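/- Theorem (stable shuffle theorem). Let $l\ge 1$, let $q,t$ be indeterminates, and let $S_l$ act on weights in $\mathbb Z^l$ and on rational functions in $x_1,\dots,x_l$ by $(w\lambda)_{w(i)}=\lambda_i$, $w(x_i)=x_{w(i)}$, so that $w(x^\lambda)=x^{w\lambda}$. *Characters.* Let $\boldsymbol\sigma(f)=\sum_{w\in S_l}w\bigl(f/\prod_{i<j}(1-x_j/x_i)\bigr)$ be the Weyl symmetrization. For a dominant weight $\lambda$ ($\lambda_1\ge\dots\ge\lambda_l$) let $\chi_\lambda=\boldsymbol\sigma(x^\lambda)$ be the irreducible $GL_l$ character. For a Laurent polynomial $\phi$ over $\mathbb Q(q)$ put $$\mathbf H_q(\phi)=\boldsymbol\sigma\Bigl(\phi\big/\prod_{i<j}(1-q\,x_i/x_j)\Bigr),$$ an infinite formal sum of irreducible characters, where the factors $1/(1-q\,x_i/x_j)$ are expanded as geometric series and $\boldsymbol\sigma$ is applied term by term. For $\mathbf b\in\mathbb Z^l$ define $$\mathcal H_{\mathbf b}(x)=\mathbf H_q\Bigl(x^{\mathbf b}\,\frac{\prod_{i+1<j}(1-q\,t\,x_i/x_j)}{\prod_{i<j}(1-t\,x_i/x_j)}\Bigr),$$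 where the argument is expanded as a power series in $t$ and $\mathbf H_q$ is applied to each coefficient. *LLT series.* For $1\le i<l$ let $s_i=(i\;\,i{+}1)$ and $T_i=q\,s_i+(1-q)\frac{1}{1-x_{i+1}/x_i}(s_i-1)$, and let $T_w=T_{i_1}\cdots T_{i_m}$ for any reduced expression $w=s_{i_1}\cdots s_{i_m}$, with $\ell(w)=m$. For $\lambda\in\mathbb Z^l$ let $\lambda_+$ be the dominant weight in its orbit and let $E_\lambda(x;q)=q^{-\ell(w)}T_w x^{\lambda_+}$, where $\lambda=w(\lambda_+)$. For $\pi\in S_l$ let $$E^{\pi}_\lambda(x;q)=q^{e}\,T_{\pi^{-1}}^{-1}E_{\pi^{-1}(\lambda)}(x;q),\qquad e=\#\{i<j:\ \pi^{-1}(i)>\pi^{-1}(j),\ \lambda_i\ge\lambda_j\}.$$ For fixed $\pi$ the $E^\pi_\lambda$ form a basis of the Laurent polynomials. For $\alpha,\beta\in\mathbb Z^l$ and $\sigma\in S_l$, let $\mathcal L^{\sigma}_{\beta/\alpha}(x;q)$ be the infinite formal sum of irreducible characters in which the coefficient of $\chi_\lambda$ is the coefficient of $E^{\sigma^{-1}}_\beta(x;q^{-1})$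 in the expansion of $\chi_\lambda\cdot E^{\sigma^{-1}}_\alpha(x;q^{-1})$ in the basis $\{E^{\sigma^{-1}}_\gamma(x;q^{-1})\}_\gamma$. *Statement.* Let $p,s$ be real numbers with $p$ positive and irrational. For $i=1,\dots,l$ let $$b_i=\lfloor s-p(i-1)\rfloor-\lfloor s-pi\rfloor,\qquad c_i=(s-p(i-1))-\lfloor s-p(i-1)\rfloor,$$ and let $\sigma\in S_l$ be the permutation such that $\sigma(1),\dots,\sigma(l)$ are in the same relative order as $c_l,\dots,c_1$. Then for all non-negative integers $u,v$, $$\mathcal H_{b_1+u,\,b_2,\dots,b_{l-1},\,b_l-v}(x)=\sum_{a_1,\dots,a_{l-1}\ge 0}t^{a_1+\cdots+a_{l-1}}\,\mathcal L^{\sigma}_{((b_l,\dots,b_1)+(-v,a_{l-1},\dots,a_1))/(a_{l-1},\dots,a_1,-u)}(x;q),$$ an identity of formal power series in $t$ whose coefficients are infinite formal sums of irreducible $GL_l$ characters over $\mathbb Q(q)$. (For $l=1$ the index on the left is $b_1+u-v$, and the right side is the single term $\mathcal L^{\sigma}_{(b_1-v)/(-u)}$.) -/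

import Mathlib

noncomputable section

namespace StableShuffle

open Equiv Finset

/-! Throughout, `l = n + 1 ≥ 1` is the number of variables `x_1, …, x_l`, which are indexed by
`Fin (n + 1)` (so `x_i` has index `i - 1`), and `q` is an element of the ground field `K`. -/

/-- The weight lattice `X = ℤ^l` of `GL_l`. -/
abbrev Weight (n : ℕ) := Fin (n + 1) → ℤ

/-- The algebra `K[x_1^{±1}, …, x_l^{±1}]` of Laurent polynomials: the group algebra of `ℤ^l`. -/
abbrev Laurent (K : Type) [Field K] (n : ℕ) := AddMonoidAlgebra K (Weight n)

/-- The field `K(x_1, …, x_l)` of rational functions, the fraction field of the Laurent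
polynomials. Laurent polynomials are regarded as elements of this field. -/
abbrev RatFn (K : Type) [Field K] (n : ℕ) := FractionRing (Laurent K n)

/-- The action of `S_l` on weights, `(w λ)_{w(i)} = λ_i`. -/
def permWeight {n : ℕ} (w : Perm (Fin (n + 1))) : Weight n ≃+ Weight n :=
  AddEquiv.arrowCongr w (AddEquiv.refl ℤ)

/-- The simple transposition `s_{i+1}`, exchanging
the indices `i` and `i + 1` of `Fin (n + 1)`. -/
def simple {n : ℕ} (i : Fin n) : Perm (Fin (n + 1)) := swap i.castSucc i.succ

/-- `L` is a reduced expression of `w`: a word in the simple transpositions with product `w`, of the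
smallest possible length. -/
def IsReducedWord {n : ℕ} (w : Perm (Fin (n + 1))) (L : List (Fin n)) : Prop :=
  (L.map simple).prod = w ∧
    ∀ L' : List (Fin n), (L'.map simple).prod = w → L.length ≤ L'.length

theorem exists_isReducedWord {n : ℕ} (w : Perm (Fin (n + 1))) : ∃ L, IsReducedWord w L := by
  classical
  have hne : ∃ m, ∃ L : List (Fin n), (L.map simple).prod = w ∧ L.length = m := by
    have hw : w ∈ Submonoid.closure (Set.range (simple : Fin n → Perm (Fin (n + 1)))) := by
      have h := Perm.mclosure_swap_castSucc_succ n
      have h' : (fun i : Fin n => swap i.castSucc i.succ) = simple := rfl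
      rw [h'] at h
      rw [h]
      trivial
    induction hw using Submonoid.closure_induction with
    | mem x hx =>
      obtain ⟨i, rfl⟩ := hx
      exact ⟨1, [i], by simp, rfl⟩
    | one => exact ⟨0, [], by simp, rfl⟩
    | mul x y _ _ hx hy =>
      obtain ⟨_, L₁, h₁, -⟩ := hx
      obtain ⟨_, L₂, h₂, -⟩ := hy
      exact ⟨_, L₁ ++ L₂, by simp [h₁, h₂], rfl⟩
  obtain ⟨L, hL, hlen⟩ := Nat.find_spec hne
  refine ⟨L, hL, fun L' hL' => ?_⟩
  rw [hlen]
  exact Nat.find_min' hne ⟨L', hL', rfl⟩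

/-- A reduced expression of `w`. -/
def reducedWord {n : ℕ} (w : Perm (Fin (n + 1))) : List (Fin n) :=
  (exists_isReducedWord w).choose

/-- The length `ℓ(w)`. -/
def len {n : ℕ} (w : Perm (Fin (n + 1))) : ℕ := (reducedWord w).length

/-- The dominant weights `λ_1 ≥ ⋯ ≥ λ_l`. -/
abbrev DomWeight (n : ℕ) := {μ : Weight n // Antitone μ}

/-- Infinite formal sums `∑_λ c_λ χ_λ` of irreducible `GL_l` characters with coefficients in `R`,
given by the coefficient function `λ ↦ c_λ` on the dominant weights. -/
abbrev CharSeries (n : ℕ) (R : Type) := DomWeight n → R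

/-- The coefficient function of `f` in terms of the family `v`: the coefficients `c` in the
expansion `f = ∑ c_i v_i` as a finite linear combination. It is applied only to linearly independent
families `v` and to elements `f` of their span, where `c` exists and is unique. -/
def expansion {K M ι : Type} [Field K] [AddCommGroup M] [Module K M] (v : ι → M) (f : M) :
    ι →₀ K :=
  Classical.epsilon fun c : ι →₀ K => Finsupp.linearCombination K v c = f

section Operators

variable {K : Type} [Field K] {n : ℕ}

/-- The monomial `x^μ`. -/
def mono (μ : Weight n) : RatFn K n :=
  algebraMap (Laurent K n) (RatFn K n) (AddMonoidAlgebra.single μ 1)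

/-- The variable `x_{i+1}`. -/
def var (i : Fin (n + 1)) : RatFn K n := mono (Pi.single i 1)

/-- The action of `S_l` on rational functions by permuting the variables, `w(x_i) = x_{w(i)}`. -/
def permRatFn (w : Perm (Fin (n + 1))) : RatFn K n ≃ₐ[K] RatFn K n :=
  IsFractionRing.algEquivOfAlgEquiv (AddMonoidAlgebra.domCongr K K (permWeight w))

/-- The Weyl symmetrization `σ(f) = ∑_{w ∈ S_l} w (f / ∏_{i<j} (1 - x_j / x_i))`. -/
def weylSym (f : RatFn K n) : RatFn K n :=
  ∑ w : Perm (Fin (n + 1)),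
    permRatFn w (f / ∏ i : Fin (n + 1), ∏ j ∈ Ioi i, (1 - var j / var i))

/-- The irreducible character `χ_μ = σ(x^μ)`, for `μ` dominant, by the Weyl character formula. -/
def irrChar (μ : DomWeight n) : RatFn K n := weylSym (mono μ.1)

/-- The coefficient `⟨χ_μ⟩ f` of `χ_μ` in a virtual character `f`. -/
def irrCoeff (f : RatFn K n) (μ : DomWeight n) : K :=
  expansion (K := K) (irrChar (K := K) (n := n)) f μ

/-- The Hall–Littlewood symmetrization
`H_q(φ) = σ(φ / ∏_{i<j} (1 - q x_i / x_j))` of a Laurent polynomial `φ`, as an infinite formal sum of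
irreducible characters. The factors `1 / (1 - q x_i / x_j)` are expanded as geometric series, whose
product has the terms `∏_{i<j} (q x_i / x_j) ^ m_{ij}`, and `σ` is applied term by term. For each
`μ` only finitely many of the terms contribute to the coefficient of `χ_μ`. -/
def hallLittlewoodSym (q : K) (φ : RatFn K n) : CharSeries n K := fun μ =>
  ∑ᶠ m : {p : Fin (n + 1) × Fin (n + 1) // p.1 < p.2} → ℕ,
    irrCoeff (weylSym (φ * ∏ p, (algebraMap K (RatFn K n) q * (var p.1.1 / var p.1.2)) ^ m p)) μ

/-- The power series in `t`
`x^b ∏_{i+1<j} (1 - q t x_i / x_j) / ∏_{i<j} (1 - t x_i / x_j)`,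
whose coefficients are Laurent polynomials. -/
def catalanSeries (q : K) (b : Weight n) : PowerSeries (RatFn K n) :=
  PowerSeries.C (mono b) *
    (∏ i : Fin (n + 1), ∏ j ∈ univ.filter (fun j : Fin (n + 1) => (i : ℕ) + 1 < j),
      (1 - PowerSeries.C (algebraMap K (RatFn K n) q * (var i / var j)) * PowerSeries.X)) *
    (∏ i : Fin (n + 1), ∏ j ∈ Ioi i,
      (1 - PowerSeries.C (var i / var j : RatFn K n) * PowerSeries.X))⁻¹

/-- The infinite series of `GL_l` characters
`H_b(x) = H_q(x^b ∏_{i+1<j} (1 - q t x_i / x_j) / ∏_{i<j} (1 - t x_i / x_j))`,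
with coefficients formal power series in `t`: `H_q` is applied to the coefficient of each `t^d`. -/
def catalanH (q : K) (b : Weight n) : CharSeries n (PowerSeries K) := fun μ =>
  PowerSeries.mk fun d => hallLittlewoodSym q (PowerSeries.coeff d (catalanSeries q b)) μ

/-- The Demazure–Lusztig operator
`T_i = q s_i + (1 - q) (1 / (1 - x_{i+1} / x_i)) (s_i - 1)`. -/
def heckeGen (q : K) (i : Fin n) : Module.End K (RatFn K n) :=
  q • (permRatFn (simple i)).toLinearMap +
    (1 - q) • (LinearMap.mulLeft K (1 / (1 - var i.succ / var i.castSucc)) *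
      ((permRatFn (simple i)).toLinearMap - 1))

/-- `T_w = T_{i_1} ⋯ T_{i_m}`, for a reduced expression `w = s_{i_1} ⋯ s_{i_m}`. -/
def heckeT (q : K) (w : Perm (Fin (n + 1))) : Module.End K (RatFn K n) :=
  ((reducedWord w).map (heckeGen q)).prod

/-- A permutation `w` such that `w⁻¹ μ` is dominant. -/
def sortPerm (μ : Weight n) : Perm (Fin (n + 1)) := Tuple.sort (fun i => -μ i)

/-- The dominant weight `μ_+` in the orbit of `μ`; thus `μ = w μ_+` for `w = sortPerm μ`. -/
def domRep (μ : Weight n) : Weight n := permWeight (sortPerm μ)⁻¹ μ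

/-- The non-symmetric Hall–Littlewood polynomial `E_μ(x; q) = q^{-ℓ(w)} T_w x^{μ_+}`, where
`μ = w μ_+`. -/
def nsHL (q : K) (μ : Weight n) : RatFn K n :=
  (q ^ len (sortPerm μ))⁻¹ • heckeT q (sortPerm μ) (mono (domRep μ))

/-- The number `|Inv(σ⁻¹) ∩ Inv(μ + ε ρ)|` of pairs `i < j` with `σ⁻¹(i) > σ⁻¹(j)` and
`μ_i ≥ μ_j`. -/
def twistExponent (σ : Perm (Fin (n + 1))) (μ : Weight n) : ℕ :=
  #{p : Fin (n + 1) × Fin (n + 1) | p.1 < p.2 ∧ σ⁻¹ p.2 < σ⁻¹ p.1 ∧ μ p.2 ≤ μ p.1}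

/-- The twisted non-symmetric Hall–Littlewood polynomial
`E^σ_μ(x; q) = q^{|Inv(σ⁻¹) ∩ Inv(μ + ε ρ)|} T_{σ⁻¹}^{-1} E_{σ⁻¹(μ)}(x; q)`.
The operator `T_{σ⁻¹}` is invertible for `q ≠ 0`. -/
def twistedHL (q : K) (σ : Perm (Fin (n + 1))) (μ : Weight n) : RatFn K n :=
  q ^ twistExponent σ μ • Ring.inverse (heckeT q σ⁻¹) (nsHL q (permWeight σ⁻¹ μ))

/-- The LLT series `L^σ_{β/α}(x; q)`, the infinite formal sum of irreducible characters in which the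
coefficient of `χ_μ` is the coefficient of `E^{σ⁻¹}_β(x; q⁻¹)` in the expansion of
`χ_μ E^{σ⁻¹}_α(x; q⁻¹)` in the basis `{E^{σ⁻¹}_γ(x; q⁻¹)}` of the Laurent polynomials. -/
def lltSeries (q : K) (σ : Perm (Fin (n + 1))) (β α : Weight n) : CharSeries n K := fun μ =>
  expansion (K := K) (fun γ : Weight n => twistedHL q⁻¹ σ⁻¹ γ)
    (irrChar μ * twistedHL q⁻¹ σ⁻¹ α) β

end Operators

end StableShuffle

end

/-!
The proof transports both sides of the identity to constant terms of Laurent polynomials.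

*Pairing.* Let `ctDelta q f` be the constant term of `f ∏_{i<j} (1 - x_i/x_j) / (1 - q x_i/x_j)`,
the denominators being expanded as geometric series. By the Weyl character formula the coefficient
of `χ_μ` in `H_q(φ)` is `ctDelta q` of `χ_μ` times the image of `φ` under `x_i ↦ 1 / x_{l+1-i}`
(`hallLittlewoodSym_eq`). The Demazure–Lusztig operators are self-adjoint for this pairing
(`ctDelta_heckeU_mul`).

*Polynomials.* For a weight `w` and a real vector `r`, `genHL q w r` is the polynomial obtained from
a monomial by the Hecke operators which sort `r`; each step is an operator `U = q T` or `V = T⁻¹`,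
according to the order of the entries of `c = r - w`. If the entries of `c` are distinct and differ
by less than `1`, then for fixed `c` the `genHL q w (w + c)` are the twisted non-symmetric
Hall–Littlewood polynomials for the permutation with the relative order of `c` (`twistedHL_eq`).
The real vector makes two features visible: a shift of `w` by `b` together with a shift of `r` by a
constant multiplies the polynomial by `x^b` (`genHL_shift`), which is the rotation
`c_{i+1} = c_i + b_i - p` of the fractional parts in the theorem; and an extreme first or last
weight splits off as a power of the first or last variable (`genHL_succ`, `genHL_castSucc`).

*Duality.* The `genHL q w (w + c)` and `genHL q (-w) (-(w + c))` are dual bases for the pairing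
(`ortho`). By adjointness one may permute the entries of `c`, and by shifts rotate them, until the
largest entry of `w + c` sits in first or last position, where either a degree argument applies or
one variable can be removed. Hence the coefficients of the LLT series are
`ctDelta q (χ_μ E_α E*_β)` (`lltSeries_eq`).

*Cauchy identity.* With the splitting and shift properties, the sum over `a` on the right hand side
becomes a monomial times `∑_a t^{|a|} E_a(x_1, …, x_{l-1}) E*_a(x_2, …, x_l)`. This sum has the
closed form `∏_{i+1<j} (1 - q t x_i/x_j) / ∏_{i<j} (1 - t x_i/x_j)` (`cauchy`): the elements dual
to the monomials with non-negative exponents can be written down explicitly, and their generating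
function is a product (`sum_dualMono`).
-/

noncomputable section

namespace StableShuffle

open Equiv Finset

/-! ### Laurent polynomials and monomial substitutions -/

/-- Laurent polynomials in variables indexed by an arbitrary type `ι`. -/
abbrev Lau (K ι : Type) [Field K] := AddMonoidAlgebra K (ι → ℤ)

section Basics

variable {K : Type} [Field K] {ι κ μ : Type}

/-- The monomial `x^γ`. -/
def xp (γ : ι → ℤ) : Lau K ι := AddMonoidAlgebra.single γ 1

theorem xp_add (γ δ : ι → ℤ) : (xp (γ + δ) : Lau K ι) = xp γ * xp δ := by
  simp [xp, AddMonoidAlgebra.single_mul_single]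

@[simp] theorem xp_zero : (xp (0 : ι → ℤ) : Lau K ι) = 1 := rfl

theorem xp_mul_neg (γ : ι → ℤ) : (xp γ : Lau K ι) * xp (-γ) = 1 := by
  rw [← xp_add, add_neg_cancel, xp_zero]

theorem xp_pow (γ : ι → ℤ) (k : ℕ) : (xp γ : Lau K ι) ^ k = xp (k • γ) := by
  simp [xp, AddMonoidAlgebra.single_pow]

theorem coeff_xp [DecidableEq ι] [Fintype ι] (γ δ : ι → ℤ) :
    (xp γ : Lau K ι).coeff δ = if γ = δ then 1 else 0 := by
  simp [xp, Finsupp.single_apply]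

theorem xp_ne_zero (γ : ι → ℤ) : (xp γ : Lau K ι) ≠ 0 := by
  simp [xp]

theorem xp_injective : Function.Injective (xp : (ι → ℤ) → Lau K ι) := by
  intro a b h
  simpa [xp, AddMonoidAlgebra.single_inj] using h

theorem one_sub_xp_ne_zero {γ : ι → ℤ} (h : γ ≠ 0) : (1 - xp γ : Lau K ι) ≠ 0 := by
  rw [← xp_zero, sub_ne_zero]
  exact fun e => h (xp_injective e).symm

theorem coeff_xp_mul (γ : ι → ℤ) (f : Lau K ι) (δ : ι → ℤ) :
    (xp γ * f).coeff (γ + δ) = f.coeff δ := by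
  simp [xp, AddMonoidAlgebra.coeff_single_mul_apply]

theorem smul_xp_eq_single (γ : ι → ℤ) (c : K) :
    c • (xp γ : Lau K ι) = AddMonoidAlgebra.single γ c := by
  simp [xp]

theorem lau_eq_sum (f : Lau K ι) : f = ∑ γ ∈ f.coeff.support, f.coeff γ • xp γ := by
  conv_lhs => rw [← AddMonoidAlgebra.sum_coeff_single f]
  simp [Finsupp.sum, smul_xp_eq_single]

theorem lau_ext {M : Type*} [AddCommGroup M] [Module K M] {f g : Lau K ι →ₗ[K] M}
    (h : ∀ γ, f (xp γ) = g (xp γ)) : f = g := by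
  refine LinearMap.ext fun x => ?_
  rw [lau_eq_sum x]
  simp [h]

theorem lau_induction {P : Lau K ι → Prop} (f : Lau K ι) (hx : ∀ γ, P (xp γ))
    (hadd : ∀ f g, P f → P g → P (f + g)) (hsmul : ∀ (c : K) f, P f → P (c • f)) : P f := by
  rw [lau_eq_sum f]
  refine Finset.sum_induction _ _ hadd ?_ fun γ _ => hsmul _ _ (hx γ)
  simpa using hsmul 0 _ (hx 0)

/-- The substitution of monomials `x^γ ↦ x^{φ γ}` attached to a homomorphism of weight lattices. -/
def mapX (φ : (ι → ℤ) →+ (κ → ℤ)) : Lau K ι →ₐ[K] Lau K κ :=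
  AddMonoidAlgebra.mapDomainAlgHom K K φ

@[simp] theorem mapX_xp (φ : (ι → ℤ) →+ (κ → ℤ)) (γ : ι → ℤ) :
    mapX φ (xp γ : Lau K ι) = xp (φ γ) := by
  simp [mapX, xp]

theorem mapX_comp (φ : (ι → ℤ) →+ (κ → ℤ)) (ψ : (κ → ℤ) →+ (μ → ℤ)) (f : Lau K ι) :
    mapX ψ (mapX φ f) = mapX (ψ.comp φ) f := by
  induction f using lau_induction with
  | hx γ => simp
  | hadd f g hf hg => simp [hf, hg]
  | hsmul c f hf => simp [hf]

theorem mapX_id (f : Lau K ι) : mapX (AddMonoidHom.id _) f = f := by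
  induction f using lau_induction with
  | hx γ => simp
  | hadd f g hf hg => simp [hf, hg]
  | hsmul c f hf => simp [hf]

theorem coeff_mapX (φ : (ι → ℤ) →+ (κ → ℤ)) (hφ : Function.Injective φ) (f : Lau K ι)
    (γ : ι → ℤ) : (mapX φ f).coeff (φ γ) = f.coeff γ := by
  show (AddMonoidAlgebra.mapDomain φ f).coeff _ = _
  exact Finsupp.mapDomain_apply hφ _ _

/-- Reindexing of exponents along a map of index sets. -/
def reidx (e : κ → ι) : (ι → ℤ) →+ (κ → ℤ) where
  toFun γ := γ ∘ e
  map_zero' := rfl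
  map_add' _ _ := rfl

@[simp] theorem reidx_apply (e : κ → ι) (γ : ι → ℤ) : reidx e γ = γ ∘ e := rfl

/-- Extension of exponents by zero along an injection of index sets. -/
def extz (e : ι → κ) : (ι → ℤ) →+ (κ → ℤ) where
  toFun γ := Function.extend e γ 0
  map_zero' := by
    funext k
    by_cases h : ∃ i, e i = k <;> simp [Function.extend, h]
  map_add' a b := by
    have := Function.extend_add e a b (0 : κ → ℤ) 0
    simpa using this

theorem extz_apply (e : ι → κ) (he : Function.Injective e) (γ : ι → ℤ) (i : ι) :
    extz e γ (e i) = γ i := he.extend_apply _ _ _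

theorem extz_of_notMem (e : ι → κ) (γ : ι → ℤ) (k : κ) (hk : ∀ i, e i ≠ k) :
    extz e γ k = 0 := by
  simp only [extz, AddMonoidHom.coe_mk, ZeroHom.coe_mk]
  rw [Function.extend_apply' _ _ _ (by simpa using hk)]
  rfl

theorem extz_injective (e : ι → κ) (he : Function.Injective e) :
    Function.Injective (extz e) := by
  intro a b h
  ext i
  rw [← extz_apply e he a i, h, extz_apply e he]

/-- Laurent polynomials all of whose exponents lie in `S`. -/
abbrev suppIn (K : Type) [Field K] (S : Set (ι → ℤ)) : Submodule K (Lau K ι) :=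
  AddMonoidAlgebra.supported K K S

theorem mem_suppIn {S : Set (ι → ℤ)} {f : Lau K ι} :
    f ∈ suppIn K S ↔ ∀ γ ∉ S, f.coeff γ = 0 := AddMonoidAlgebra.mem_supported'

theorem xp_mem_suppIn {S : Set (ι → ℤ)} {γ : ι → ℤ} (h : γ ∈ S) : (xp γ : Lau K ι) ∈ suppIn K S := by
  classical
  rw [mem_suppIn]
  intro δ hδ
  have : γ ≠ δ := fun e => hδ (e ▸ h)
  simp [xp, this]

theorem suppIn_mono {S T : Set (ι → ℤ)} (h : S ⊆ T) : suppIn K S ≤ suppIn K T :=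
  AddMonoidAlgebra.supported_mono h

/-- A linear map sends `suppIn S` into a submodule as soon as it does so on the monomials. -/
theorem map_mem_of_suppIn {M : Type*} [AddCommGroup M] [Module K M] {S : Set (ι → ℤ)}
    {P : Submodule K M} (L : Lau K ι →ₗ[K] M) (hL : ∀ γ ∈ S, L (xp γ) ∈ P) {f : Lau K ι}
    (hf : f ∈ suppIn K S) : L f ∈ P := by
  rw [lau_eq_sum f, map_sum]
  refine Submodule.sum_mem _ fun γ hγ => ?_
  rw [map_smul]
  exact P.smul_mem _ (hL γ (hf hγ))

theorem mul_mem_suppIn {S T U : Set (ι → ℤ)} (h : ∀ a ∈ S, ∀ b ∈ T, a + b ∈ U) {f g : Lau K ι}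
    (hf : f ∈ suppIn K S) (hg : g ∈ suppIn K T) : f * g ∈ suppIn K U := by
  refine map_mem_of_suppIn (LinearMap.mulRight K g) (fun a ha => ?_) hf
  refine map_mem_of_suppIn (LinearMap.mulLeft K (xp a)) (fun b hb => ?_) hg
  simp only [LinearMap.mulLeft_apply, ← xp_add]
  exact xp_mem_suppIn (h a ha b hb)

theorem mapX_mem_suppIn (φ : (ι → ℤ) →+ (κ → ℤ)) {S : Set (ι → ℤ)} {T : Set (κ → ℤ)}
    (h : ∀ a ∈ S, φ a ∈ T) {f : Lau K ι} (hf : f ∈ suppIn K S) : mapX φ f ∈ suppIn K T :=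
  map_mem_of_suppIn (mapX φ).toLinearMap (fun a ha => by simpa using xp_mem_suppIn (h a ha)) hf

/-- The constant term. -/
def ct : Lau K ι →ₗ[K] K :=
  Finsupp.lapply 0 ∘ₗ (AddMonoidAlgebra.coeffLinearEquiv K).toLinearMap

theorem ct_apply (f : Lau K ι) : ct f = f.coeff 0 := rfl

theorem ct_xp_of_ne {γ : ι → ℤ} (h : γ ≠ 0) : ct (xp γ : Lau K ι) = 0 := by
  classical
  simp [ct_apply, xp, h]

theorem ct_one : ct (1 : Lau K ι) = 1 := by
  simp [ct_apply, AddMonoidAlgebra.one_def]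

theorem ct_mapX (φ : (ι → ℤ) →+ (κ → ℤ)) (hφ : Function.Injective φ) (f : Lau K ι) :
    ct (mapX φ f) = ct f := by
  rw [ct_apply, ct_apply, ← coeff_mapX φ hφ f 0, map_zero φ]

theorem ct_eq_zero {S : Set (ι → ℤ)} (h0 : (0 : ι → ℤ) ∉ S) {f : Lau K ι} (hf : f ∈ suppIn K S) :
    ct f = 0 := mem_suppIn.1 hf 0 h0

theorem ct_xp_neg_mul (γ : ι → ℤ) (f : Lau K ι) : ct (xp (-γ) * f) = f.coeff γ := by
  rw [ct_apply, ← coeff_xp_mul (-γ) f γ, neg_add_cancel]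

/-- The exponent of `x_a / x_b`. -/
def root [DecidableEq ι] (a b : ι) : ι → ℤ := Pi.single a 1 - Pi.single b 1

theorem neg_root [DecidableEq ι] (a b : ι) : -root a b = root b a := by simp [root]

theorem reidx_root [DecidableEq ι] (w : Perm ι) (a b : ι) :
    reidx w (root a b) = root (w⁻¹ a) (w⁻¹ b) := by
  funext i
  simp only [reidx_apply, root, Function.comp, Pi.sub_apply, Pi.single_apply]
  simp only [← Equiv.Perm.eq_inv_iff_eq]

theorem extz_single [DecidableEq ι] [DecidableEq κ] (e : ι → κ) (he : Function.Injective e) (a : ι)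
    (n : ℤ) : extz e (Pi.single a n) = Pi.single (e a) n := by
  funext k
  by_cases h : ∃ i, e i = k
  · obtain ⟨i, rfl⟩ := h
    rw [extz_apply e he]
    simp [Pi.single_apply, he.eq_iff]
  · push Not at h
    rw [extz_of_notMem e _ k h, Pi.single_apply, if_neg (fun hh => h a hh.symm)]

theorem extz_root [DecidableEq ι] [DecidableEq κ] (e : ι → κ) (he : Function.Injective e)
    (a b : ι) : extz e (root a b) = root (e a) (e b) := by
  simp [root, extz_single e he]

end Basics

/-! ### Demazure–Lusztig operators on Laurent polynomials -/

section Ops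

variable {K : Type} [Field K] {ι κ : Type} [DecidableEq ι] [DecidableEq κ]

/-- The exchange of the variables `x_a` and `x_b`. -/
def sw (a b : ι) : Lau K ι →ₐ[K] Lau K ι := mapX (reidx (swap a b))

@[simp] theorem sw_xp (a b : ι) (γ : ι → ℤ) : sw a b (xp γ : Lau K ι) = xp (γ ∘ swap a b) := by
  simp [sw]

theorem sw_sw (a b : ι) (f : Lau K ι) : sw a b (sw a b f) = f := by
  rw [sw, mapX_comp]
  convert mapX_id f
  ext γ i
  simp

/-- The divided difference `(s - 1) / (1 - x_b / x_a)` on a monomial. -/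
def divDiffMono (a b : ι) (γ : ι → ℤ) : Lau K ι :=
  (∑ k ∈ range (γ b - γ a).toNat, xp (γ + (k + 1) • root a b)) -
    ∑ k ∈ range (γ a - γ b).toNat, xp (γ - k • root a b)

/-- The divided difference `f ↦ (s f - f) / (1 - x_b / x_a)`, where `s` exchanges `x_a` and
`x_b`. -/
def divDiff (a b : ι) : Lau K ι →ₗ[K] Lau K ι :=
  Finsupp.linearCombination K (divDiffMono a b) ∘ₗ
    (AddMonoidAlgebra.coeffLinearEquiv K).toLinearMap

theorem divDiff_xp (a b : ι) (γ : ι → ℤ) : divDiff a b (xp γ : Lau K ι) = divDiffMono a b γ := by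
  simp [divDiff, xp]

theorem comp_swap_eq (a b : ι) (γ : ι → ℤ) : γ ∘ swap a b = γ + (γ b - γ a) • root a b := by
  funext i
  simp only [Function.comp, Pi.add_apply, Pi.smul_apply, root, Pi.sub_apply, Pi.single_apply,
    smul_eq_mul]
  rcases eq_or_ne i a with rfl | ha
  · rcases eq_or_ne i b with rfl | hb
    · simp
    · simp [hb]
  · rcases eq_or_ne i b with rfl | hb
    · simp [ha]
    · simp [ha, hb, swap_apply_of_ne_of_ne ha hb]

theorem mul_divDiff (a b : ι) (f : Lau K ι) :
    (1 - xp (root b a)) * divDiff a b f = sw a b f - f := by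
  have key : LinearMap.mulLeft K (1 - xp (root b a)) ∘ₗ divDiff a b =
      (sw a b : Lau K ι →ₐ[K] Lau K ι).toLinearMap - LinearMap.id := by
    refine lau_ext fun γ => ?_
    simp only [LinearMap.comp_apply, divDiff_xp, LinearMap.mulLeft_apply, LinearMap.sub_apply,
      AlgHom.toLinearMap_apply, sw_xp, LinearMap.id_apply, comp_swap_eq]
    rw [divDiffMono, mul_sub, sub_mul, sub_mul, one_mul, one_mul, mul_sum, mul_sum]
    simp only [← xp_add, ← neg_root a b]
    rcases le_total (γ a) (γ b) with h | h
    · have e : (γ a - γ b).toNat = 0 := by omega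
      rw [e]
      obtain ⟨m, hm⟩ : ∃ m : ℕ, γ b - γ a = m := ⟨(γ b - γ a).toNat, by omega⟩
      rw [hm, Int.toNat_natCast, ← sum_sub_distrib]
      simp only [range_zero, sum_empty, sub_zero]
      have := Finset.sum_range_sub (fun k : ℕ => (xp (γ + k • root a b) : Lau K ι)) m
      simp only [zero_smul, add_zero] at this
      rw [natCast_zsmul, ← this]
      refine sum_congr rfl fun k _ => ?_
      congr 2
      rw [add_smul, one_smul]
      abel
    · have e : (γ b - γ a).toNat = 0 := by omega
      rw [e]
      obtain ⟨m, hm⟩ : ∃ m : ℕ, γ a - γ b = m := ⟨(γ a - γ b).toNat, by omega⟩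
      have hm' : γ b - γ a = -(m : ℤ) := by omega
      rw [hm, hm', Int.toNat_natCast, ← sum_sub_distrib]
      simp only [range_zero, sum_empty, zero_sub]
      have := Finset.sum_range_sub (fun k : ℕ => (xp (γ - k • root a b) : Lau K ι)) m
      simp only [zero_smul, sub_zero] at this
      rw [neg_smul, natCast_zsmul, ← sub_eq_add_neg, ← this, neg_sub, sum_sub_distrib]
      congr 1
      refine sum_congr rfl fun k _ => ?_
      congr 1
      rw [add_smul, one_smul]
      abel
  simpa using LinearMap.congr_fun key f

theorem root_ne_zero {a b : ι} (h : a ≠ b) : root a b ≠ 0 := by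
  intro e
  have := congrFun e a
  simp [root, h] at this

/-- Divided differences of monomials have exponents between `γ` and `s γ`, excluding the smaller
value at `a`. -/
theorem divDiff_xp_mem {a b : ι} (hab : a ≠ b) (γ : ι → ℤ) :
    divDiff a b (xp γ : Lau K ι) ∈ suppIn K {δ : ι → ℤ | (∀ i, i ≠ a → i ≠ b → δ i = γ i) ∧
      δ a + δ b = γ a + γ b ∧ min (γ a) (γ b) < δ a ∧ min (γ a) (γ b) ≤ δ b} := by
  rw [divDiff_xp, divDiffMono]
  refine Submodule.sub_mem _ (Submodule.sum_mem _ fun k hk => xp_mem_suppIn ?_)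
    (Submodule.sum_mem _ fun k hk => xp_mem_suppIn ?_)
  all_goals
    rw [mem_range] at hk
    refine ⟨fun i ha hb => ?_, ?_, ?_, ?_⟩
    · simp [root, ha, hb]
    · simp [root, hab, hab.symm] <;> ring
    · simp [root, hab] <;> omega
    · simp [root, hab.symm] <;> omega

theorem divDiff_mapX {a b : ι} {a' b' : κ} (hab : a' ≠ b') (φ : (ι → ℤ) →+ (κ → ℤ))
    (hφ : ∀ γ, φ (γ ∘ swap a b) = φ γ ∘ swap a' b') (hr : φ (root b a) = root b' a')
    (f : Lau K ι) : divDiff a' b' (mapX φ f) = mapX φ (divDiff a b f) := by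
  have hsw : sw a' b' (mapX φ f) = mapX φ (sw a b f) := by
    rw [sw, sw, mapX_comp, mapX_comp]
    congr 2
    ext1 γ
    simp [hφ]
  apply mul_left_cancel₀ (one_sub_xp_ne_zero (K := K) (root_ne_zero hab.symm))
  have e : (1 - xp (root b' a') : Lau K κ) = mapX φ (1 - xp (root b a)) := by simp [hr]
  rw [mul_divDiff, hsw, e, ← map_mul, mul_divDiff, map_sub]

theorem divDiff_mul_of_sw_eq {a b : ι} (hab : a ≠ b) {g : Lau K ι} (hg : sw a b g = g)
    (f : Lau K ι) : divDiff a b (g * f) = g * divDiff a b f := by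
  apply mul_left_cancel₀ (one_sub_xp_ne_zero (K := K) (root_ne_zero hab.symm))
  rw [mul_divDiff, map_mul, hg, mul_left_comm, mul_divDiff]
  ring

theorem sw_xp_root (a b : ι) : sw a b (xp (root b a) : Lau K ι) = xp (root a b) := by
  rw [sw_xp]
  congr 1
  have := reidx_root (swap a b) b a
  simpa using this

theorem xp_root_mul (a b : ι) : (xp (root a b) : Lau K ι) * xp (root b a) = 1 := by
  rw [← neg_root a b, xp_mul_neg]

variable {a b : ι}

theorem sw_divDiff (hab : a ≠ b) (f : Lau K ι) :
    sw a b (divDiff a b f) = xp (root b a) * divDiff a b f := by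
  have h := congrArg (sw a b) (mul_divDiff a b f)
  rw [map_mul, map_sub, map_sub, map_one, sw_xp_root, sw_sw] at h
  have hx := xp_root_mul (K := K) a b
  apply mul_left_cancel₀ (one_sub_xp_ne_zero (K := K) (root_ne_zero hab))
  rw [h, sub_mul, one_mul, ← mul_assoc, hx, one_mul]
  have := mul_divDiff a b f
  rw [sub_mul, one_mul] at this
  linear_combination this

theorem divDiff_sw (hab : a ≠ b) (f : Lau K ι) : divDiff a b (sw a b f) = -divDiff a b f := by
  apply mul_left_cancel₀ (one_sub_xp_ne_zero (K := K) (root_ne_zero hab.symm))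
  rw [mul_divDiff, mul_neg, mul_divDiff, sw_sw]
  ring

theorem divDiff_divDiff (hab : a ≠ b) (f : Lau K ι) :
    divDiff a b (divDiff a b f) = -divDiff a b f := by
  apply mul_left_cancel₀ (one_sub_xp_ne_zero (K := K) (root_ne_zero hab.symm))
  rw [mul_divDiff, sw_divDiff hab]
  ring

/-- The normalized Demazure–Lusztig operator `U = q T = s + (q - 1) (s - 1) / (1 - x_b / x_a)`,
where `T` has Hecke parameter `q⁻¹`. -/
def heckeU (q : K) (a b : ι) : Module.End K (Lau K ι) :=
  (sw a b : Lau K ι →ₐ[K] Lau K ι).toLinearMap + (q - 1) • divDiff a b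

/-- The operator `V = U + (q - 1)`, which is the inverse of `T = q⁻¹ U`. -/
def heckeV (q : K) (a b : ι) : Module.End K (Lau K ι) := heckeU q a b + (q - 1) • 1

variable (q : K)

theorem heckeU_apply (f : Lau K ι) : heckeU q a b f = sw a b f + (q - 1) • divDiff a b f := rfl

theorem heckeV_apply (f : Lau K ι) : heckeV q a b f = heckeU q a b f + (q - 1) • f := rfl

theorem heckeU_heckeV (hab : a ≠ b) (f : Lau K ι) :
    heckeU q a b (heckeV q a b f) = q • f := by
  have h := mul_divDiff a b f
  rw [sub_mul, one_mul] at h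
  simp only [heckeV_apply, heckeU_apply, map_add, map_smul, sw_sw, divDiff_sw hab,
    divDiff_divDiff hab, sw_divDiff hab]
  have h' : xp (root b a) * divDiff a b f = divDiff a b f - (sw a b f - f) := by rw [← h]; ring
  rw [h']
  module

theorem heckeV_heckeU (hab : a ≠ b) (f : Lau K ι) :
    heckeV q a b (heckeU q a b f) = q • f := by
  rw [← heckeU_heckeV q hab, heckeV_apply, heckeV_apply, map_add, map_smul]

theorem heckeU_mul_of_sw_eq (hab : a ≠ b) {g : Lau K ι} (hg : sw a b g = g) (f : Lau K ι) :
    heckeU q a b (g * f) = g * heckeU q a b f := by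
  simp [heckeU_apply, divDiff_mul_of_sw_eq hab hg, hg, mul_add]

theorem heckeV_mul_of_sw_eq (hab : a ≠ b) {g : Lau K ι} (hg : sw a b g = g) (f : Lau K ι) :
    heckeV q a b (g * f) = g * heckeV q a b f := by
  simp [heckeV_apply, heckeU_mul_of_sw_eq q hab hg, mul_add]

theorem heckeU_mapX {a' b' : κ} (hab : a' ≠ b') (φ : (ι → ℤ) →+ (κ → ℤ))
    (hφ : ∀ γ, φ (γ ∘ swap a b) = φ γ ∘ swap a' b') (hr : φ (root b a) = root b' a')
    (f : Lau K ι) : heckeU q a' b' (mapX φ f) = mapX φ (heckeU q a b f) := by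
  have hsw : sw a' b' (mapX φ f) = mapX φ (sw a b f) := by
    rw [sw, sw, mapX_comp, mapX_comp]
    congr 2
    ext1 γ
    simp [hφ]
  simp [heckeU_apply, divDiff_mapX hab φ hφ hr, hsw]

theorem heckeV_mapX {a' b' : κ} (hab : a' ≠ b') (φ : (ι → ℤ) →+ (κ → ℤ))
    (hφ : ∀ γ, φ (γ ∘ swap a b) = φ γ ∘ swap a' b') (hr : φ (root b a) = root b' a')
    (f : Lau K ι) : heckeV q a' b' (mapX φ f) = mapX φ (heckeV q a b f) := by
  simp [heckeV_apply, heckeU_mapX q hab φ hφ hr]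

/-- Multiplication by a monomial with `β_b = β_a + 1` turns `V` into `U`. -/
theorem heckeU_xp_mul (hab : a ≠ b) {β : ι → ℤ} (hβ : β b = β a + 1) (f : Lau K ι) :
    heckeU q a b (xp β * f) = xp (β ∘ swap a b) * heckeV q a b f := by
  have hs : β ∘ swap a b = β + root a b := by
    rw [comp_swap_eq, hβ, add_sub_cancel_left, one_smul]
  have h := mul_divDiff a b f
  have hD : divDiff a b (xp β * f) = xp (β + root a b) * (divDiff a b f + f) := by
    apply mul_left_cancel₀ (one_sub_xp_ne_zero (K := K) (root_ne_zero hab.symm))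
    have e : (xp (β + root a b) : Lau K ι) * xp (root b a) = xp β := by
      rw [← xp_add, ← neg_root a b, add_neg_cancel_right]
    rw [mul_divDiff, map_mul, sw_xp, hs]
    linear_combination (-xp (β + root a b) : Lau K ι) * h + f * e
  simp only [heckeV_apply, heckeU_apply, map_mul, sw_xp, hD, hs]
  simp only [mul_add, mul_smul_comm, smul_add, add_assoc]

/-- Multiplication by a monomial with `β_a = β_b + 1` turns `U` into `V`. -/
theorem heckeV_xp_mul (hab : a ≠ b) {β : ι → ℤ} (hβ : β a = β b + 1) (f : Lau K ι) :
    heckeV q a b (xp β * f) = xp (β ∘ swap a b) * heckeU q a b f := by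
  have h := heckeU_xp_mul q hab (β := -β) (by simp [hβ]) (xp β * f)
  rw [← mul_assoc, mul_comm (xp (-β)), xp_mul_neg, one_mul] at h
  rw [h, ← mul_assoc, ← xp_add]
  have : β ∘ swap a b + (-β) ∘ swap a b = 0 := by funext i; simp
  rw [this, xp_zero, one_mul]

theorem heckeU_xp_of_eq {γ : ι → ℤ} (h : γ a = γ b) : heckeU q a b (xp γ : Lau K ι) = xp γ := by
  rw [heckeU_apply, divDiff_xp, divDiffMono, sw_xp, comp_swap_eq, h]
  simp

end Ops

section Braid

variable {K : Type} [Field K] {ι : Type} [DecidableEq ι]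

theorem algHom_heckeU {F : Type} [Field F] [Algebra K F] (q : K) (ψ : Lau K ι →ₐ[K] F) {a b : ι}
    (h : ψ (xp (Pi.single a 1)) ≠ ψ (xp (Pi.single b 1))) (g : Lau K ι) :
    ψ (heckeU q a b g) = ψ (sw a b g) + (algebraMap K F q - 1) * (ψ (xp (Pi.single a 1)) *
      (ψ (sw a b g) - ψ g) / (ψ (xp (Pi.single a 1)) - ψ (xp (Pi.single b 1)))) := by
  have e := congrArg ψ (mul_divDiff a b g)
  have e1 : (xp (Pi.single a 1) : Lau K ι) * xp (root b a) = xp (Pi.single b 1) := by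
    rw [← xp_add]; congr 1; simp [root]
  have e2 := congrArg ψ e1
  rw [map_mul] at e2
  rw [map_mul, map_sub, map_sub, map_one] at e
  have h' : ψ (xp (Pi.single a 1)) - ψ (xp (Pi.single b 1)) ≠ 0 := sub_ne_zero.2 h
  rw [heckeU_apply, map_add, map_smul, Algebra.smul_def, map_sub, map_one]
  congr 2
  rw [eq_div_iff h', ← e, ← e2]
  ring

theorem sw_single_left (a b : ι) :
    sw a b (xp (Pi.single a 1) : Lau K ι) = xp (Pi.single b 1) := by
  rw [sw_xp]; congr 1; funext i
  simp only [Function.comp, Pi.single_apply, swap_apply_def]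
  split_ifs <;> simp_all

theorem sw_single_right (a b : ι) :
    sw a b (xp (Pi.single b 1) : Lau K ι) = xp (Pi.single a 1) := by
  rw [← sw_single_left a b, sw_sw]

theorem sw_single_of_ne {a b c : ι} (h1 : c ≠ a) (h2 : c ≠ b) :
    sw a b (xp (Pi.single c 1) : Lau K ι) = xp (Pi.single c 1) := by
  rw [sw_xp]; congr 1; funext i
  simp only [Function.comp, Pi.single_apply, swap_apply_def]
  split_ifs <;> simp_all

theorem sw_braid {a b c : ι} (hab : a ≠ b) (hbc : b ≠ c) (hac : a ≠ c) (f : Lau K ι) :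
    sw a b (sw b c (sw a b f)) = sw b c (sw a b (sw b c f)) := by
  simp only [sw, mapX_comp]
  congr 2
  ext γ i
  simp only [AddMonoidHom.comp_apply, reidx_apply, Function.comp]
  congr 1
  simp only [swap_apply_def]
  split_ifs <;> simp_all

/-- The identity of rational functions behind the braid relation; `f0, …, f5` stand for the six
permutations of a function. -/
theorem braid_identity {F : Type} [Field F] {x y z : F} (d1 : x - y ≠ 0) (d2 : y - z ≠ 0)
    (d3 : x - z ≠ 0) (Q f0 f1 f2 f3 f4 f5 : F) :
    f5 + Q * (y * (f5 - f3) / (y - z)) +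
        Q * (x * (f5 + Q * (y * (f5 - f3) / (y - z)) - (f0 + Q * (y * (f0 - f1) / -(x - y)))) / (x - z)) +
      Q *
        (x *
            (f5 + Q * (y * (f5 - f3) / (y - z)) +
                Q * (x * (f5 + Q * (y * (f5 - f3) / (y - z)) - (f0 + Q * (y * (f0 - f1) / -(x - y)))) / (x - z)) -
              (f4 + Q * (x * (f4 - f2) / (x - z)) +
                Q * (y * (f4 + Q * (x * (f4 - f2) / (x - z)) - (f1 + Q * (x * (f1 - f0) / (x - y)))) / (y - z)))) /
          (x - y)) =
    f5 + Q * (x * (f5 - f4) / (x - y)) +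
        Q * (x * (f5 + Q * (x * (f5 - f4) / (x - y)) - (f0 + Q * (z * (f0 - f2) / -(y - z)))) / (x - z)) +
      Q *
        (y *
            (f5 + Q * (x * (f5 - f4) / (x - y)) +
                Q * (x * (f5 + Q * (x * (f5 - f4) / (x - y)) - (f0 + Q * (z * (f0 - f2) / -(y - z)))) / (x - z)) -
              (f3 + Q * (x * (f3 - f1) / (x - z)) +
                Q * (x * (f3 + Q * (x * (f3 - f1) / (x - z)) - (f2 + Q * (y * (f2 - f0) / (y - z)))) / (x - y)))) /
          (y - z)) := by
  field_simp
  ring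

/-- The braid relation for the Demazure–Lusztig operators. -/
theorem heckeU_braid (q : K) {a b c : ι} (hab : a ≠ b) (hbc : b ≠ c) (hac : a ≠ c) (f : Lau K ι) :
    heckeU q a b (heckeU q b c (heckeU q a b f)) =
      heckeU q b c (heckeU q a b (heckeU q b c f)) := by
  let F := FractionRing (Lau K ι)
  let φ : Lau K ι →ₐ[K] F := IsScalarTower.toAlgHom K (Lau K ι) F
  have hφ : Function.Injective φ := IsFractionRing.injective (Lau K ι) F
  apply hφ
  have inj : ∀ {i j : ι}, i ≠ j → φ (xp (Pi.single i 1)) ≠ φ (xp (Pi.single j 1)) := by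
    intro i j hij h
    have h1 := congrFun (xp_injective (hφ h)) i
    simp [hij] at h1
  set s : Lau K ι →ₐ[K] Lau K ι := sw a b with hs
  set t : Lau K ι →ₐ[K] Lau K ι := sw b c with ht
  have sa : s (xp (Pi.single a 1)) = xp (Pi.single b 1) := sw_single_left a b
  have sb : s (xp (Pi.single b 1)) = xp (Pi.single a 1) := sw_single_right a b
  have sc : s (xp (Pi.single c 1)) = xp (Pi.single c 1) := sw_single_of_ne hac.symm hbc.symm
  have ta : t (xp (Pi.single a 1)) = xp (Pi.single a 1) := sw_single_of_ne hab hac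
  have tb : t (xp (Pi.single b 1)) = xp (Pi.single c 1) := sw_single_left b c
  have tc : t (xp (Pi.single c 1)) = xp (Pi.single b 1) := sw_single_right b c
  have ss : ∀ g, s (s g) = g := sw_sw a b
  have tt : ∀ g, t (t g) = g := sw_sw b c
  have br : ∀ g, s (t (s g)) = t (s (t g)) := sw_braid hab hbc hac
  set x := φ (xp (Pi.single a 1)) with hx
  set y := φ (xp (Pi.single b 1)) with hy
  set z := φ (xp (Pi.single c 1)) with hz
  have xy : x ≠ y := inj hab
  have yz : y ≠ z := inj hbc
  have xz : x ≠ z := inj hac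
  set Q := algebraMap K F q - 1 with hQ
  have U1 : ∀ g, φ (heckeU q a b g) = φ (s g) + Q * (x * (φ (s g) - φ g) / (x - y)) :=
    fun g => algHom_heckeU q φ xy g
  have U2 : ∀ g, φ (heckeU q b c g) = φ (t g) + Q * (y * (φ (t g) - φ g) / (y - z)) :=
    fun g => algHom_heckeU q φ yz g
  have sU2 : ∀ g, φ (s (heckeU q b c g)) =
      φ (s (t g)) + Q * (x * (φ (s (t g)) - φ (s g)) / (x - z)) := by
    intro g
    have := algHom_heckeU q (φ.comp s) (a := b) (b := c)
      (by simpa only [AlgHom.comp_apply, sb, sc] using xz) g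
    simpa only [AlgHom.comp_apply, sb, sc] using this
  have tU1 : ∀ g, φ (t (heckeU q a b g)) =
      φ (t (s g)) + Q * (x * (φ (t (s g)) - φ (t g)) / (x - z)) := by
    intro g
    have := algHom_heckeU q (φ.comp t) (a := a) (b := b)
      (by simpa only [AlgHom.comp_apply, ta, tb] using xz) g
    simpa only [AlgHom.comp_apply, ta, tb] using this
  have sU1 : ∀ g, φ (s (heckeU q a b g)) = φ g + Q * (y * (φ g - φ (s g)) / (y - x)) := by
    intro g
    have := algHom_heckeU q (φ.comp s) (a := a) (b := b)
      (by simpa only [AlgHom.comp_apply, sa, sb] using xy.symm) g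
    simpa only [AlgHom.comp_apply, sa, sb, ss, ← hs] using this
  have tU2 : ∀ g, φ (t (heckeU q b c g)) = φ g + Q * (z * (φ g - φ (t g)) / (z - y)) := by
    intro g
    have := algHom_heckeU q (φ.comp t) (a := b) (b := c)
      (by simpa only [AlgHom.comp_apply, tb, tc] using yz.symm) g
    simpa only [AlgHom.comp_apply, tb, tc, tt, ← ht] using this
  have stU1 : ∀ g, φ (s (t (heckeU q a b g))) =
      φ (s (t (s g))) + Q * (y * (φ (s (t (s g))) - φ (s (t g))) / (y - z)) := by
    intro g
    have := algHom_heckeU q ((φ.comp s).comp t) (a := a) (b := b)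
      (by simpa only [AlgHom.comp_apply, ta, tb, sa, sc] using yz) g
    simpa only [AlgHom.comp_apply, ta, tb, sa, sc] using this
  have tsU2 : ∀ g, φ (t (s (heckeU q b c g))) =
      φ (t (s (t g))) + Q * (x * (φ (t (s (t g))) - φ (t (s g))) / (x - y)) := by
    intro g
    have := algHom_heckeU q ((φ.comp t).comp s) (a := b) (b := c)
      (by simpa only [AlgHom.comp_apply, sb, sc, ta, tc] using xy) g
    simpa only [AlgHom.comp_apply, sb, sc, ta, tc] using this
  rw [U1, U2 (heckeU q a b (heckeU q b c f)), U2 (heckeU q a b f), sU2, tU1 (heckeU q b c f),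
    U1 (heckeU q b c f), stU1, tsU2, tU1, sU1, U1, sU2, tU2, U2, br]
  have d1 : x - y ≠ 0 := sub_ne_zero.2 xy
  have d2 : y - z ≠ 0 := sub_ne_zero.2 yz
  have d3 : x - z ≠ 0 := sub_ne_zero.2 xz
  have d4 : z - y = -(y - z) := by ring
  have d5 : y - x = -(x - y) := by ring
  rw [d4, d5]
  generalize φ f = f0
  generalize φ (s f) = f1
  generalize φ (t f) = f2
  generalize φ (s (t f)) = f3
  generalize φ (t (s f)) = f4
  generalize φ (t (s (t f))) = f5
  exact braid_identity d1 d2 d3 Q f0 f1 f2 f3 f4 f5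

theorem heckeU_comm (q : K) {a b c d : ι} (hab : a ≠ b) (hcd : c ≠ d) (hac : a ≠ c) (had : a ≠ d)
    (hbc : b ≠ c) (hbd : b ≠ d) (f : Lau K ι) :
    heckeU q a b (heckeU q c d f) = heckeU q c d (heckeU q a b f) := by
  have hs : ∀ g : Lau K ι, sw a b (sw c d g) = sw c d (sw a b g) := by
    intro g
    simp only [sw, mapX_comp]
    congr 2
    ext γ i
    simp only [AddMonoidHom.comp_apply, reidx_apply, Function.comp]
    congr 1
    simp only [swap_apply_def]
    split_ifs <;> simp_all
  have hr : ∀ g, sw a b (divDiff c d g) = divDiff c d (sw a b g : Lau K ι) := by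
    intro g
    rw [sw, divDiff_mapX hcd]
    · intro γ
      funext i
      simp only [reidx_apply, Function.comp]
      congr 1
      simp only [swap_apply_def]
      split_ifs <;> simp_all
    · rw [reidx_root]
      simp [swap_apply_of_ne_of_ne, hac.symm, had.symm, hbc.symm, hbd.symm]
  have hr' : ∀ g, sw c d (divDiff a b g) = divDiff a b (sw c d g : Lau K ι) := by
    intro g
    rw [sw, divDiff_mapX hab]
    · intro γ
      funext i
      simp only [reidx_apply, Function.comp]
      congr 1
      simp only [swap_apply_def]
      split_ifs <;> simp_all
    · rw [reidx_root]
      simp [swap_apply_of_ne_of_ne, hac, had, hbc, hbd]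
  have hD : divDiff a b (divDiff c d f) = divDiff c d (divDiff a b f) := by
    have hx : sw a b (1 - xp (root d c) : Lau K ι) = 1 - xp (root d c) := by
      rw [map_sub, map_one, sw, mapX_xp, reidx_root]
      simp [swap_apply_of_ne_of_ne, hac.symm, had.symm, hbc.symm, hbd.symm]
    apply mul_left_cancel₀ (one_sub_xp_ne_zero (K := K) (root_ne_zero hcd.symm))
    rw [← divDiff_mul_of_sw_eq hab hx, mul_divDiff, mul_divDiff, map_sub, hr']
  simp only [heckeU_apply, map_add, map_smul, hs, hr, hr', hD, smul_add]
  module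

end Braid

/-! ### Non-symmetric Hall–Littlewood polynomials attached to a weight and a real vector -/

section NonSym

variable {K : Type} [Field K] {m : ℕ}

open Classical in
/-- The number of pairs of positions at which `r` fails to be decreasing. -/
def ascCount (r : Fin m → ℝ) : ℕ := #{p : Fin m × Fin m | p.1 < p.2 ∧ r p.1 < r p.2}

theorem swap_adj_lt {a b i j : Fin m} (hab : (a : ℕ) + 1 = b) (hij : i < j)
    (h : ¬(i = a ∧ j = b)) : swap a b i < swap a b j := by
  simp only [swap_apply_def]
  simp only [Fin.ext_iff, Fin.lt_def] at *
  split_ifs <;> omega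

theorem ascCount_swap_lt {a b : Fin m} (hab : (a : ℕ) + 1 = b) {r : Fin m → ℝ} (hr : r a < r b) :
    ascCount (r ∘ swap a b) < ascCount r := by
  classical
  unfold ascCount
  have hlt : a < b := by rw [Fin.lt_def]; omega
  have hmem : (a, b) ∈ ({p : Fin m × Fin m | p.1 < p.2 ∧ r p.1 < r p.2} : Finset _) := by
    simp [hlt, hr]
  refine lt_of_le_of_lt ?_ (Finset.card_erase_lt_of_mem hmem)
  refine Finset.card_le_card_of_injOn (Prod.map (swap a b) (swap a b)) ?_
    ((swap a b).injective.prodMap (swap a b).injective).injOn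
  rintro ⟨i, j⟩ hp
  simp only [coe_filter, mem_univ, true_and, Set.mem_ofPred_eq, Function.comp] at hp
  have hne : ¬(i = a ∧ j = b) := by
    rintro ⟨rfl, rfl⟩
    simp only [swap_apply_left, swap_apply_right] at hp
    exact absurd hp.2 (not_lt.2 hr.le)
  simp only [coe_erase, coe_filter, mem_univ, true_and, Set.mem_sdiff, Set.mem_ofPred_eq,
    Prod.map_apply, Set.mem_singleton_iff, Prod.mk.injEq]
  refine ⟨⟨swap_adj_lt hab hp.1 hne, hp.2⟩, ?_⟩
  rintro ⟨h1, h2⟩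
  rw [swap_apply_eq_iff, swap_apply_left] at h1
  rw [swap_apply_eq_iff, swap_apply_right] at h2
  rw [h1, h2] at hp
  exact absurd hp.1 (not_lt.2 hlt.le)

theorem antitone_or_exists_asc (r : Fin m → ℝ) :
    Antitone r ∨ ∃ a b : Fin m, (a : ℕ) + 1 = b ∧ r a < r b := by
  by_contra! h
  obtain ⟨h1, h2⟩ := h
  apply h1
  cases m with
  | zero => exact fun i => i.elim0
  | succ n => exact Fin.antitone_iff_succ_le.2 fun i => h2 i.castSucc i.succ (by simp)

open Classical in
/-- The operator `V` or `U`, according to whether `p` holds. -/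
def heckeA (q : K) (a b : Fin m) (p : Prop) : Module.End K (Lau K (Fin m)) :=
  if p then heckeV q a b else heckeU q a b

theorem heckeA_pos (q : K) (a b : Fin m) {p : Prop} (hp : p) : heckeA q a b p = heckeV q a b :=
  if_pos hp

theorem heckeA_neg (q : K) (a b : Fin m) {p : Prop} (hp : ¬p) : heckeA q a b p = heckeU q a b :=
  if_neg hp

open Classical in
/-- The twisted non-symmetric Hall–Littlewood polynomial attached to a weight `w` and a real
vector `r`. When `r` is decreasing it is `x^w`; exchanging adjacent entries of `w` and `r` at an
ascent of `r` amounts to applying `U` or `V`, depending on the order of the entries of `r - w`. It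
does not depend on the sequence of exchanges, see `genHL_step`. -/
def genHL (q : K) (w : Fin m → ℤ) (r : Fin m → ℝ) : Lau K (Fin m) :=
  if h : ∃ a b : Fin m, (a : ℕ) + 1 = b ∧ r a < r b then
    heckeA q h.choose h.choose_spec.choose
      (r h.choose_spec.choose - w h.choose_spec.choose < r h.choose - w h.choose)
      (genHL q (w ∘ swap h.choose h.choose_spec.choose) (r ∘ swap h.choose h.choose_spec.choose))
  else xp w
termination_by ascCount r
decreasing_by exact ascCount_swap_lt h.choose_spec.choose_spec.1 h.choose_spec.choose_spec.2

theorem genHL_of_antitone (q : K) (w : Fin m → ℤ) {r : Fin m → ℝ} (hr : Antitone r) :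
    genHL q w r = xp w := by
  rw [genHL, dif_neg]
  rintro ⟨a, b, hab, h⟩
  exact absurd (hr (show a ≤ b by rw [Fin.le_def]; omega)) (not_le.2 h)

theorem genHL_exists_step (q : K) (w : Fin m → ℤ) {r : Fin m → ℝ}
    (h : ∃ a b : Fin m, (a : ℕ) + 1 = b ∧ r a < r b) :
    ∃ a b : Fin m, (a : ℕ) + 1 = b ∧ r a < r b ∧ genHL q w r =
      heckeA q a b (r b - w b < r a - w a) (genHL q (w ∘ swap a b) (r ∘ swap a b)) := by
  refine ⟨h.choose, h.choose_spec.choose, h.choose_spec.choose_spec.1, h.choose_spec.choose_spec.2,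
    ?_⟩
  rw [genHL, dif_pos h]

/-- The braid relation for the operators `U` and `V` mixed according to a linear order. -/
theorem heckeA_braid (q : K) {a b c : Fin m} (hab : a ≠ b) (hbc : b ≠ c) (hac : a ≠ c)
    {p₁ p₂ p₃ : Prop} (h₁ : p₁ → p₃ → p₂) (h₂ : ¬p₁ → ¬p₃ → ¬p₂) (f : Lau K (Fin m)) :
    heckeA q a b p₁ (heckeA q b c p₂ (heckeA q a b p₃ f)) =
      heckeA q b c p₃ (heckeA q a b p₂ (heckeA q b c p₁ f)) := by
  have br := heckeU_braid q hab hbc hac f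
  have qa : ∀ g, heckeU q a b (heckeU q a b g) = q • g - (q - 1) • heckeU q a b g := by
    intro g
    rw [← heckeU_heckeV q hab g, heckeV_apply, map_add, map_smul, add_sub_cancel_right]
  have qb : ∀ g, heckeU q b c (heckeU q b c g) = q • g - (q - 1) • heckeU q b c g := by
    intro g
    rw [← heckeU_heckeV q hbc g, heckeV_apply, map_add, map_smul, add_sub_cancel_right]
  by_cases k1 : p₁ <;> by_cases k2 : p₂ <;> by_cases k3 : p₃
  all_goals first
    | exact absurd k2 (by tauto)
    | exact absurd k2 (not_not.2 (by tauto))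
    | (simp only [heckeA, k1, k2, k3, if_true, if_false, heckeV_apply, map_add, map_smul, br, qa, qb]
       try module)

theorem heckeA_comm (q : K) {a b c d : Fin m} (hab : a ≠ b) (hcd : c ≠ d) (hac : a ≠ c)
    (had : a ≠ d) (hbc : b ≠ c) (hbd : b ≠ d) (p₁ p₂ : Prop) (f : Lau K (Fin m)) :
    heckeA q a b p₁ (heckeA q c d p₂ f) = heckeA q c d p₂ (heckeA q a b p₁ f) := by
  by_cases k1 : p₁ <;> by_cases k2 : p₂ <;>
    simp only [heckeA, k1, k2, if_true, if_false, heckeV_apply, map_add, map_smul,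
      heckeU_comm q hab hcd hac had hbc hbd, smul_add] <;>
    module

theorem swap_braid {a b c : Fin m} (hab : a ≠ b) (hbc : b ≠ c) (hac : a ≠ c) {α : Type*}
    (r : Fin m → α) :
    ((r ∘ swap a b) ∘ swap b c) ∘ swap a b = ((r ∘ swap b c) ∘ swap a b) ∘ swap b c := by
  funext i
  simp only [Function.comp]
  congr 1
  simp only [swap_apply_def]
  split_ifs <;> simp_all

theorem swap_comm_of_ne {a b c d : Fin m} (hac : a ≠ c) (had : a ≠ d) (hbc : b ≠ c) (hbd : b ≠ d)
    {α : Type*} (r : Fin m → α) :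
    (r ∘ swap a b) ∘ swap c d = (r ∘ swap c d) ∘ swap a b := by
  funext i
  simp only [Function.comp]
  congr 1
  simp only [swap_apply_def]
  split_ifs <;> simp_all

/-- The two ways of sorting three consecutive increasing entries lead to the same result. -/
theorem genHL_diamond (q : K) (w : Fin m → ℤ) (r : Fin m → ℝ)
    (ih : ∀ (w' : Fin m → ℤ) (r' : Fin m → ℝ), ascCount r' < ascCount r → ∀ a b : Fin m,
      (a : ℕ) + 1 = b → r' a < r' b → genHL q w' r' =
        heckeA q a b (r' b - w' b < r' a - w' a) (genHL q (w' ∘ swap a b) (r' ∘ swap a b)))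
    {a b c : Fin m} (hab : (a : ℕ) + 1 = b) (hbc : (b : ℕ) + 1 = c) (h1 : r a < r b)
    (h2 : r b < r c) :
    heckeA q a b (r b - w b < r a - w a) (genHL q (w ∘ swap a b) (r ∘ swap a b)) =
      heckeA q b c (r c - w c < r b - w b) (genHL q (w ∘ swap b c) (r ∘ swap b c)) := by
  have nab : a ≠ b := by rw [Ne, Fin.ext_iff]; omega
  have nbc : b ≠ c := by rw [Ne, Fin.ext_iff]; omega
  have nac : a ≠ c := by rw [Ne, Fin.ext_iff]; omega
  have l1 := ascCount_swap_lt hab h1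
  have l2 := ascCount_swap_lt hbc h2
  have k1 : (r ∘ swap a b) b < (r ∘ swap a b) c := by
    simp [swap_apply_of_ne_of_ne, nac.symm, nbc.symm, h1.trans h2]
  have k2 : (r ∘ swap b c) a < (r ∘ swap b c) b := by
    simp [swap_apply_of_ne_of_ne, nac, nab, h1.trans h2]
  rw [ih _ _ l1 b c hbc k1, ih _ _ l2 a b hab k2,
    ih _ _ ((ascCount_swap_lt hbc k1).trans l1) a b hab
      (by simp [swap_apply_of_ne_of_ne, nac, nac.symm, nab, nbc.symm, h2]),
    ih _ _ ((ascCount_swap_lt hab k2).trans l2) b c hbc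
      (by simp [swap_apply_of_ne_of_ne, nac, nac.symm, nab, nbc.symm, h1]),
    swap_braid nab nbc nac, swap_braid nab nbc nac]
  simp only [Function.comp, swap_apply_left, swap_apply_right, swap_apply_of_ne_of_ne nac.symm nbc.symm,
    swap_apply_of_ne_of_ne nab nac]
  exact heckeA_braid q nab nbc nac (fun x y => y.trans x)
    (fun x y => not_lt.2 ((not_lt.1 x).trans (not_lt.1 y))) _

/-- Exchanging the entries at any ascent of `r` computes `genHL`: the analogue of Matsumoto's
theorem. -/
theorem genHL_step (q : K) (w : Fin m → ℤ) (r : Fin m → ℝ) {a b : Fin m} (hab : (a : ℕ) + 1 = b)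
    (hr : r a < r b) : genHL q w r =
      heckeA q a b (r b - w b < r a - w a) (genHL q (w ∘ swap a b) (r ∘ swap a b)) := by
  induction hn : ascCount r using Nat.strong_induction_on generalizing w r a b with
  | _ n ih =>
    subst hn
    have ih' : ∀ (w' : Fin m → ℤ) (r' : Fin m → ℝ), ascCount r' < ascCount r → ∀ a b : Fin m,
        (a : ℕ) + 1 = b → r' a < r' b → genHL q w' r' =
        heckeA q a b (r' b - w' b < r' a - w' a) (genHL q (w' ∘ swap a b) (r' ∘ swap a b)) :=
      fun w' r' h a b hab hr => ih _ h w' r' hab hr rfl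
    obtain ⟨a₀, b₀, hab₀, hr₀, e⟩ := genHL_exists_step q w ⟨a, b, hab, hr⟩
    rw [e]
    -- `(a₀, b₀)` is the ascent chosen in the definition of `genHL`; it may equal `(a, b)`, overlap
    -- it in one position, or be disjoint from it
    by_cases h1 : a₀ = a
    · subst h1
      have : b₀ = b := by rw [Fin.ext_iff]; omega
      rw [this]
    by_cases h2 : b₀ = a
    · subst h2
      exact genHL_diamond q w r ih' hab₀ hab hr₀ hr
    by_cases h3 : b = a₀
    · subst h3
      exact (genHL_diamond q w r ih' hab hab₀ hr hr₀).symm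
    -- the two exchanges involve disjoint positions and commute
    have h4 : b₀ ≠ b := by
      intro h
      apply h1
      rw [Fin.ext_iff] at h ⊢
      omega
    have nab : a ≠ b := by rw [Ne, Fin.ext_iff]; omega
    have nab₀ : a₀ ≠ b₀ := by rw [Ne, Fin.ext_iff]; omega
    rw [ih' _ _ (ascCount_swap_lt hab₀ hr₀) a b hab, ih' _ _ (ascCount_swap_lt hab hr) a₀ b₀ hab₀,
      swap_comm_of_ne h1 (Ne.symm h3) h2 h4, swap_comm_of_ne h1 (Ne.symm h3) h2 h4,
      heckeA_comm q nab₀ nab h1 (Ne.symm h3) h2 h4]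
    · simp only [Function.comp, swap_apply_of_ne_of_ne h1 (Ne.symm h3), swap_apply_of_ne_of_ne h2 h4,
        swap_apply_of_ne_of_ne (Ne.symm h1) (Ne.symm h2), swap_apply_of_ne_of_ne h3 (Ne.symm h4)]
    · simpa only [Function.comp, swap_apply_of_ne_of_ne h1 (Ne.symm h3),
        swap_apply_of_ne_of_ne h2 h4] using hr₀
    · simpa only [Function.comp, swap_apply_of_ne_of_ne (Ne.symm h1) (Ne.symm h2),
        swap_apply_of_ne_of_ne h3 (Ne.symm h4)] using hr

/-- Induction along the exchanges that sort `r`. -/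
theorem sort_induction {P : (Fin m → ℤ) → (Fin m → ℝ) → Prop} (w : Fin m → ℤ) (r : Fin m → ℝ)
    (base : ∀ w r, Antitone r → P w r)
    (step : ∀ w r, ∀ a b : Fin m, (a : ℕ) + 1 = b → r a < r b →
      P (w ∘ swap a b) (r ∘ swap a b) → P w r) : P w r := by
  induction hn : ascCount r using Nat.strong_induction_on generalizing w r with
  | _ n ih =>
    subst hn
    rcases antitone_or_exists_asc r with h | ⟨a, b, hab, h⟩
    · exact base w r h
    · exact step w r a b hab h (ih _ (ascCount_swap_lt hab h) _ _ rfl)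

theorem ne_of_adj {a b : Fin m} (hab : (a : ℕ) + 1 = b) : a ≠ b := by
  rw [Ne, Fin.ext_iff]; omega

theorem comp_swap_swap {α : Type*} (a b : Fin m) (w : Fin m → α) :
    (w ∘ swap a b) ∘ swap a b = w := by
  funext i; simp

/-- `genHL q w r` depends only on the order of the entries of `r` and, at the pairs of positions
where `r` is not decreasing, on the order of the entries of `r - w`. -/
theorem genHL_congr (q : K) (w : Fin m → ℤ) (r r' : Fin m → ℝ)
    (h1 : ∀ i j, r i < r j ↔ r' i < r' j)
    (h2 : ∀ i j, i < j → r i < r j → (r j - w j < r i - w i ↔ r' j - w j < r' i - w i)) :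
    genHL q w r = genHL q w r' := by
  induction w, r using sort_induction generalizing r' with
  | base w r hr =>
    rw [genHL_of_antitone q w hr, genHL_of_antitone q w]
    intro i j hij
    have := hr hij
    exact not_lt.1 fun h => absurd ((h1 _ _).2 h) (not_lt.2 this)
  | step w r a b hab hr ih =>
    have hlt : a < b := by rw [Fin.lt_def]; omega
    rw [genHL_step q w r hab hr, genHL_step q w r' hab ((h1 _ _).1 hr), propext (h2 a b hlt hr),
      ih (r' ∘ swap a b) (fun i j => h1 _ _)]
    intro i j hij hlt'
    refine h2 _ _ (swap_adj_lt hab hij ?_) hlt'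
    rintro ⟨rfl, rfl⟩
    simp only [Function.comp, swap_apply_left, swap_apply_right] at hlt'
    exact absurd hlt' (not_lt.2 hr.le)

/-- `genHL q w r` is a monomial if `r` is decreasing up to ties of `w`. -/
theorem genHL_of_ties (q : K) (w : Fin m → ℤ) (r : Fin m → ℝ)
    (h : ∀ i j, i < j → r i < r j → w i = w j) : genHL q w r = xp w := by
  induction w, r using sort_induction with
  | base w r hr => exact genHL_of_antitone q w hr
  | step w r a b hab hr ih =>
    have hlt : a < b := by rw [Fin.lt_def]; omega
    have hw := h a b hlt hr
    have hs : w ∘ swap a b = w := by rw [comp_swap_eq, hw, sub_self, zero_smul, add_zero]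
    rw [genHL_step q w r hab hr, ih, hs, heckeA_neg, heckeU_xp_of_eq q hw]
    · rw [hw]; linarith
    · intro i j hij hlt'
      refine h _ _ (swap_adj_lt hab hij ?_) hlt'
      rintro ⟨rfl, rfl⟩
      simp only [Function.comp, swap_apply_left, swap_apply_right] at hlt'
      exact absurd hlt' (not_lt.2 hr.le)

/-- The entries of `c` differ by less than `1`. -/
def Narrow {ι : Type} (c : ι → ℝ) : Prop := ∀ i j, c i - c j < 1

theorem genHL_of_weight_antitone (q : K) (w : Fin m → ℤ) (r : Fin m → ℝ) (hw : Antitone w)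
    (hc : Narrow fun i => r i - w i) : genHL q w r = xp w := by
  refine genHL_of_ties q w r fun i j hij hr => le_antisymm ?_ (hw hij.le)
  have h := hc j i
  have : (w i : ℝ) - w j < 1 := by simp only at h; linarith
  have : w i - w j < 1 := by exact_mod_cast this
  omega

/-- Changing `w` by `β` and `r` by a constant multiplies `genHL` by `x^β`. At each exchange the
entries of `β` differ by at most `1`, and when they do differ the choice between `U` and `V` changes
exactly as in `heckeU_xp_mul` and `heckeV_xp_mul`. -/
theorem genHL_shift (q : K) (w β : Fin m → ℤ) (r : Fin m → ℝ) (p : ℝ)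
    (hc : Narrow fun i => r i - w i) (hc' : Narrow fun i => r i + p - (w i + β i)) :
    genHL q (w + β) (fun i => r i + p) = xp β * genHL q w r := by
  induction w, r using sort_induction generalizing β with
  | base w r hr =>
    rw [genHL_of_antitone q w hr, genHL_of_antitone, xp_add, mul_comm]
    intro i j hij
    simpa using hr hij
  | step w r a b hab hr ih =>
    have nab := ne_of_adj hab
    have ih' := ih (β ∘ swap a b) (fun i j => hc _ _) (fun i j => hc' _ _)
    have e1 : w ∘ swap a b + β ∘ swap a b = (w + β) ∘ swap a b := rfl
    have e2 : (fun i => (r ∘ swap a b) i + p) = (fun i => r i + p) ∘ swap a b := rfl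
    rw [e1, e2] at ih'
    rw [genHL_step q w r hab hr, genHL_step q (w + β) _ hab (by simpa using hr), ih']
    have c1 := hc a b
    have c2 := hc b a
    have c3 := hc' a b
    have c4 := hc' b a
    simp only at c1 c2 c3 c4
    have sβ : β a = β b → β ∘ swap a b = β := fun h => by
      rw [comp_swap_eq, h, sub_self, zero_smul, add_zero]
    by_cases k1 : r b - w b < r a - w a <;>
      by_cases k2 : r b + p - ((w + β) b : ℤ) < r a + p - ((w + β) a : ℤ)
    · have hβ : β a = β b := by
        simp only [Pi.add_apply, Int.cast_add] at k2
        have l1 : (β a : ℝ) - β b < 1 := by linarith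
        have l2 : (β b : ℝ) - β a < 1 := by linarith
        norm_cast at l1 l2; omega
      rw [heckeA_pos q a b k1, heckeA_pos q a b k2, heckeV_mul_of_sw_eq q nab, sβ hβ]
      simp [sβ hβ]
    · have hβ : β a = β b + 1 := by
        simp only [Pi.add_apply, Int.cast_add] at k2
        have l1 : (β a : ℝ) - β b < 2 := by linarith
        have l2 : (0 : ℝ) < β a - β b := by linarith
        norm_cast at l1 l2; omega
      rw [heckeA_pos q a b k1, heckeA_neg q a b k2, heckeU_xp_mul q nab, comp_swap_swap]
      simp [hβ]
    · have hβ : β b = β a + 1 := by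
        simp only [Pi.add_apply, Int.cast_add] at k2
        have l1 : (β b : ℝ) - β a < 2 := by linarith
        have l2 : (0 : ℝ) < β b - β a := by linarith
        norm_cast at l1 l2; omega
      rw [heckeA_neg q a b k1, heckeA_pos q a b k2, heckeV_xp_mul q nab, comp_swap_swap]
      simp [hβ]
    · have hβ : β a = β b := by
        simp only [Pi.add_apply, Int.cast_add] at k2
        have l1 : (β a : ℝ) - β b < 1 := by linarith
        have l2 : (β b : ℝ) - β a < 1 := by linarith
        norm_cast at l1 l2; omega
      rw [heckeA_neg q a b k1, heckeA_neg q a b k2, heckeU_mul_of_sw_eq q nab, sβ hβ]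
      simp [sβ hβ]

theorem heckeA_mapX {k : ℕ} (q : K) {a b : Fin m} {a' b' : Fin k} (hab : a' ≠ b')
    (φ : (Fin m → ℤ) →+ (Fin k → ℤ)) (hφ : ∀ γ, φ (γ ∘ swap a b) = φ γ ∘ swap a' b')
    (hr : φ (root b a) = root b' a') (p : Prop) (f : Lau K (Fin m)) :
    heckeA q a' b' p (mapX φ f) = mapX φ (heckeA q a b p f) := by
  by_cases h : p
  · simp only [heckeA_pos _ _ _ h, heckeV_mapX q hab φ hφ hr]
  · simp only [heckeA_neg _ _ _ h, heckeU_mapX q hab φ hφ hr]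

theorem heckeA_mul_of_sw_eq (q : K) {a b : Fin m} (hab : a ≠ b) {g : Lau K (Fin m)}
    (hg : sw a b g = g) (p : Prop) (f : Lau K (Fin m)) :
    heckeA q a b p (g * f) = g * heckeA q a b p f := by
  by_cases h : p
  · simp only [heckeA_pos _ _ _ h, heckeV_mul_of_sw_eq q hab hg]
  · simp only [heckeA_neg _ _ _ h, heckeU_mul_of_sw_eq q hab hg]

theorem extz_comp_swap {ι κ : Type} [DecidableEq ι] [DecidableEq κ] (e : ι → κ)
    (he : Function.Injective e) (a b : ι) (γ : ι → ℤ) :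
    extz e (γ ∘ swap a b) = extz e γ ∘ swap (e a) (e b) := by
  funext k
  by_cases h : ∃ i, e i = k
  · obtain ⟨i, rfl⟩ := h
    rw [extz_apply e he, Function.comp, Function.comp, ← he.map_swap, extz_apply e he]
  · push Not at h
    rw [extz_of_notMem e _ k h, Function.comp,
      swap_apply_of_ne_of_ne (h a).symm (h b).symm, extz_of_notMem e _ k h]

theorem comp_swap_comp {ι κ : Type} [DecidableEq ι] [DecidableEq κ] {α : Type*} (e : ι → κ)
    (he : Function.Injective e) (a b : ι) (w : κ → α) :
    (w ∘ swap (e a) (e b)) ∘ e = (w ∘ e) ∘ swap a b := by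
  funext i
  simp only [Function.comp]
  rw [he.map_swap]

theorem single_add_extz (e : Fin m → Fin (m + 1)) (he : Function.Injective e) (k : Fin (m + 1))
    (hk : ∀ i, e i ≠ k) (hk' : ∀ j, j ≠ k → ∃ i, e i = j) (w : Fin (m + 1) → ℤ) :
    Pi.single k (w k) + extz e (w ∘ e) = w := by
  funext j
  by_cases h : j = k
  · subst h
    simp [extz_of_notMem e _ j hk]
  · obtain ⟨i, rfl⟩ := hk' j h
    rw [Pi.add_apply, extz_apply e he, Pi.single_eq_of_ne h, zero_add, Function.comp]

/-- Splitting off the variable at a position `k` which is the first or the last one, and at which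
the weight is extremal. -/
theorem genHL_embed (q : K) (e : Fin m → Fin (m + 1)) (he : StrictMono e)
    (hadj : ∀ a b : Fin m, (a : ℕ) + 1 = b → (e a : ℕ) + 1 = e b) (k : Fin (m + 1))
    (hk : ∀ i, e i ≠ k) (hk' : ∀ j, j ≠ k → ∃ i, e i = j) (w : Fin (m + 1) → ℤ)
    (r : Fin (m + 1) → ℝ)
    (hext : ∀ i, (k < e i → w (e i) ≤ w k) ∧ (e i < k → w k ≤ w (e i)))
    (hc : Narrow fun i => r i - w i) :
    genHL q w r = xp (Pi.single k (w k)) * mapX (extz e) (genHL q (w ∘ e) (r ∘ e)) := by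
  induction hn : ascCount (r ∘ e) using Nat.strong_induction_on generalizing w r with
  | _ n ih =>
    subst hn
    rcases antitone_or_exists_asc (r ∘ e) with h | ⟨a, b, hab, h⟩
    -- `r` may still have ascents at pairs involving `k`, but by `hext` and `hc` only at ties of `w`
    · rw [genHL_of_antitone q _ h, mapX_xp, ← xp_add, single_add_extz e he.injective k hk hk']
      refine genHL_of_ties q w r fun i j hij hr => ?_
      have hji := hc j i
      have hw : w i < w j + 1 := by
        have : (w i : ℝ) < w j + 1 := by simp only at hji; linarith
        exact_mod_cast this
      by_cases hi : i = k
      · subst hi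
        obtain ⟨j', rfl⟩ := hk' j hij.ne'
        have := (hext j').1 hij
        omega
      · obtain ⟨i', rfl⟩ := hk' i hi
        by_cases hj : j = k
        · subst hj
          have := (hext i').2 hij
          omega
        · obtain ⟨j', rfl⟩ := hk' j hj
          exact absurd (h (he.lt_iff_lt.1 hij).le) (not_le.2 hr)
    · have hne := ne_of_adj (hadj a b hab)
      have hkk : swap (e a) (e b) k = k := swap_apply_of_ne_of_ne (hk a).symm (hk b).symm
      have hr' : (r ∘ swap (e a) (e b)) ∘ e = (r ∘ e) ∘ swap a b :=
        comp_swap_comp e he.injective a b r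
      have hw' : (w ∘ swap (e a) (e b)) ∘ e = (w ∘ e) ∘ swap a b :=
        comp_swap_comp e he.injective a b w
      rw [genHL_step q w r (hadj a b hab) h, genHL_step q _ _ hab h,
        ih _ (by rw [hr']; exact ascCount_swap_lt hab h) (w ∘ swap (e a) (e b))
          (r ∘ swap (e a) (e b)) ?_ (fun i j => hc _ _) rfl, hr', hw', heckeA_mul_of_sw_eq q hne,
        heckeA_mapX q hne (extz e) (extz_comp_swap e he.injective a b)
          (extz_root e he.injective b a)]
      · simp only [Function.comp, hkk]
      · rw [sw_xp]
        congr 1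
        funext i
        simp only [Function.comp, hkk, Pi.single_apply, swap_apply_eq_iff]
      · have hka := hk a
        have hkb := hk b
        have h1 := hadj a b hab
        have key : ∀ i, (k < e i ↔ k < e (swap a b i)) ∧ (e i < k ↔ e (swap a b i) < k) := by
          intro i
          simp only [swap_apply_def]
          simp only [Fin.ext_iff, Fin.lt_def, Ne] at *
          split_ifs with h2 h3
          · have : i = a := Fin.ext h2
            subst this; omega
          · have : i = b := Fin.ext h3
            subst this; omega
          · simp
        intro i
        simp only [Function.comp, hkk, ← he.injective.map_swap]
        exact ⟨fun h => (hext _).1 ((key i).1.1 h), fun h => (hext _).2 ((key i).2.1 h)⟩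

/-- Splitting off the first variable, at which the weight is largest. -/
theorem genHL_succ (q : K) (w : Fin (m + 1) → ℤ) (r : Fin (m + 1) → ℝ)
    (hw : ∀ i, w i ≤ w 0) (hc : Narrow fun i => r i - w i) :
    genHL q w r = xp (Pi.single 0 (w 0)) *
      mapX (extz Fin.succ) (genHL q (w ∘ Fin.succ) (r ∘ Fin.succ)) :=
  genHL_embed q Fin.succ (Fin.strictMono_succ) (fun a b h => by simp [← h]) 0
    (fun i => Fin.succ_ne_zero i) (fun j hj => ⟨j.pred hj, Fin.succ_pred _ _⟩) w r
    (fun i => ⟨fun _ => hw _, fun h => absurd h (by simp)⟩) hc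

/-- Splitting off the last variable, at which the weight is smallest. -/
theorem genHL_castSucc (q : K) (w : Fin (m + 1) → ℤ) (r : Fin (m + 1) → ℝ)
    (hw : ∀ i, w (Fin.last m) ≤ w i) (hc : Narrow fun i => r i - w i) :
    genHL q w r = xp (Pi.single (Fin.last m) (w (Fin.last m))) *
      mapX (extz Fin.castSucc) (genHL q (w ∘ Fin.castSucc) (r ∘ Fin.castSucc)) :=
  genHL_embed q Fin.castSucc (Fin.strictMono_castSucc) (fun a b h => by simp [← h]) (Fin.last m)
    (fun i => Fin.castSucc_ne_last i) (fun j hj => ⟨j.castPred hj, Fin.castSucc_castPred _ _⟩) w r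
    (fun i => ⟨fun h => absurd h (not_lt.2 (Fin.le_last _)), fun _ => hw _⟩) hc

/-- The exponents with entries in `[N, M]` and sum `d`. -/
def box (m : ℕ) (N M d : ℤ) : Set (Fin m → ℤ) :=
  {γ | (∀ i, N ≤ γ i ∧ γ i ≤ M) ∧ ∑ i, γ i = d}

theorem sum_comp_swap (a b : Fin m) (γ : Fin m → ℤ) : ∑ i, (γ ∘ swap a b) i = ∑ i, γ i :=
  Equiv.sum_comp (swap a b) γ

theorem heckeA_mem_box (q : K) {a b : Fin m} (hab : a ≠ b) (p : Prop) {N M d : ℤ}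
    {f : Lau K (Fin m)} (hf : f ∈ suppIn K (box m N M d)) :
    heckeA q a b p f ∈ suppIn K (box m N M d) := by
  have hU : heckeU q a b f ∈ suppIn K (box m N M d) := by
    refine map_mem_of_suppIn (heckeU q a b) (fun γ hγ => ?_) hf
    rw [heckeU_apply, sw_xp]
    refine Submodule.add_mem _ (xp_mem_suppIn ⟨fun i => hγ.1 _, ?_⟩)
      (Submodule.smul_mem _ _ (suppIn_mono ?_ (divDiff_xp_mem hab γ)))
    · rw [sum_comp_swap, hγ.2]
    · rintro δ ⟨h1, h2, h3, h4⟩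
      have ha := hγ.1 a
      have hb := hγ.1 b
      refine ⟨fun i => ?_, ?_⟩
      · by_cases hia : i = a
        · subst hia; omega
        · by_cases hib : i = b
          · subst hib; omega
          · rw [h1 i hia hib]; exact hγ.1 i
      · rw [← hγ.2]
        have hz : ∑ i, (δ i - γ i) = ∑ i ∈ ({a, b} : Finset (Fin m)), (δ i - γ i) := by
          refine (Finset.sum_subset (Finset.subset_univ _) fun i _ hi => ?_).symm
          simp only [mem_insert, mem_singleton, not_or] at hi
          rw [h1 i hi.1 hi.2, sub_self]
        rw [sum_pair hab, sum_sub_distrib] at hz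
        omega
  by_cases h : p
  · rw [heckeA_pos q a b h, heckeV_apply]
    exact Submodule.add_mem _ hU (Submodule.smul_mem _ _ hf)
  · rwa [heckeA_neg q a b h]

theorem genHL_mem_box (q : K) (w : Fin m → ℤ) (r : Fin m → ℝ) {N M d : ℤ}
    (hw : w ∈ box m N M d) : genHL q w r ∈ suppIn K (box m N M d) := by
  induction w, r using sort_induction with
  | base w r hr =>
    rw [genHL_of_antitone q w hr]
    exact xp_mem_suppIn hw
  | step w r a b hab hr ih =>
    rw [genHL_step q w r hab hr]
    refine heckeA_mem_box q (ne_of_adj hab) _ (ih ⟨fun i => hw.1 _, ?_⟩)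
    rw [sum_comp_swap, hw.2]

end NonSym

/-! ### The constant term functional -/

section Functional

variable {K : Type} [Field K] {m : ℕ}

/-- The height of an exponent, normalized so that `x_i / x_j` has height `j - i`. -/
def height (γ : Fin m → ℤ) : ℤ := -∑ i : Fin m, ((i : ℕ) : ℤ) * γ i

theorem height_add (γ δ : Fin m → ℤ) : height (γ + δ) = height γ + height δ := by
  simp [height, mul_add, sum_add_distrib, add_comm]

/-- The exponents in the cone of positive roots of height at least `k`. -/
def rootCone (m : ℕ) (k : ℤ) : Set (Fin m → ℤ) :=
  {γ | k ≤ height γ ∧ (∀ j, 0 ≤ ∑ i ∈ Iic j, γ i) ∧ ∑ i, γ i = 0}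

theorem add_mem_rootCone {k l n : ℤ} (h : n ≤ k + l) {γ δ : Fin m → ℤ} (hγ : γ ∈ rootCone m k)
    (hδ : δ ∈ rootCone m l) : γ + δ ∈ rootCone m n := by
  refine ⟨?_, fun j => ?_, ?_⟩
  · rw [height_add]
    have := hγ.1
    have := hδ.1
    omega
  · simp only [Pi.add_apply, sum_add_distrib]
    exact add_nonneg (hγ.2.1 j) (hδ.2.1 j)
  · simp only [Pi.add_apply, sum_add_distrib, hγ.2.2, hδ.2.2, add_zero]

theorem zero_mem_rootCone : (0 : Fin m → ℤ) ∈ rootCone m 0 := by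
  refine ⟨?_, fun j => ?_, ?_⟩ <;> simp [height]

theorem root_mem_rootCone {i j : Fin m} (h : i < j) : root i j ∈ rootCone m 1 := by
  have h' : (i : ℤ) < j := by exact_mod_cast h
  refine ⟨?_, fun k => ?_, ?_⟩
  · simp only [height, root, Pi.sub_apply, mul_sub, sum_sub_distrib, Pi.single_apply, mul_ite,
      mul_one, mul_zero, sum_ite_eq', mem_univ, if_true]
    omega
  · simp only [root, Pi.sub_apply, sum_sub_distrib, Pi.single_apply, sum_ite_eq', mem_Iic]
    split_ifs with h1 h2 h2
    · simp
    · simp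
    · exact absurd (h.le.trans h2) h1
    · simp
  · simp [root, sum_sub_distrib]

theorem rootCone_mono {k l : ℤ} (h : k ≤ l) : rootCone m l ⊆ rootCone m k :=
  fun _ hγ => ⟨h.trans hγ.1, hγ.2⟩

/-- Power series whose coefficient of `h^k` is supported in the positive root cone, in heights at
least `k`. -/
def InCone (G : PowerSeries (Lau K (Fin m))) : Prop :=
  ∀ k : ℕ, PowerSeries.coeff k G ∈ suppIn K (rootCone m k)

theorem InCone.mul {G H : PowerSeries (Lau K (Fin m))} (hG : InCone G) (hH : InCone H) :
    InCone (G * H) := by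
  intro k
  rw [PowerSeries.coeff_mul]
  refine Submodule.sum_mem _ fun p hp => ?_
  rw [HasAntidiagonal.mem_antidiagonal] at hp
  exact mul_mem_suppIn (fun a ha b hb => add_mem_rootCone (by omega) ha hb) (hG p.1) (hH p.2)

theorem InCone.sub {G H : PowerSeries (Lau K (Fin m))} (hG : InCone G) (hH : InCone H) :
    InCone (G - H) := fun k => by
  rw [map_sub]
  exact Submodule.sub_mem _ (hG k) (hH k)

theorem inCone_C {p : Lau K (Fin m)} (hp : p ∈ suppIn K (rootCone m 0)) :
    InCone (PowerSeries.C p) := by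
  intro k
  rw [PowerSeries.coeff_C]
  split_ifs with h
  · subst h; exact hp
  · exact Submodule.zero_mem _

theorem one_mem_rootCone : (1 : Lau K (Fin m)) ∈ suppIn K (rootCone m 0) := by
  rw [← xp_zero]
  exact xp_mem_suppIn zero_mem_rootCone

theorem inCone_one : InCone (1 : PowerSeries (Lau K (Fin m))) := by
  rw [← map_one PowerSeries.C]
  exact inCone_C one_mem_rootCone

theorem InCone.prod {α : Type*} (s : Finset α) {G : α → PowerSeries (Lau K (Fin m))}
    (hG : ∀ a ∈ s, InCone (G a)) : InCone (∏ a ∈ s, G a) :=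
  Finset.prod_induction G InCone (fun _ _ => InCone.mul) inCone_one hG

/-- The geometric series `1 / (1 - c X)`. -/
def geom {R : Type*} [CommRing R] (c : R) : PowerSeries R := PowerSeries.mk fun n => c ^ n

theorem geom_mul {R : Type*} [CommRing R] (c : R) :
    (1 - PowerSeries.C c * PowerSeries.X) * geom c = 1 := by
  ext n
  rw [sub_mul, one_mul, mul_assoc, map_sub, PowerSeries.coeff_C_mul]
  cases n with
  | zero => simp [geom]
  | succ n =>
    rw [PowerSeries.coeff_succ_X_mul, PowerSeries.coeff_one, if_neg n.succ_ne_zero, geom,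
      PowerSeries.coeff_mk, PowerSeries.coeff_mk, pow_succ']
    ring

theorem map_geom {R S : Type*} [CommRing R] [CommRing S] (f : R →+* S) (c : R) :
    PowerSeries.map f (geom c) = geom (f c) := by
  ext n
  simp [geom]

theorem inCone_geom {i j : Fin m} (h : i < j) : InCone (geom (xp (root i j) : Lau K (Fin m))) := by
  intro k
  rw [geom, PowerSeries.coeff_mk]
  induction k with
  | zero => simpa using one_mem_rootCone
  | succ k ih =>
    rw [pow_succ]
    exact mul_mem_suppIn (fun a ha b hb => add_mem_rootCone (by push_cast; rfl) ha hb) ih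
      (xp_mem_suppIn (root_mem_rootCone h))

/-- The factor `(1 - x_i / x_j) / (1 - h x_i / x_j)`, as a power series in `h`. -/
def deltaFactor (i j : Fin m) : PowerSeries (Lau K (Fin m)) :=
  PowerSeries.C (1 - xp (root i j)) * geom (xp (root i j))

theorem inCone_deltaFactor {i j : Fin m} (h : i < j) :
    InCone (deltaFactor i j : PowerSeries (Lau K (Fin m))) :=
  (inCone_C (Submodule.sub_mem _ one_mem_rootCone
    (suppIn_mono (rootCone_mono zero_le_one) (xp_mem_suppIn (root_mem_rootCone h))))).mul
    (inCone_geom h)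

/-- The density `∏_{i<j} (1 - x_i / x_j) / (1 - h x_i / x_j)`, as a power series in `h`. -/
def delta (K : Type) [Field K] (m : ℕ) : PowerSeries (Lau K (Fin m)) :=
  ∏ i : Fin m, ∏ j ∈ Ioi i, deltaFactor i j

theorem inCone_delta : InCone (delta K m) :=
  InCone.prod _ fun _ _ => InCone.prod _ fun _ hj => inCone_deltaFactor (mem_Ioi.1 hj)

/-- The linear functional `f ↦ ct (f G)`, where `h` is specialized to `q` in the power series
`G`. -/
def ctWith (q : K) (G : PowerSeries (Lau K (Fin m))) : Lau K (Fin m) →ₗ[K] K :=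
  Finsupp.linearCombination K
    (fun γ : Fin m → ℤ => ∑ᶠ k : ℕ, q ^ k * ct (xp γ * PowerSeries.coeff k G)) ∘ₗ
    (AddMonoidAlgebra.coeffLinearEquiv K).toLinearMap

theorem InCone.eventually {G : PowerSeries (Lau K (Fin m))} (hG : InCone G) (f : Lau K (Fin m)) :
    ∃ N, ∀ k ≥ N, ct (f * PowerSeries.coeff k G) = 0 := by
  induction f using lau_induction with
  | hx γ =>
    refine ⟨(1 - height γ).toNat, fun k hk => ?_⟩
    refine ct_eq_zero (S := {δ | 0 < height δ}) (by simp [height]) ?_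
    refine mul_mem_suppIn (S := {γ}) (fun a ha b hb => ?_) (xp_mem_suppIn rfl) (hG k)
    have := hb.1
    rw [Set.mem_singleton_iff] at ha
    show 0 < height (a + b)
    rw [height_add, ha]
    omega
  | hadd f g hf hg =>
    obtain ⟨N, hN⟩ := hf
    obtain ⟨M, hM⟩ := hg
    refine ⟨max N M, fun k hk => ?_⟩
    rw [add_mul, map_add, hN k (le_trans (le_max_left _ _) hk), hM k (le_trans (le_max_right _ _) hk),
      add_zero]
  | hsmul c f hf =>
    obtain ⟨N, hN⟩ := hf
    exact ⟨N, fun k hk => by rw [smul_mul_assoc, map_smul, hN k hk, smul_zero]⟩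

theorem InCone.finite_support {G : PowerSeries (Lau K (Fin m))} (hG : InCone G) (q : K)
    (f : Lau K (Fin m)) :
    (Function.support fun k : ℕ => q ^ k * ct (f * PowerSeries.coeff k G)).Finite := by
  obtain ⟨N, hN⟩ := hG.eventually f
  refine (Set.finite_lt_nat N).subset fun k hk => ?_
  by_contra h
  exact hk (by simp [hN k (not_lt.1 h)])

theorem ctWith_apply (q : K) {G : PowerSeries (Lau K (Fin m))} (hG : InCone G)
    (f : Lau K (Fin m)) :
    ctWith q G f = ∑ᶠ k : ℕ, q ^ k * ct (f * PowerSeries.coeff k G) := by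
  induction f using lau_induction with
  | hx γ => simp [ctWith, xp]
  | hadd f g hf hg =>
    rw [map_add, hf, hg, ← finsum_add_distrib (hG.finite_support q f) (hG.finite_support q g)]
    simp only [add_mul, map_add, mul_add]
  | hsmul c f hf =>
    rw [map_smul, hf, smul_finsum' _ (hG.finite_support q f)]
    simp only [smul_mul_assoc, map_smul, smul_eq_mul]
    congr 1
    funext k
    ring

theorem ctWith_eq_sum (q : K) {G : PowerSeries (Lau K (Fin m))} (hG : InCone G)
    (f : Lau K (Fin m)) {N : ℕ} (hN : ∀ k ≥ N, ct (f * PowerSeries.coeff k G) = 0) :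
    ctWith q G f = ∑ k ∈ range N, q ^ k * ct (f * PowerSeries.coeff k G) := by
  rw [ctWith_apply q hG]
  refine finsum_eq_sum_of_support_subset _ fun k hk => ?_
  rw [coe_range, Set.mem_Iio]
  by_contra h
  exact hk (by simp [hN k (not_lt.1 h)])

theorem ctWith_C_mul (q : K) {G : PowerSeries (Lau K (Fin m))} (hG : InCone G)
    {p : Lau K (Fin m)} (hp : p ∈ suppIn K (rootCone m 0)) (f : Lau K (Fin m)) :
    ctWith q (PowerSeries.C p * G) f = ctWith q G (p * f) := by
  rw [ctWith_apply q ((inCone_C hp).mul hG), ctWith_apply q hG]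
  simp only [PowerSeries.coeff_C_mul]
  congr 1
  funext k
  congr 2
  ring

theorem inCone_one_sub {i j : Fin m} (h : i < j) :
    InCone (1 - PowerSeries.C (xp (root i j) : Lau K (Fin m)) * PowerSeries.X) := by
  refine inCone_one.sub fun k => ?_
  cases k with
  | zero => simp
  | succ k =>
    rw [PowerSeries.coeff_C_mul, PowerSeries.coeff_X]
    split_ifs with h'
    · rw [mul_one, h']
      exact xp_mem_suppIn (root_mem_rootCone h)
    · simp

theorem ctWith_one_sub_mul (q : K) {G : PowerSeries (Lau K (Fin m))} (hG : InCone G)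
    {i j : Fin m} (h : i < j) (f : Lau K (Fin m)) :
    ctWith q ((1 - PowerSeries.C (xp (root i j)) * PowerSeries.X) * G) f =
      ctWith q G ((1 - q • xp (root i j)) * f) := by
  have hG' := (inCone_one_sub (K := K) h).mul hG
  obtain ⟨N₁, h₁⟩ := hG.eventually f
  obtain ⟨N₂, h₂⟩ := hG.eventually (xp (root i j) * f)
  obtain ⟨N₃, h₃⟩ := hG'.eventually f
  obtain ⟨N, hN⟩ : ∃ N, N₁ ≤ N ∧ N₂ ≤ N ∧ N₃ ≤ N :=
    ⟨max N₁ (max N₂ N₃), by simp, by simp, by simp⟩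
  rw [sub_mul (1 : Lau K (Fin m)), one_mul, smul_mul_assoc, map_sub, map_smul,
    ctWith_eq_sum q hG f (N := N + 1) (fun k hk => h₁ k (by omega)),
    ctWith_eq_sum q hG (xp (root i j) * f) (N := N) (fun k hk => h₂ k (by omega)),
    ctWith_eq_sum q hG' f (N := N + 1) (fun k hk => h₃ k (by omega)), sum_range_succ',
    sum_range_succ', smul_eq_mul, mul_sum, add_sub_right_comm, ← sum_sub_distrib]
  congr 1
  · refine sum_congr rfl fun k _ => ?_
    rw [sub_mul, one_mul, map_sub, mul_assoc (PowerSeries.C _), PowerSeries.coeff_C_mul,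
      PowerSeries.coeff_succ_X_mul, mul_sub, map_sub, mul_sub]
    congr 1
    rw [pow_succ', mul_left_comm f, ← mul_assoc (xp _)]
    ring
  · congr 2
    rw [sub_mul, one_mul, map_sub, mul_assoc (PowerSeries.C _), PowerSeries.coeff_C_mul]
    simp

theorem ctWith_prod_one_sub_mul {α : Type*} (q : K) {G : PowerSeries (Lau K (Fin m))}
    (hG : InCone G) (s : Finset α) (a b : α → Fin m) (hab : ∀ x ∈ s, a x < b x)
    (f : Lau K (Fin m)) :
    ctWith q ((∏ x ∈ s, (1 - PowerSeries.C (xp (root (a x) (b x))) * PowerSeries.X)) * G) f =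
      ctWith q G ((∏ x ∈ s, (1 - q • xp (root (a x) (b x)))) * f) := by
  classical
  induction s using Finset.induction_on generalizing f with
  | empty => simp
  | insert x s hx ih =>
    rw [prod_insert hx, prod_insert hx, mul_assoc, ctWith_one_sub_mul q _ (hab x (by simp)),
      ih (fun y hy => hab y (mem_insert_of_mem hy))]
    · congr 1; ring
    · exact (InCone.prod _ fun y hy => inCone_one_sub (hab y (mem_insert_of_mem hy))).mul hG

/-- The functional `f ↦ ct (f ∏_{i<j} (1 - x_i / x_j) / (1 - q x_i / x_j))`. -/
def ctDelta (q : K) : Lau K (Fin m) →ₗ[K] K := ctWith q (delta K m)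

/-- The density without the factor at `(a, b)`. -/
def deltaErase (K : Type) [Field K] (a b : Fin m) : PowerSeries (Lau K (Fin m)) :=
  ∏ p ∈ (univ.filter fun p : Fin m × Fin m => p.1 < p.2).erase (a, b), deltaFactor p.1 p.2

theorem prod_Ioi_eq_prod_filter {M : Type*} [CommMonoid M] (g : Fin m → Fin m → M) :
    ∏ i, ∏ j ∈ Ioi i, g i j = ∏ p : Fin m × Fin m with p.1 < p.2, g p.1 p.2 := by
  rw [prod_filter, ← univ_product_univ, prod_product]
  refine prod_congr rfl fun i _ => ?_
  rw [← prod_filter]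
  congr 1
  ext j
  simp

theorem delta_eq_mul_erase {a b : Fin m} (h : a < b) :
    delta K m = deltaFactor a b * deltaErase K a b := by
  rw [delta, prod_Ioi_eq_prod_filter, deltaErase]
  exact (mul_prod_erase _ (fun p : Fin m × Fin m => (deltaFactor p.1 p.2 :
    PowerSeries (Lau K (Fin m)))) (a := (a, b)) (by simpa using h)).symm

theorem map_deltaFactor {k : ℕ} (φ : (Fin m → ℤ) →+ (Fin k → ℤ)) {i j : Fin m} {i' j' : Fin k}
    (h : φ (root i j) = root i' j') :
    PowerSeries.map (mapX φ : Lau K (Fin m) →ₐ[K] Lau K (Fin k)).toRingHom (deltaFactor i j) =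
      deltaFactor i' j' := by
  simp [deltaFactor, map_geom, h]

theorem map_sw_deltaErase {a b : Fin m} (hab : (a : ℕ) + 1 = b) :
    PowerSeries.map (sw a b : Lau K (Fin m) →ₐ[K] Lau K (Fin m)).toRingHom (deltaErase K a b) =
      deltaErase K a b := by
  rw [deltaErase, map_prod]
  refine prod_nbij (Prod.map (swap a b) (swap a b)) ?_
    ((swap a b).injective.prodMap (swap a b).injective).injOn ?_ ?_
  · rintro ⟨i, j⟩ h
    simp only [mem_erase, mem_filter, mem_univ, true_and, Prod.mk.injEq, Ne, Prod.map_apply] at h ⊢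
    refine ⟨?_, swap_adj_lt hab h.2 h.1⟩
    rintro ⟨h1, h2⟩
    rw [swap_apply_eq_iff, swap_apply_left] at h1
    rw [swap_apply_eq_iff, swap_apply_right] at h2
    have := h.2
    rw [h1, h2, Fin.lt_def] at this
    omega
  · rintro ⟨i, j⟩ h
    simp only [coe_erase, coe_filter, mem_univ, true_and, Set.mem_sdiff, Set.mem_ofPred_eq,
      Set.mem_singleton_iff, Prod.mk.injEq] at h
    refine ⟨(swap a b i, swap a b j), ?_, by simp⟩
    simp only [coe_erase, coe_filter, mem_univ, true_and, Set.mem_sdiff, Set.mem_ofPred_eq,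
      Set.mem_singleton_iff, Prod.mk.injEq]
    refine ⟨swap_adj_lt hab h.1 h.2, ?_⟩
    rintro ⟨h1, h2⟩
    rw [swap_apply_eq_iff, swap_apply_left] at h1
    rw [swap_apply_eq_iff, swap_apply_right] at h2
    have := h.1
    rw [h1, h2, Fin.lt_def] at this
    omega
  · rintro ⟨i, j⟩ h
    refine map_deltaFactor _ ?_
    rw [reidx_root, swap_inv]
    rfl

theorem inCone_deltaErase (a b : Fin m) : InCone (deltaErase K a b) :=
  InCone.prod _ fun p hp => inCone_deltaFactor (by simpa using (mem_erase.1 hp).2)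

theorem reidx_swap_injective (a b : Fin m) : Function.Injective (reidx (swap a b)) := by
  intro γ δ h
  simp only [reidx_apply] at h
  rw [← comp_swap_swap a b γ, h, comp_swap_swap]

theorem ctWith_deltaErase_sw (q : K) {a b : Fin m} (hab : (a : ℕ) + 1 = b) (f : Lau K (Fin m)) :
    ctWith q (deltaErase K a b) (sw a b f) = ctWith q (deltaErase K a b) f := by
  rw [ctWith_apply q (inCone_deltaErase a b), ctWith_apply q (inCone_deltaErase a b)]
  congr 1
  funext k
  congr 1
  have h := congrArg (PowerSeries.coeff k) (map_sw_deltaErase (K := K) hab)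
  rw [PowerSeries.coeff_map] at h
  have h' : sw a b (PowerSeries.coeff k (deltaErase K a b)) =
    PowerSeries.coeff k (deltaErase K a b) := h
  conv_lhs => rw [← h', ← map_mul]
  exact ct_mapX _ (reidx_swap_injective a b) _

/-- The operators `U` are self-adjoint. After removing the factor of the density at `(a, b)`, this
is the invariance of the constant term under the exchange of `x_a` and `x_b`. -/
theorem ctDelta_heckeU_mul (q : K) {a b : Fin m} (hab : (a : ℕ) + 1 = b) (f g : Lau K (Fin m)) :
    ctDelta q (heckeU q a b f * g) = ctDelta q (f * heckeU q a b g) := by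
  have hlt : a < b := by rw [Fin.lt_def]; omega
  have hf := mul_divDiff a b f
  have hg := mul_divDiff a b g
  have hr := xp_root_mul (K := K) a b
  set y : Lau K (Fin m) := xp (root a b) with hy
  set y' : Lau K (Fin m) := xp (root b a) with hy'
  have hred : ∀ C : Lau K (Fin m), ctDelta q ((1 - q • y) * C) =
      ctWith q (deltaErase K a b) ((1 - y) * C) := by
    intro C
    have hp : (1 - y : Lau K (Fin m)) ∈ suppIn K (rootCone m 0) :=
      Submodule.sub_mem _ one_mem_rootCone
        (suppIn_mono (rootCone_mono zero_le_one) (xp_mem_suppIn (root_mem_rootCone hlt)))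
    rw [ctDelta, ← ctWith_one_sub_mul q inCone_delta hlt, delta_eq_mul_erase hlt, deltaFactor,
      ← ctWith_C_mul q (inCone_deltaErase a b) hp]
    congr 2
    have := geom_mul y
    linear_combination (PowerSeries.C (1 - y) * deltaErase K a b) * this
  -- `C` is the antisymmetric function `g s(f) - f s(g)` divided by a multiple of `1 - x_a / x_b`
  have key : heckeU q a b f * g - f * heckeU q a b g =
      (1 - q • y) * (y' * (f * divDiff a b g - g * divDiff a b f)) := by
    simp only [heckeU_apply, Algebra.smul_def, map_sub, map_one]
    linear_combination (-g) * hf + f * hg + (algebraMap K (Lau K (Fin m)) q) *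
      (f * divDiff a b g - g * divDiff a b f) * hr
  have key' : (1 - y) * (y' * (f * divDiff a b g - g * divDiff a b f)) =
      sw a b f * g - sw a b (sw a b f * g) := by
    rw [map_mul, sw_sw]
    linear_combination (f * divDiff a b g - g * divDiff a b f) * (-hr) - f * hg + g * hf
  rw [← sub_eq_zero, ← map_sub, key, hred, key', map_sub, ctWith_deltaErase_sw q hab, sub_self]

theorem ctDelta_heckeV_mul (q : K) {a b : Fin m} (hab : (a : ℕ) + 1 = b) (f g : Lau K (Fin m)) :
    ctDelta q (heckeV q a b f * g) = ctDelta q (f * heckeV q a b g) := by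
  simp only [heckeV_apply, add_mul, mul_add, map_add, ctDelta_heckeU_mul q hab, smul_mul_assoc,
    mul_smul_comm]

theorem ctWith_eq_zero (q : K) {G : PowerSeries (Lau K (Fin m))} (hG : InCone G)
    {S : Set (Fin m → ℤ)} (hS : ∀ γ ∈ S, ∀ δ ∈ rootCone m 0, γ + δ ≠ 0) {f : Lau K (Fin m)}
    (hf : f ∈ suppIn K S) : ctWith q G f = 0 := by
  rw [ctWith_apply q hG]
  refine finsum_eq_zero_of_forall_eq_zero fun k => ?_
  rw [ct_eq_zero (S := {δ | δ ≠ 0}) (by simp), mul_zero]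
  exact mul_mem_suppIn hS hf (suppIn_mono (rootCone_mono (by positivity)) (hG k))

theorem ctDelta_eq_zero_of_first (q : K) {f : Lau K (Fin (m + 1))}
    (hf : f ∈ suppIn K {γ : Fin (m + 1) → ℤ | 0 < γ 0}) : ctDelta q f = 0 := by
  refine ctWith_eq_zero q inCone_delta (fun γ hγ δ hδ h => ?_) hf
  have h0 := hδ.2.1 0
  have h1 := congrFun h 0
  have : Iic (0 : Fin (m + 1)) = {0} := by ext i; simp
  rw [this, sum_singleton] at h0
  simp only [Set.mem_ofPred_eq] at hγ
  simp only [Pi.add_apply, Pi.zero_apply] at h1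
  omega

theorem ctDelta_eq_zero_of_last (q : K) {f : Lau K (Fin (m + 1))}
    (hf : f ∈ suppIn K {γ : Fin (m + 1) → ℤ | γ (Fin.last m) < 0}) : ctDelta q f = 0 := by
  refine ctWith_eq_zero q inCone_delta (fun γ hγ δ hδ h => ?_) hf
  have h1 := congrFun h (Fin.last m)
  have h2 := hδ.2.2
  simp only [Set.mem_ofPred_eq] at hγ
  simp only [Pi.add_apply, Pi.zero_apply] at h1
  rw [Fin.sum_univ_castSucc] at h2
  cases m with
  | zero =>
    rw [Fin.sum_univ_zero, zero_add] at h2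
    omega
  | succ m =>
    have h3 := hδ.2.1 (Fin.last m).castSucc
    have : Iic (Fin.last m).castSucc = univ.map Fin.castSuccEmb := by
      ext i
      simp only [mem_Iic, mem_map, mem_univ, true_and, Fin.coe_castSuccEmb]
      constructor
      · intro hi
        have hne : i ≠ Fin.last (m + 1) := by
          rintro rfl
          exact absurd hi (not_le.2 (Fin.castSucc_lt_last _))
        exact ⟨i.castPred hne, Fin.castSucc_castPred _ _⟩
      · rintro ⟨j, rfl⟩
        exact Fin.castSucc_le_castSucc_iff.2 (Fin.le_last _)
    rw [this, sum_map] at h3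
    simp only [Fin.coe_castSuccEmb] at h3
    omega

end Functional

/-! ### Extraction of the first variable from the constant term -/

section FirstVariable

variable {K : Type} [Field K] {m : ℕ}

/-- The inclusion of the Laurent polynomials in `x_2, …, x_{m+1}`. -/
abbrev inclSucc (K : Type) [Field K] (m : ℕ) : Lau K (Fin m) →ₐ[K] Lau K (Fin (m + 1)) :=
  mapX (extz Fin.succ)

theorem extz_succ_zero (γ : Fin m → ℤ) : extz Fin.succ γ (0 : Fin (m + 1)) = 0 :=
  extz_of_notMem _ _ _ fun i => Fin.succ_ne_zero i

theorem extz_succ_root (i j : Fin m) : extz Fin.succ (root i j) = root i.succ j.succ :=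
  extz_root _ (Fin.succ_injective m) _ _

theorem map_inclSucc_delta :
    PowerSeries.map (inclSucc K m).toRingHom (delta K m) =
      ∏ i : Fin m, ∏ j ∈ Ioi i, deltaFactor i.succ j.succ := by
  simp only [delta, map_prod]
  exact prod_congr rfl fun i _ => prod_congr rfl fun j _ => map_deltaFactor _ (extz_succ_root i j)

theorem delta_succ : delta K (m + 1) = (∏ j : Fin m, deltaFactor 0 j.succ) *
    PowerSeries.map (inclSucc K m).toRingHom (delta K m) := by
  rw [map_inclSucc_delta, delta, Fin.prod_univ_succ, Fin.prod_Ioi_zero]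
  simp only [Fin.prod_Ioi_succ]

theorem inCone_map_delta : InCone (PowerSeries.map (inclSucc K m).toRingHom (delta K m)) := by
  rw [map_inclSucc_delta]
  exact InCone.prod _ fun i _ => InCone.prod _ fun j hj =>
    inCone_deltaFactor (Fin.succ_lt_succ_iff.2 (mem_Ioi.1 hj))

/-- The density for the variables `x_2, …, x_{m+1}` alone: the constant term in `x_1` can be taken
first. -/
theorem ctWith_map_delta (q : K) (k : ℤ) (G : Lau K (Fin m)) :
    ctWith q (PowerSeries.map (inclSucc K m).toRingHom (delta K m))
      (xp (Pi.single 0 k) * inclSucc K m G) = if k = 0 then ctDelta q G else 0 := by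
  have key : ∀ n : ℕ, ct ((xp (Pi.single 0 k) * inclSucc K m G) *
      PowerSeries.coeff n (PowerSeries.map (inclSucc K m).toRingHom (delta K m))) =
      if k = 0 then ct (G * PowerSeries.coeff n (delta K m)) else 0 := by
    intro n
    have e : PowerSeries.coeff n (PowerSeries.map (inclSucc K m).toRingHom (delta K m)) =
      inclSucc K m (PowerSeries.coeff n (delta K m)) := PowerSeries.coeff_map _ _ _
    rw [e, mul_assoc, ← map_mul]
    split_ifs with hk
    · subst hk
      rw [Pi.single_zero, xp_zero, one_mul, ct_mapX _ (extz_injective _ (Fin.succ_injective m))]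
    · refine ct_eq_zero (S := {γ | γ 0 = k}) (fun h => hk h.symm) ?_
      refine mul_mem_suppIn (S := {(Pi.single 0 k : Fin (m + 1) → ℤ)}) (T := {γ | γ 0 = 0}) (fun a ha b hb => ?_)
        (xp_mem_suppIn rfl) (mapX_mem_suppIn _ (S := Set.univ) (fun a _ => extz_succ_zero a) ?_)
      · rw [Set.mem_singleton_iff] at ha
        have hb' : b 0 = 0 := hb
        simp [ha, hb']
      · exact mem_suppIn.2 fun γ h => absurd (Set.mem_univ γ) h
  rw [ctWith_apply q inCone_map_delta]
  simp only [key]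
  split_ifs with hk
  · rw [ctDelta, ctWith_apply q inCone_delta]
  · simp

/-- The series `∏_j (1 - c z / x_j)` in `z`. -/
def linSeries (c : K) : PowerSeries (Lau K (Fin m)) :=
  ∏ j : Fin m, (1 - PowerSeries.C (c • xp (-Pi.single j 1)) * PowerSeries.X)

/-- The series `∏_j (1 - c z / x_j) / (1 - d z / x_j)` in `z`. -/
def ratioSeries (c d : K) : PowerSeries (Lau K (Fin m)) :=
  linSeries c * ∏ j : Fin m, geom (d • xp (-Pi.single j 1))

theorem linSeries_mul_geom (c : K) :
    linSeries c * ∏ j : Fin m, geom (c • xp (-Pi.single j 1) : Lau K (Fin m)) = 1 := by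
  rw [linSeries, ← prod_mul_distrib]
  exact prod_eq_one fun j _ => geom_mul _

theorem ratioSeries_mul_ratioSeries (c d : K) :
    (ratioSeries c d * ratioSeries d c : PowerSeries (Lau K (Fin m))) = 1 := by
  have h1 := linSeries_mul_geom (m := m) c
  have h2 := linSeries_mul_geom (m := m) d
  rw [ratioSeries, ratioSeries]
  linear_combination (linSeries (m := m) d * ∏ j : Fin m, geom (d • xp (-Pi.single j 1) :
    Lau K (Fin m))) * h1 + h2

theorem linSeries_mul_ratioSeries (c d : K) :
    (linSeries d * ratioSeries c d : PowerSeries (Lau K (Fin m))) = linSeries c := by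
  rw [ratioSeries, mul_left_comm, linSeries_mul_geom, mul_one]

/-- The polynomial `∏_j (1 - c z / x_j)`. -/
def linPoly (c : K) : Polynomial (Lau K (Fin m)) :=
  ∏ j : Fin m, (1 - Polynomial.C (c • xp (-Pi.single j 1)) * Polynomial.X)

theorem coeff_linPoly (c : K) (n : ℕ) :
    (linPoly c : Polynomial (Lau K (Fin m))).coeff n = PowerSeries.coeff n (linSeries c) := by
  rw [← Polynomial.coeff_coe]
  congr 1
  rw [linPoly, ← Polynomial.coeToPowerSeries.ringHom_apply, map_prod, linSeries]
  simp [Polynomial.coeToPowerSeries.ringHom_apply]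

theorem linPoly_eval₂ (c : K) :
    (linPoly c : Polynomial (Lau K (Fin m))).eval₂ (inclSucc K m).toRingHom
      (xp (Pi.single 0 1)) = ∏ j : Fin m, (1 - c • xp (root 0 j.succ)) := by
  rw [linPoly, Polynomial.eval₂_finsetProd]
  refine prod_congr rfl fun j _ => ?_
  simp only [Polynomial.eval₂_sub, Polynomial.eval₂_one, Polynomial.eval₂_mul, Polynomial.eval₂_C,
    Polynomial.eval₂_X]
  congr 1
  show inclSucc K m (c • xp (-Pi.single j 1)) * _ = _
  rw [map_smul, mapX_xp, smul_mul_assoc, ← xp_add, map_neg, extz_single _ (Fin.succ_injective m),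
    root, neg_add_eq_sub]

/-- The expansion of `∏_j (1 - c x_1 / x_j)` in powers of `x_1`. -/
theorem prod_one_sub_mul (c : K) (k : ℤ) (G : Lau K (Fin m)) {N : ℕ}
    (hN : (linPoly c : Polynomial (Lau K (Fin m))).natDegree < N) :
    (∏ j : Fin m, (1 - c • xp (root 0 j.succ))) * (xp (Pi.single 0 k) * inclSucc K m G) =
      ∑ i ∈ range N, xp (Pi.single 0 (k + i)) *
        inclSucc K m (PowerSeries.coeff i (linSeries c) * G) := by
  rw [← linPoly_eval₂, Polynomial.eval₂_eq_sum_range' _ hN, sum_mul]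
  refine sum_congr rfl fun i _ => ?_
  rw [coeff_linPoly, xp_pow, map_mul]
  have e : i • (Pi.single 0 1 : Fin (m + 1) → ℤ) = Pi.single 0 (i : ℤ) := by
    rw [← Pi.single_smul]; simp
  rw [e, Pi.single_add, xp_add]
  simp only [AlgHom.toRingHom_eq_coe, RingHom.coe_coe]
  ring

/-- Taking the constant term in the first variable `z`: it extracts the coefficient of `z^n` in
`∏_j (1 - z / x_j) / (1 - q z / x_j)`. Clearing the denominators gives a triangular recursion for
the left hand sides, with the coefficients of `∏_j (1 - q z / x_j)`. -/
theorem ctDelta_first (q : K) (n : ℕ) (G : Lau K (Fin m)) :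
    ctDelta q (xp (Pi.single 0 (-n : ℤ)) * inclSucc K m G) =
      ctDelta q (PowerSeries.coeff n (ratioSeries 1 q) * G) := by
  have hpos : ∀ (k : ℤ) (G : Lau K (Fin m)), 0 < k →
      ctDelta q (xp (Pi.single 0 k) * inclSucc K m G) = 0 := by
    intro k G hk
    refine ctDelta_eq_zero_of_first q ?_
    refine mul_mem_suppIn (S := {(Pi.single 0 k : Fin (m + 1) → ℤ)}) (T := {γ | γ 0 = 0}) (fun a ha b hb => ?_)
      (xp_mem_suppIn rfl) (mapX_mem_suppIn _ (S := Set.univ) (fun a _ => extz_succ_zero a) ?_)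
    · rw [Set.mem_singleton_iff] at ha
      have hb' : b 0 = 0 := hb
      simp [ha, hb', hk]
    · exact mem_suppIn.2 fun γ h => absurd (Set.mem_univ γ) h
  -- multiplying by `∏_j (1 - q z / x_j)` removes the factors of the density which involve `z` and
  -- leaves `∏_j (1 - z / x_j)`
  have hrec : ∀ (n : ℕ) (G : Lau K (Fin m)), ∑ i ∈ range (n + 1), ctDelta q
      (xp (Pi.single 0 (-n + i : ℤ)) * inclSucc K m (PowerSeries.coeff i (linSeries q) * G)) =
      ctDelta q (PowerSeries.coeff n (linSeries 1) * G) := by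
    intro n G
    obtain ⟨N, h1, h2, h3⟩ : ∃ N, (linPoly q : Polynomial (Lau K (Fin m))).natDegree < N ∧
        (linPoly 1 : Polynomial (Lau K (Fin m))).natDegree < N ∧ n + 1 ≤ N :=
      ⟨(linPoly q : Polynomial (Lau K (Fin m))).natDegree +
        (linPoly 1 : Polynomial (Lau K (Fin m))).natDegree + n + 1, by omega, by omega, by omega⟩
    have hp : (∏ j : Fin m, (1 - (1 : K) • xp (root 0 j.succ)) : Lau K (Fin (m + 1))) ∈
        suppIn K (rootCone (m + 1) 0) := by
      have := InCone.prod (K := K) univ (G := fun j : Fin m =>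
        PowerSeries.C (1 - xp (root (0 : Fin (m + 1)) j.succ))) (fun j _ => inCone_C
        (Submodule.sub_mem _ one_mem_rootCone (suppIn_mono (rootCone_mono zero_le_one)
          (xp_mem_suppIn (root_mem_rootCone (Fin.succ_pos j)))))) 0
      rw [← map_prod, PowerSeries.coeff_zero_C] at this
      simpa using this
    have hsplit : (∏ j : Fin m, (1 - PowerSeries.C (xp (root (0 : Fin (m + 1)) j.succ) :
        Lau K (Fin (m + 1))) * PowerSeries.X)) * delta K (m + 1) =
        PowerSeries.C (∏ j : Fin m, (1 - (1 : K) • xp (root 0 j.succ))) *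
          PowerSeries.map (inclSucc K m).toRingHom (delta K m) := by
      rw [delta_succ, ← mul_assoc, ← prod_mul_distrib, map_prod]
      congr 1
      refine prod_congr rfl fun j _ => ?_
      rw [deltaFactor, mul_left_comm, geom_mul, mul_one, one_smul]
    have hmain := ctWith_prod_one_sub_mul q (inCone_delta (K := K) (m := m + 1)) univ
      (fun _ : Fin m => 0) Fin.succ (fun j _ => Fin.succ_pos j)
      (xp (Pi.single 0 (-n : ℤ)) * inclSucc K m G)
    rw [hsplit, ctWith_C_mul q inCone_map_delta hp, prod_one_sub_mul q _ G h1,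
      prod_one_sub_mul 1 _ G h2, map_sum, map_sum] at hmain
    rw [sum_eq_single n] at hmain
    · rw [ctWith_map_delta, if_pos (by omega)] at hmain
      rw [hmain]
      refine sum_subset (range_mono h3) fun i _ hi => ?_
      rw [mem_range] at hi
      exact hpos _ _ (by omega)
    · intro i _ hi
      rw [ctWith_map_delta, if_neg (by omega)]
    · intro h
      rw [mem_range] at h
      omega
  have h0 : PowerSeries.coeff 0 (linSeries q : PowerSeries (Lau K (Fin m))) = 1 := by
    simp [linSeries]
  induction n using Nat.strong_induction_on generalizing G with
  | _ n ih =>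
    have h := hrec n G
    have hc : PowerSeries.coeff n (linSeries (m := m) (1 : K)) = ∑ i ∈ range (n + 1),
        PowerSeries.coeff i (linSeries q) * PowerSeries.coeff (n - i) (ratioSeries 1 q) := by
      rw [← linSeries_mul_ratioSeries 1 q, PowerSeries.coeff_mul,
        Finset.Nat.sum_antidiagonal_eq_sum_range_succ
          (fun i j => PowerSeries.coeff i (linSeries (m := m) q) *
            PowerSeries.coeff j (ratioSeries 1 q))]
    rw [hc, sum_mul, map_sum, sum_range_succ', sum_range_succ'] at h
    have htail : ∑ i ∈ range n, ctDelta q (xp (Pi.single 0 (-n + (i + 1 : ℕ) : ℤ)) *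
        inclSucc K m (PowerSeries.coeff (i + 1) (linSeries q) * G)) =
        ∑ i ∈ range n, ctDelta q (PowerSeries.coeff (i + 1) (linSeries q) *
          PowerSeries.coeff (n - (i + 1)) (ratioSeries 1 q) * G) := by
      refine sum_congr rfl fun i hi => ?_
      rw [mem_range] at hi
      have e : (-n + (i + 1 : ℕ) : ℤ) = -((n - (i + 1) : ℕ) : ℤ) := by omega
      rw [e, ih _ (by omega)]
      congr 1
      ring
    rw [htail] at h
    have h' := add_left_cancel h
    rw [h0, one_mul, one_mul] at h'
    simpa using h'

theorem ctDelta_inclSucc (q : K) (G : Lau K (Fin m)) :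
    ctDelta q (inclSucc K m G) = ctDelta q G := by
  have h := ctDelta_first q 0 G
  have h0 : PowerSeries.coeff 0 (ratioSeries (m := m) 1 q) = 1 := by
    simp [ratioSeries, linSeries, geom]
  rw [h0, one_mul] at h
  simpa using h

end FirstVariable

/-! ### Orthogonality -/

section Duality

variable {K : Type} [Field K] {m : ℕ}

/-- The exponents which are at least `N`, and larger than `N` up to the position `k`. -/
def lowSet (k : Fin (m + 1)) (N : ℤ) : Set (Fin (m + 1) → ℤ) :=
  {γ | (∀ j ≤ k, N < γ j) ∧ ∀ j, N ≤ γ j}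

theorem genHL_mem_ge (q : K) (w : Fin m → ℤ) (r : Fin m → ℝ) {N : ℤ} (hw : ∀ i, N ≤ w i) :
    genHL q w r ∈ suppIn K {γ : Fin m → ℤ | ∀ i, N ≤ γ i} := by
  refine suppIn_mono (fun γ hγ i => (hγ.1 i).1)
    (genHL_mem_box q w r (N := N) (M := ∑ i, |w i|) (d := ∑ i, w i) ⟨fun i => ⟨hw i, ?_⟩, rfl⟩)
  exact (le_abs_self _).trans
    (single_le_sum (f := fun i => |w i|) (fun i _ => abs_nonneg _) (mem_univ i))

theorem genHL_mem_le (q : K) (w : Fin m → ℤ) (r : Fin m → ℝ) {M : ℤ} (hw : ∀ i, w i ≤ M) :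
    genHL q w r ∈ suppIn K {γ : Fin m → ℤ | ∀ i, γ i ≤ M} := by
  refine suppIn_mono (fun γ hγ i => (hγ.1 i).2)
    (genHL_mem_box q w r (N := -∑ i, |w i|) (M := M) (d := ∑ i, w i) ⟨fun i => ⟨?_, hw i⟩, rfl⟩)
  have h1 := neg_abs_le (w i)
  have h2 := single_le_sum (f := fun i => |w i|) (fun i _ => abs_nonneg _) (mem_univ i)
  omega

theorem heckeU_xp_sub_mem (q : K) {a b : Fin (m + 1)} (hab : (a : ℕ) + 1 = b) {N : ℤ}
    {γ : Fin (m + 1) → ℤ} (hγ : ∀ j, N ≤ γ j) (hγ' : ∀ j < a, N < γ j) :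
    heckeU q a b (xp γ) - xp (γ ∘ swap a b) ∈ suppIn K (lowSet a N) := by
  have nab := ne_of_adj hab
  rw [heckeU_apply, sw_xp, add_sub_cancel_left]
  refine Submodule.smul_mem _ _ (suppIn_mono ?_ (divDiff_xp_mem nab γ))
  rintro δ ⟨h1, h2, h3, h4⟩
  have ha := hγ a
  have hb := hγ b
  refine ⟨fun j hj => ?_, fun j => ?_⟩
  · rcases eq_or_ne j a with rfl | hja
    · omega
    · have hlt : j < a := lt_of_le_of_ne hj hja
      have hjb : j ≠ b := by
        rintro rfl
        rw [Fin.lt_def] at hlt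
        omega
      rw [h1 j hja hjb]
      exact hγ' j hlt
  · rcases eq_or_ne j a with rfl | hja
    · omega
    · rcases eq_or_ne j b with rfl | hjb
      · omega
      · rw [h1 j hja hjb]
        exact hγ j

theorem heckeA_mem_lowSet (q : K) {a b : Fin (m + 1)} (hab : (a : ℕ) + 1 = b) (p : Prop) {N : ℤ}
    {f : Lau K (Fin (m + 1))} (hf : f ∈ suppIn K (lowSet b N)) :
    heckeA q a b p f ∈ suppIn K (lowSet a N) := by
  have hlt : a < b := by rw [Fin.lt_def]; omega
  have hsub : (lowSet b N : Set (Fin (m + 1) → ℤ)) ⊆ lowSet a N :=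
    fun γ hγ => ⟨fun j hj => hγ.1 j (hj.trans hlt.le), hγ.2⟩
  have hU : heckeU q a b f ∈ suppIn K (lowSet a N) := by
    refine map_mem_of_suppIn (heckeU q a b) (fun γ hγ => ?_) hf
    have h1 := heckeU_xp_sub_mem q hab hγ.2 (fun j hj => hγ.1 j (hj.trans hlt).le)
    have h2 : (xp (γ ∘ swap a b) : Lau K (Fin (m + 1))) ∈ suppIn K (lowSet a N) := by
      refine xp_mem_suppIn ⟨fun j hj => hγ.1 _ ?_, fun j => hγ.2 _⟩
      rcases eq_or_ne j a with rfl | hja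
      · rw [swap_apply_left]
      · rw [swap_apply_of_ne_of_ne hja (lt_of_le_of_lt hj hlt).ne]
        exact hj.trans hlt.le
    simpa using Submodule.add_mem _ h1 h2
  by_cases h : p
  · rw [heckeA_pos q a b h, heckeV_apply]
    exact Submodule.add_mem _ hU (Submodule.smul_mem _ _ (suppIn_mono hsub hf))
  · rwa [heckeA_neg q a b h]

theorem heckeA_xp_sub_mem (q : K) {a b : Fin (m + 1)} (hab : (a : ℕ) + 1 = b) (p : Prop) {N : ℤ}
    {γ : Fin (m + 1) → ℤ} (hγ : γ b = N) (hγ' : ∀ j, j ≠ b → N < γ j) :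
    heckeA q a b p (xp γ) - xp (γ ∘ swap a b) ∈ suppIn K (lowSet a N) := by
  have hlt : a < b := by rw [Fin.lt_def]; omega
  have hge : ∀ j, N ≤ γ j := fun j => by
    rcases eq_or_ne j b with rfl | h
    · exact hγ.ge
    · exact (hγ' j h).le
  have hU := heckeU_xp_sub_mem q hab hge (fun j hj => hγ' j (hj.trans hlt).ne)
  by_cases h : p
  · rw [heckeA_pos q a b h, heckeV_apply, add_sub_right_comm]
    exact Submodule.add_mem _ hU (Submodule.smul_mem _ _ (xp_mem_suppIn
      ⟨fun j hj => hγ' j (lt_of_le_of_lt hj hlt).ne, hge⟩))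
  · rwa [heckeA_neg q a b h]

theorem swap_succAbove (i : Fin m) (j : Fin m) :
    swap i.castSucc i.succ (i.succ.succAbove j) = i.castSucc.succAbove j := by
  simp only [Fin.succAbove, swap_apply_def, Fin.ext_iff, Fin.lt_def]
  split_ifs <;> simp_all <;> omega

/-- If the weight has a strict minimum `w k`, then up to exponents in `lowSet k (w k)` the
polynomial `genHL` is `x_k ^ w k` times the polynomial for the remaining variables. The proof moves
`k` to the last position, where there is equality. -/
theorem genHL_bottom (q : K) (k : Fin (m + 1)) (w : Fin (m + 1) → ℤ) (r : Fin (m + 1) → ℝ)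
    (hw : ∀ j, j ≠ k → w k < w j) (hr : ∀ j, j ≠ k → r k < r j) (hc : Narrow fun i => r i - w i) :
    genHL q w r - xp (Pi.single k (w k)) *
      mapX (extz k.succAbove) (genHL q (w ∘ k.succAbove) (r ∘ k.succAbove)) ∈
        suppIn K (lowSet k (w k)) := by
  induction k using Fin.reverseInduction generalizing w r with
  | last =>
    rw [genHL_castSucc q w r (fun i => ?_) hc, Fin.succAbove_last, sub_self]
    · exact Submodule.zero_mem _
    · rcases eq_or_ne i (Fin.last m) with rfl | h
      · exact le_rfl
      · exact (hw i h).le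
  | cast i ih =>
    set a := i.castSucc with ha
    set b := i.succ with hb
    have hab : (a : ℕ) + 1 = b := by simp [ha, hb]
    have nab := ne_of_adj hab
    have hsw : ∀ j, j ≠ b → swap a b j ≠ a := by
      intro j hj h
      rw [swap_apply_eq_iff, swap_apply_left] at h
      exact hj h
    have ih' := ih (w ∘ swap a b) (r ∘ swap a b)
      (fun j hj => by simpa using hw _ (hsw j hj)) (fun j hj => by simpa using hr _ (hsw j hj))
      (fun i j => hc _ _)
    have e1 : (w ∘ swap a b) ∘ b.succAbove = w ∘ a.succAbove := by
      funext j; simp only [Function.comp, ha, hb, swap_succAbove]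
    have e2 : (r ∘ swap a b) ∘ b.succAbove = r ∘ a.succAbove := by
      funext j; simp only [Function.comp, ha, hb, swap_succAbove]
    have e3 : (w ∘ swap a b) b = w a := by simp
    rw [e1, e2, e3] at ih'
    rw [genHL_step q w r hab (hr b nab.symm)]
    set p := r b - w b < r a - w a
    set f₀ := genHL q (w ∘ a.succAbove) (r ∘ a.succAbove) with hf₀
    have h1 := heckeA_mem_lowSet q hab p ih'
    have hmem : f₀ ∈ suppIn K {δ : Fin m → ℤ | ∀ j, w a + 1 ≤ δ j} :=
      genHL_mem_ge q _ _ fun j => by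
        have := hw (a.succAbove j) (Fin.succAbove_ne _ _)
        simp only [Function.comp]
        omega
    -- the error made by moving the split variable from position `b` to position `a`; being linear
    -- in the polynomial `f₀` of the other variables, it can be estimated on monomials
    let L : Lau K (Fin m) →ₗ[K] Lau K (Fin (m + 1)) :=
      heckeA q a b p ∘ₗ LinearMap.mulLeft K (xp (Pi.single b (w a))) ∘ₗ
        (mapX (extz b.succAbove)).toLinearMap -
      LinearMap.mulLeft K (xp (Pi.single a (w a))) ∘ₗ (mapX (extz a.succAbove)).toLinearMap
    have h2 : L f₀ ∈ suppIn K (lowSet a (w a)) := by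
      refine map_mem_of_suppIn L (fun δ hδ => ?_) hmem
      simp only [L, LinearMap.sub_apply, LinearMap.comp_apply, LinearMap.mulLeft_apply,
        AlgHom.toLinearMap_apply, mapX_xp, ← xp_add]
      have e4 : Pi.single a (w a) + extz a.succAbove δ =
          (Pi.single b (w a) + extz b.succAbove δ) ∘ swap a b := by
        have inj := Fin.succAbove_right_injective (p := a)
        have inj' := Fin.succAbove_right_injective (p := b)
        funext j
        simp only [Function.comp, Pi.add_apply]
        rcases eq_or_ne j a with rfl | hj
        · rw [swap_apply_left, Pi.single_eq_same, Pi.single_eq_same,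
            extz_of_notMem _ _ _ (fun i => Fin.succAbove_ne _ i),
            extz_of_notMem _ _ _ (fun i => Fin.succAbove_ne _ i)]
        · obtain ⟨j', rfl⟩ := Fin.exists_succAbove_eq hj
          have e5 : swap a b (a.succAbove j') = b.succAbove j' := by
            rw [swap_apply_eq_iff]; exact (swap_succAbove i j').symm
          rw [e5, Pi.single_eq_of_ne (Fin.succAbove_ne _ _),
            Pi.single_eq_of_ne (Fin.succAbove_ne _ _), extz_apply _ inj, extz_apply _ inj']
      rw [e4]
      refine heckeA_xp_sub_mem q hab p ?_ fun j hj => ?_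
      · rw [Pi.add_apply, Pi.single_eq_same, extz_of_notMem _ _ _ (fun i => Fin.succAbove_ne _ i),
          add_zero]
      · obtain ⟨j', rfl⟩ := Fin.exists_succAbove_eq hj
        rw [Pi.add_apply, Pi.single_eq_of_ne hj, zero_add,
          extz_apply _ Fin.succAbove_right_injective]
        have := hδ j'
        omega
    have h3 := Submodule.add_mem _ h1 h2
    convert h3 using 1
    simp only [L, LinearMap.sub_apply, LinearMap.comp_apply, LinearMap.mulLeft_apply,
      AlgHom.toLinearMap_apply, map_sub]
    abel

/-- The pairing of two non-symmetric Hall–Littlewood polynomials. -/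
def pairing (q : K) (c : Fin m → ℝ) (w w' : Fin m → ℤ) : K :=
  ctDelta q (genHL q w (fun i => w i + c i) * genHL q (-w') (fun i => -(w' i + c i)))

theorem add_ne_add_of_narrow {c : Fin m → ℝ} (hc : Narrow c) (hinj : Function.Injective c)
    {i j : Fin m} (hij : i ≠ j) (x y : ℤ) : (x : ℝ) + c i ≠ y + c j := by
  intro h
  have h1 := hc i j
  have h2 := hc j i
  have h3 : (y : ℝ) - x < 1 := by linarith
  have h4 : (x : ℝ) - y < 1 := by linarith
  have h5 : x = y := by norm_cast at h3 h4; omega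
  rw [h5, add_right_inj] at h
  exact hij (hinj h)

theorem genHL_swap (q : K) {a b : Fin m} (hab : (a : ℕ) + 1 = b) (w : Fin m → ℤ) {r : Fin m → ℝ}
    (h : r b < r a) : genHL q (w ∘ swap a b) (r ∘ swap a b) =
      heckeA q a b (r a - w a < r b - w b) (genHL q w r) := by
  rw [genHL_step q (w ∘ swap a b) (r ∘ swap a b) hab (by simpa using h), comp_swap_swap,
    comp_swap_swap]
  simp

theorem heckeV_genHL (q : K) {a b : Fin m} (hab : (a : ℕ) + 1 = b) (w : Fin m → ℤ) {r : Fin m → ℝ}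
    (hr : r a ≠ r b) (hc : r a - w a < r b - w b) :
    heckeV q a b (genHL q w r) =
      (if r a < r b then q else 1) • genHL q (w ∘ swap a b) (r ∘ swap a b) := by
  split_ifs with h
  · rw [genHL_step q w r hab h, heckeA_neg q a b (not_lt.2 hc.le), heckeV_heckeU q (ne_of_adj hab)]
  · rw [genHL_swap q hab w (lt_of_le_of_ne (not_lt.1 h) hr.symm), heckeA_pos q a b hc, one_smul]

theorem heckeU_genHL (q : K) {a b : Fin m} (hab : (a : ℕ) + 1 = b) (w : Fin m → ℤ) {r : Fin m → ℝ}
    (hr : r a ≠ r b) (hc : r b - w b < r a - w a) :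
    heckeU q a b (genHL q w r) =
      (if r a < r b then q else 1) • genHL q (w ∘ swap a b) (r ∘ swap a b) := by
  split_ifs with h
  · rw [genHL_step q w r hab h, heckeA_pos q a b hc, heckeU_heckeV q (ne_of_adj hab)]
  · rw [genHL_swap q hab w (lt_of_le_of_ne (not_lt.1 h) hr.symm),
      heckeA_neg q a b (not_lt.2 hc.le), one_smul]

/-- The effect of exchanging adjacent entries on the pairing. It comes from the adjointness of `V`,
applied to `E` and `U E*`, together with `V U = q`. -/
theorem pairing_swap (q : K) {a b : Fin m} (hab : (a : ℕ) + 1 = b) {c : Fin m → ℝ} (hc : Narrow c)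
    (hinj : Function.Injective c) (hlt : c a < c b) (w w' : Fin m → ℤ) :
    q * pairing q c w w' = (if (w a : ℝ) + c a < w b + c b then q else 1) *
      (if (w' b : ℝ) + c b < w' a + c a then q else 1) *
        pairing q (c ∘ swap a b) (w ∘ swap a b) (w' ∘ swap a b) := by
  have nab := ne_of_adj hab
  have h1 := heckeV_genHL q hab w (r := fun i => w i + c i)
    (add_ne_add_of_narrow hc hinj nab _ _) (by simpa using hlt)
  have h2 := heckeU_genHL q hab (-w') (r := fun i => -(w' i + c i))
    (fun h => add_ne_add_of_narrow hc hinj nab _ _ (neg_injective h)) (by simpa using hlt)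
  have h3 := ctDelta_heckeV_mul q hab (genHL q w (fun i => w i + c i))
    (heckeU q a b (genHL q (-w') (fun i => -(w' i + c i))))
  rw [heckeV_heckeU q nab, h1, h2, mul_smul_comm, map_smul, smul_mul_assoc, map_smul,
    mul_smul_comm, map_smul] at h3
  simp only [smul_eq_mul, neg_lt_neg_iff] at h3
  rw [pairing, pairing, ← h3, ← mul_assoc, mul_comm (ite _ _ _)]
  rfl

/-- Orthogonality at the weights `w` and `w'`. -/
def Ortho (q : K) (c : Fin m → ℝ) (w w' : Fin m → ℤ) : Prop :=
  pairing q c w w' = if w = w' then 1 else 0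

theorem swap_comp_eq_iff {α : Type*} (a b : Fin m) (w w' : Fin m → α) :
    w ∘ swap a b = w' ∘ swap a b ↔ w = w' :=
  ⟨fun h => by rw [← comp_swap_swap a b w, h, comp_swap_swap], fun h => by rw [h]⟩

/-- Orthogonality is invariant under exchanging adjacent entries of `c` and of both weights. -/
theorem Ortho.of_swap {q : K} (hq : q ≠ 0) {a b : Fin m} (hab : (a : ℕ) + 1 = b) {c : Fin m → ℝ}
    (hc : Narrow c) (hinj : Function.Injective c) {w w' : Fin m → ℤ}
    (h : Ortho q (c ∘ swap a b) (w ∘ swap a b) (w' ∘ swap a b)) : Ortho q c w w' := by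
  have nab := ne_of_adj hab
  unfold Ortho at h ⊢
  simp only [swap_comp_eq_iff] at h
  have hne := add_ne_add_of_narrow hc hinj nab (w a) (w b)
  rcases lt_or_gt_of_ne (hinj.ne nab) with hlt | hlt
  · have e := pairing_swap q hab hc hinj hlt w w'
    rw [h] at e
    by_cases hw : w = w'
    · subst hw
      rw [if_pos rfl, mul_one] at e
      rw [if_pos rfl]
      apply mul_left_cancel₀ hq
      rw [e, mul_one]
      rcases lt_or_gt_of_ne hne with h1 | h1
      · rw [if_pos h1, if_neg (not_lt.2 h1.le), mul_one]
      · rw [if_neg (not_lt.2 h1.le), if_pos h1, one_mul]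
    · rw [if_neg hw, mul_zero] at e
      rw [if_neg hw]
      exact (mul_eq_zero.1 e).resolve_left hq
  · have e := pairing_swap q hab (c := c ∘ swap a b) (fun i j => hc _ _)
      (hinj.comp (swap a b).injective) (by simpa using hlt) (w ∘ swap a b) (w' ∘ swap a b)
    rw [h] at e
    simp only [comp_swap_swap] at e
    rw [Function.comp, Function.comp, Function.comp, Function.comp, Function.comp, Function.comp,
      swap_apply_left, swap_apply_right] at e
    by_cases hw : w = w'
    · subst hw
      rw [if_pos rfl, mul_one] at e
      rw [if_pos rfl]
      apply mul_left_cancel₀ hq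
      rw [mul_one]
      refine Eq.trans ?_ e.symm
      rcases lt_or_gt_of_ne hne with h1 | h1
      · rw [if_neg (not_lt.2 h1.le), if_pos h1, one_mul]
      · rw [if_pos h1, if_neg (not_lt.2 h1.le), mul_one]
    · rw [if_neg hw, mul_zero] at e
      rw [if_neg hw]
      have hne' := add_ne_add_of_narrow hc hinj nab (w' a) (w' b)
      refine (mul_eq_zero.1 e.symm).resolve_left (mul_ne_zero ?_ ?_) <;> split_ifs <;> simp [hq]

/-- Orthogonality is invariant under shifting entries of `c` by integers, as long as they differ by
less than `1`: the two polynomials are multiplied by inverse monomials. -/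
theorem Ortho.of_rotate {q : K} {c : Fin m → ℝ} (hc : Narrow c) (β : Fin m → ℤ)
    (hc' : Narrow fun i => c i - β i) {w w' : Fin m → ℤ}
    (h : Ortho q (fun i => c i - β i) (w + β) (w' + β)) : Ortho q c w w' := by
  unfold Ortho pairing at h ⊢
  simp only [add_left_inj] at h
  rw [← h]
  have e1 := genHL_shift q w β (fun i => w i + c i) 0 (by simpa using hc)
    (by convert hc' using 2; ring)
  have e2 := genHL_shift q (-w') (-β) (fun i => -(w' i + c i)) 0
    (fun i j => by have := hc j i; simp only [Pi.neg_apply, Int.cast_neg]; linarith)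
    (fun i j => by have := hc' j i; simp only [Pi.neg_apply, Int.cast_neg] at this ⊢; linarith)
  have e3 : (fun i => ((w + β) i : ℝ) + (c i - β i)) = fun i => (w i + c i) + (0 : ℝ) := by
    funext i; simp
  have e4 : (fun i => -(((w' + β) i : ℝ) + (c i - β i))) = fun i => -(w' i + c i) + (0 : ℝ) := by
    funext i; simp
  rw [e3, e4, neg_add, e1, e2]
  congr 1
  have := xp_mul_neg (K := K) β
  linear_combination (-(genHL q w (fun i => (w i : ℝ) + c i)) *
    genHL q (-w') (fun i => -((w' i : ℝ) + c i))) * this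

/-- Entries of `c` can be shifted by integers so that a prescribed one becomes the smallest. -/
theorem exists_rotation {c : Fin m → ℝ} (hc : Narrow c) (hinj : Function.Injective c)
    (k : Fin m) : ∃ β : Fin m → ℤ, Narrow (fun i => c i - β i) ∧
      Function.Injective (fun i => c i - (β i : ℝ)) ∧ ∀ j, j ≠ k → c k - β k < c j - β j := by
  refine ⟨fun j => if c j < c k then -1 else 0, fun i j => ?_, fun i j h => ?_, fun j hj => ?_⟩
  · have h1 := hc i j
    have h2 := hc i k
    have h3 := hc k j
    simp only
    split_ifs <;> push_cast <;> linarith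
  · by_contra hij
    have := add_ne_add_of_narrow hc hinj hij (-(if c i < c k then -1 else 0))
      (-(if c j < c k then -1 else 0))
    apply this
    push_cast at h ⊢
    linarith
  · have h1 := hc k j
    have h2 := hinj.ne hj
    simp only [lt_self_iff_false, if_false]
    split_ifs with h3
    · push_cast; linarith
    · push_cast
      have := lt_of_le_of_ne (not_lt.1 h3) h2.symm
      linarith

/-- To prove orthogonality one may move a chosen position to the front. -/
theorem Ortho.of_front {q : K} (hq : q ≠ 0)
    (C : Fin (m + 1) → (Fin (m + 1) → ℝ) → (Fin (m + 1) → ℤ) → (Fin (m + 1) → ℤ) → Prop)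
    (hC : ∀ (s : Perm (Fin (m + 1))) k c w w', C (s k) c w w' → C k (c ∘ s) (w ∘ s) (w' ∘ s))
    (h0 : ∀ c w w', Narrow c → Function.Injective c → C 0 c w w' → Ortho q c w w')
    (k : Fin (m + 1)) {c : Fin (m + 1) → ℝ} (hc : Narrow c) (hinj : Function.Injective c)
    {w w' : Fin (m + 1) → ℤ} (h : C k c w w') : Ortho q c w w' := by
  induction k using Fin.induction generalizing c w w' with
  | zero => exact h0 c w w' hc hinj h
  | succ i ih =>
    refine Ortho.of_swap hq (a := i.castSucc) (b := i.succ) (by simp) hc hinj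
      (ih (fun _ _ => hc _ _) (hinj.comp (swap _ _).injective) (hC _ _ _ _ _ ?_))
    rwa [swap_apply_left]

/-- To prove orthogonality one may move a chosen position to the end. -/
theorem Ortho.of_back {q : K} (hq : q ≠ 0)
    (C : Fin (m + 1) → (Fin (m + 1) → ℝ) → (Fin (m + 1) → ℤ) → (Fin (m + 1) → ℤ) → Prop)
    (hC : ∀ (s : Perm (Fin (m + 1))) k c w w', C (s k) c w w' → C k (c ∘ s) (w ∘ s) (w' ∘ s))
    (h0 : ∀ c w w', Narrow c → Function.Injective c → C (Fin.last m) c w w' → Ortho q c w w')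
    (k : Fin (m + 1)) {c : Fin (m + 1) → ℝ} (hc : Narrow c) (hinj : Function.Injective c)
    {w w' : Fin (m + 1) → ℤ} (h : C k c w w') : Ortho q c w w' := by
  induction k using Fin.reverseInduction generalizing c w w' with
  | last => exact h0 c w w' hc hinj h
  | cast i ih =>
    refine Ortho.of_swap hq (a := i.castSucc) (b := i.succ) (by simp) hc hinj
      (ih (fun _ _ => hc _ _) (hinj.comp (swap _ _).injective) (hC _ _ _ _ _ ?_))
    rwa [swap_apply_right]

theorem weight_le_of_add_le {c : Fin m → ℝ} (hc : Narrow c) {i k : Fin m} {x y : ℤ}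
    (h : (x : ℝ) + c i ≤ y + c k) : x ≤ y := by
  have := hc k i
  have h' : (x : ℝ) < y + 1 := by linarith
  have : x < y + 1 := by exact_mod_cast h'
  omega

theorem weight_lt_of_add_lt {x y : ℤ} {s t : ℝ} (hst : t ≤ s) (h : (x : ℝ) + s < y + t) :
    x < y := by
  have h' : (x : ℝ) < y := by linarith
  exact_mod_cast h'

theorem xp_mul_mapX_succ_mem (N : ℤ) (f : Lau K (Fin m)) :
    xp (Pi.single 0 N) * mapX (extz Fin.succ) f ∈
      suppIn K {γ : Fin (m + 1) → ℤ | γ 0 = N} := by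
  refine mul_mem_suppIn (S := {(Pi.single 0 N : Fin (m + 1) → ℤ)}) (T := {γ | γ 0 = 0})
    (fun a ha b hb => ?_) (xp_mem_suppIn rfl)
    (mapX_mem_suppIn _ (S := Set.univ) (fun a _ => extz_succ_zero a) (by simp [mem_suppIn]))
  rw [Set.mem_singleton_iff] at ha
  have hb' : b 0 = 0 := hb
  simp [ha, hb']

/-- Orthogonality holds if the largest entry occurs in the first argument. -/
theorem ortho_of_first_lt {q : K} (hq : q ≠ 0) (k : Fin (m + 1)) {c : Fin (m + 1) → ℝ}
    (hc : Narrow c) (hinj : Function.Injective c) {w w' : Fin (m + 1) → ℤ}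
    (h1 : ∀ j, (w j : ℝ) + c j ≤ w k + c k) (h2 : ∀ j, (w' j : ℝ) + c j < w k + c k) :
    Ortho q c w w' := by
  refine Ortho.of_front hq (fun k c w w' => (∀ j, (w j : ℝ) + c j ≤ w k + c k) ∧
    ∀ j, (w' j : ℝ) + c j < w k + c k) (fun s k c w w' h => ⟨fun j => h.1 _, fun j => h.2 _⟩)
    ?_ k hc hinj ⟨h1, h2⟩
  clear h1 h2 hc hinj
  rintro c w w' hc hinj ⟨h1, h2⟩
  obtain ⟨β, hβ, hβi, hmin⟩ := exists_rotation hc hinj 0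
  refine Ortho.of_rotate hc β hβ ?_
  have g1 : ∀ j, (w + β) j ≤ (w + β) 0 := fun j => by
    refine weight_le_of_add_le hβ (i := j) (k := 0) ?_
    have := h1 j
    push_cast [Pi.add_apply]; linarith
  have g2 : ∀ j, (w' + β) j < (w + β) 0 := fun j => by
    refine weight_lt_of_add_lt (s := c j - β j) (t := c 0 - β 0) ?_ ?_
    · rcases eq_or_ne j 0 with rfl | hj
      · exact le_rfl
      · exact (hmin j hj).le
    · have := h2 j
      push_cast [Pi.add_apply]; linarith
  generalize w + β = v at g1 g2 ⊢
  generalize w' + β = v' at g2 ⊢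
  have hne : v ≠ v' := fun h => absurd (g2 0) (by rw [h]; exact lt_irrefl _)
  rw [Ortho, if_neg hne, pairing, genHL_succ q v _ g1 (by simpa using hβ)]
  refine ctDelta_eq_zero_of_first q ?_
  refine mul_mem_suppIn (S := {γ | γ 0 = v 0}) (T := {γ | ∀ i, -v 0 + 1 ≤ γ i}) (fun a ha b hb => ?_)
    ?_ (genHL_mem_ge q _ _ fun i => ?_)
  · have ha' : a 0 = v 0 := ha
    have hb' := hb 0
    show 0 < a 0 + b 0
    omega
  · exact xp_mul_mapX_succ_mem _ _
  · have := g2 i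
    simp only [Pi.neg_apply]
    omega

/-- Orthogonality holds if the largest entry occurs in the second argument. -/
theorem ortho_of_lt_second {q : K} (hq : q ≠ 0) (k : Fin (m + 1)) {c : Fin (m + 1) → ℝ}
    (hc : Narrow c) (hinj : Function.Injective c) {w w' : Fin (m + 1) → ℤ}
    (h1 : ∀ j, (w' j : ℝ) + c j ≤ w' k + c k) (h2 : ∀ j, (w j : ℝ) + c j < w' k + c k) :
    Ortho q c w w' := by
  refine Ortho.of_back hq (fun k c w w' => (∀ j, (w' j : ℝ) + c j ≤ w' k + c k) ∧
    ∀ j, (w j : ℝ) + c j < w' k + c k) (fun s k c w w' h => ⟨fun j => h.1 _, fun j => h.2 _⟩)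
    ?_ k hc hinj ⟨h1, h2⟩
  clear h1 h2 hc hinj
  rintro c w w' hc hinj ⟨h1, h2⟩
  obtain ⟨β, hβ, hβi, hmin⟩ := exists_rotation hc hinj (Fin.last m)
  refine Ortho.of_rotate hc β hβ ?_
  have g1 : ∀ j, (w' + β) j ≤ (w' + β) (Fin.last m) := fun j => by
    refine weight_le_of_add_le hβ (i := j) (k := Fin.last m) ?_
    have := h1 j
    push_cast [Pi.add_apply]; linarith
  have g2 : ∀ j, (w + β) j < (w' + β) (Fin.last m) := fun j => by
    refine weight_lt_of_add_lt (s := c j - β j) (t := c (Fin.last m) - β (Fin.last m)) ?_ ?_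
    · rcases eq_or_ne j (Fin.last m) with rfl | hj
      · exact le_rfl
      · exact (hmin j hj).le
    · have := h2 j
      push_cast [Pi.add_apply]; linarith
  generalize w + β = v at g2 ⊢
  generalize w' + β = v' at g1 g2 ⊢
  have hne : v ≠ v' := fun h => absurd (g2 (Fin.last m)) (by rw [h]; exact lt_irrefl _)
  rw [Ortho, if_neg hne, pairing, genHL_castSucc q (-v') _ (fun i => by simpa using g1 i)
    (fun i j => by have := hβ j i; simp only [Pi.neg_apply, Int.cast_neg]; linarith)]
  refine ctDelta_eq_zero_of_last q ?_
  refine mul_mem_suppIn (S := {γ | ∀ i, γ i ≤ v' (Fin.last m) - 1})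
    (T := {γ | γ (Fin.last m) = -v' (Fin.last m)}) (fun a ha b hb => ?_)
    (genHL_mem_le q _ _ fun i => ?_) ?_
  · have ha' := ha (Fin.last m)
    have hb' : b (Fin.last m) = -v' (Fin.last m) := hb
    show a (Fin.last m) + b (Fin.last m) < 0
    omega
  · have := g2 i
    omega
  · refine mul_mem_suppIn
      (S := {(Pi.single (Fin.last m) ((-v') (Fin.last m)) : Fin (m + 1) → ℤ)})
      (T := {γ | γ (Fin.last m) = 0}) (fun a ha b hb => ?_) (xp_mem_suppIn rfl)
      (mapX_mem_suppIn _ (S := Set.univ)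
        (fun a _ => extz_of_notMem _ _ _ fun i => Fin.castSucc_ne_last i) (by simp [mem_suppIn]))
    rw [Set.mem_singleton_iff] at ha
    have hb' : b (Fin.last m) = 0 := hb
    simp [ha, hb']

/-- If the largest entries agree, orthogonality reduces to one variable less. -/
theorem ortho_of_eq {q : K} (hq : q ≠ 0)
    (ih : ∀ (c : Fin m → ℝ) (w w' : Fin m → ℤ), Narrow c → Function.Injective c → Ortho q c w w')
    (k : Fin (m + 1)) {c : Fin (m + 1) → ℝ}
    (hc : Narrow c) (hinj : Function.Injective c) {w w' : Fin (m + 1) → ℤ}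
    (h1 : ∀ j, (w j : ℝ) + c j ≤ w k + c k) (h2 : ∀ j, (w' j : ℝ) + c j ≤ w' k + c k)
    (h3 : w k = w' k) : Ortho q c w w' := by
  refine Ortho.of_front hq (fun k c w w' => (∀ j, (w j : ℝ) + c j ≤ w k + c k) ∧
    (∀ j, (w' j : ℝ) + c j ≤ w' k + c k) ∧ w k = w' k)
    (fun s k c w w' h => ⟨fun j => h.1 _, fun j => h.2.1 _, h.2.2⟩) ?_ k hc hinj ⟨h1, h2, h3⟩
  clear h1 h2 h3 hc hinj
  rintro c w w' hc hinj ⟨h1, h2, h3⟩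
  obtain ⟨β, hβ, hβi, hmin⟩ := exists_rotation hc hinj 0
  refine Ortho.of_rotate hc β hβ ?_
  have aux : ∀ u : Fin (m + 1) → ℤ, (∀ j, (u j : ℝ) + c j ≤ u 0 + c 0) → ∀ j, j ≠ 0 →
      (u + β) j < (u + β) 0 := fun u hu j hj => by
    have h := hmin j hj
    have h' := hu j
    have : ((u + β) j : ℝ) < (u + β) 0 := by push_cast [Pi.add_apply]; linarith
    exact_mod_cast this
  have g1 := aux w h1
  have g2 := aux w' h2
  have g3 : (w + β) 0 = (w' + β) 0 := by simp [h3]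
  clear aux h1 h2 h3
  generalize w + β = v at g1 g3 ⊢
  generalize w' + β = v' at g2 g3 ⊢
  have hr : ∀ j, j ≠ 0 → -((v' 0 : ℝ) + (c 0 - β 0)) < -((v' j : ℝ) + (c j - β j)) := fun j hj => by
    have l1 := hβ j 0
    have l2 := g2 j hj
    have l3 : (v' j : ℝ) + 1 ≤ v' 0 := by exact_mod_cast l2
    linarith
  have hd : Narrow fun i => -((v' i : ℝ) + (c i - β i)) - ((-v') i : ℤ) := fun i j => by
    have := hβ j i
    simp only [Pi.neg_apply, Int.cast_neg]
    linarith
  have hbot := genHL_bottom q 0 (-v') (fun i => -((v' i : ℝ) + (c i - β i)))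
    (fun j hj => neg_lt_neg (g2 j hj)) hr hd
  have htail := ih (fun i => c i.succ - β i.succ) (v ∘ Fin.succ) (v' ∘ Fin.succ)
    (fun i j => hβ _ _) (hβi.comp (Fin.succ_injective m))
  rw [Ortho, pairing] at htail ⊢
  have g1' : ∀ j, v j ≤ v 0 := fun j => by
    rcases eq_or_ne j 0 with rfl | hj
    · exact le_rfl
    · exact (g1 j hj).le
  rw [genHL_succ q v _ g1' (by simpa using hβ)]
  rw [Fin.succAbove_zero] at hbot
  set g := genHL q (-v') (fun i => -((v' i : ℝ) + (c i - β i)))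
  set E' := genHL q (v ∘ Fin.succ) ((fun i => (v i : ℝ) + (c i - β i)) ∘ Fin.succ) with hE'
  set g' := genHL q ((-v') ∘ Fin.succ) ((fun i => -((v' i : ℝ) + (c i - β i))) ∘ Fin.succ) with hg'
  have e1 : xp (Pi.single 0 (v 0)) * mapX (extz Fin.succ) E' * g =
      inclSucc K m (E' * g') + xp (Pi.single 0 (v 0)) * mapX (extz Fin.succ) E' *
        (g - xp (Pi.single 0 ((-v') 0)) * mapX (extz Fin.succ) g') := by
    have e2 : (xp (Pi.single 0 (v 0)) : Lau K (Fin (m + 1))) * xp (Pi.single 0 ((-v') 0)) = 1 := by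
      rw [← xp_add, ← Pi.single_add, Pi.neg_apply, g3, add_neg_cancel, Pi.single_zero, xp_zero]
    rw [inclSucc, map_mul]
    linear_combination (mapX (extz Fin.succ) E' * mapX (extz Fin.succ) g') * e2
  rw [e1, map_add, ctDelta_inclSucc]
  rw [ctDelta_eq_zero_of_first q, add_zero]
  · refine htail.trans (if_congr ?_ rfl rfl)
    refine ⟨fun h => ?_, fun h => by rw [h]⟩
    funext j
    refine Fin.cases g3 (fun i => congrFun h i) j
  · refine mul_mem_suppIn (S := {γ | γ 0 = v 0}) (fun a ha b hb => ?_) ?_ hbot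
    · have ha' : a 0 = v 0 := ha
      have hb' := hb.1 0 le_rfl
      rw [Pi.neg_apply] at hb'
      show 0 < a 0 + b 0
      omega
    · exact xp_mul_mapX_succ_mem _ _

theorem ctDelta_one_zero (q : K) : ctDelta q (1 : Lau K (Fin 0)) = 1 := by
  have h : delta K 0 = 1 := by simp [delta]
  rw [ctDelta, h, ctWith_eq_sum q inCone_one (N := 1)]
  · simp [ct_one]
  · intro k hk
    rw [PowerSeries.coeff_one, if_neg (by omega), mul_zero, map_zero]

/-- The non-symmetric Hall–Littlewood polynomials attached to `w + c` and to `-(w + c)`, for `c`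
fixed and `w` varying, are dual bases. -/
theorem ortho {q : K} (hq : q ≠ 0) (c : Fin m → ℝ) (w w' : Fin m → ℤ) (hc : Narrow c)
    (hinj : Function.Injective c) : Ortho q c w w' := by
  induction m with
  | zero =>
    have h : w = w' := Subsingleton.elim _ _
    have h0 : ∀ (u : Fin 0 → ℤ) (r : Fin 0 → ℝ), genHL q u r = 1 := fun u r => by
      rw [genHL_of_antitone q u (fun i => i.elim0), ← xp_zero]
      congr 1
      exact Subsingleton.elim _ _
    rw [Ortho, pairing, h0, h0, mul_one, ctDelta_one_zero, if_pos h]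
  | succ m ih =>
    obtain ⟨k, hk⟩ := Finite.exists_max fun j => (w j : ℝ) + c j
    obtain ⟨k', hk'⟩ := Finite.exists_max fun j => (w' j : ℝ) + c j
    rcases lt_trichotomy ((w k : ℝ) + c k) (w' k' + c k') with h | h | h
    · exact ortho_of_lt_second hq k' hc hinj hk' fun j => (hk j).trans_lt h
    · have e : k = k' := by
        by_contra hne
        exact add_ne_add_of_narrow hc hinj hne _ _ h
      subst e
      exact ortho_of_eq hq (fun c w w' h h' => ih c w w' h h') k hc hinj hk hk'
        (by exact_mod_cast add_right_cancel h)
    · exact ortho_of_first_lt hq k hc hinj hk fun j => (hk' j).trans_lt h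

end Duality

/-! ### Expansions in the basis of non-symmetric Hall–Littlewood polynomials -/

section Expansion

/-- As many vectors as the dimension, with a dual family of functionals, form a basis. -/
theorem eq_sum_of_dual {K M ι : Type*} [Field K] [AddCommGroup M] [Module K M] [DecidableEq ι]
    (S : Finset ι) (x E : ι → M) (φ : ι → M →ₗ[K] K)
    (hE : ∀ a ∈ S, E a ∈ Submodule.span K (x '' S))
    (hφ : ∀ a ∈ S, ∀ b ∈ S, φ b (E a) = if a = b then 1 else 0) {f : M}
    (hf : f ∈ Submodule.span K (x '' S)) : f = ∑ a ∈ S, φ a f • E a := by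
  classical
  have hfin : (x '' (S : Set ι)).Finite := S.finite_toSet.image x
  haveI := FiniteDimensional.span_of_finite K hfin
  have hli : LinearIndependent K fun a : S => E a := by
    rw [Fintype.linearIndependent_iff]
    intro g hg i
    have h := congrArg (φ i) hg
    rw [map_sum, map_zero] at h
    rw [Finset.sum_eq_single i] at h
    · simpa [hφ i i.2 i i.2] using h
    · intro b _ hb
      rw [map_smul, hφ b b.2 i i.2, if_neg (fun e => hb (Subtype.ext e)), smul_zero]
    · simp
  have hle : Submodule.span K (Set.range fun a : S => E a) ≤ Submodule.span K (x '' S) := by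
    rw [Submodule.span_le]
    rintro _ ⟨a, rfl⟩
    exact hE a a.2
  have heq : Submodule.span K (Set.range fun a : S => E a) = Submodule.span K (x '' S) := by
    refine Submodule.eq_of_le_of_finrank_le hle ?_
    rw [finrank_span_eq_card hli, ← coe_image]
    exact (finrank_span_finset_le_card _).trans (by simpa using card_image_le)
  rw [← heq] at hf
  obtain ⟨c, hc⟩ := (Submodule.mem_span_range_iff_exists_fun K).1 hf
  rw [← sum_coe_sort S fun a => φ a f • E a]
  conv_lhs => rw [← hc]
  refine sum_congr rfl fun i _ => ?_
  congr 1
  rw [← hc, map_sum, Finset.sum_eq_single i]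
  · simp [hφ i i.2 i i.2]
  · intro b _ hb
    rw [map_smul, hφ b b.2 i i.2, if_neg (fun e => hb (Subtype.ext e)), smul_zero]
  · simp

variable {K : Type} [Field K] {m : ℕ}

theorem box_finite (m : ℕ) (N M d : ℤ) : (box m N M d).Finite := by
  refine (Set.finite_Icc (fun _ : Fin m => N) fun _ => M).subset fun γ hγ => ?_
  exact ⟨fun i => (hγ.1 i).1, fun i => (hγ.1 i).2⟩

/-- The exponents in a box of a given degree. -/
def boxFin (m : ℕ) (N M d : ℤ) : Finset (Fin m → ℤ) := (box_finite m N M d).toFinset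

theorem mem_boxFin {N M d : ℤ} {γ : Fin m → ℤ} : γ ∈ boxFin m N M d ↔ γ ∈ box m N M d :=
  Set.Finite.mem_toFinset _

theorem coe_boxFin (N M d : ℤ) : (boxFin m N M d : Set (Fin m → ℤ)) = box m N M d :=
  Set.Finite.coe_toFinset _

theorem suppIn_le_span {ι κ : Type} (S : Set κ) (x : κ → ι → ℤ) :
    suppIn K (x '' S) ≤ Submodule.span K ((fun a => (xp (x a) : Lau K ι)) '' S) := by
  intro f hf
  refine map_mem_of_suppIn LinearMap.id (fun γ hγ => ?_) hf
  obtain ⟨a, ha, rfl⟩ := hγ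
  exact Submodule.subset_span ⟨a, ha, rfl⟩

theorem genHL_expand {q : K} (hq : q ≠ 0) {c : Fin m → ℝ} (hc : Narrow c)
    (hinj : Function.Injective c) {N M d : ℤ} {f : Lau K (Fin m)}
    (hf : f ∈ suppIn K (box m N M d)) :
    f = ∑ a ∈ boxFin m N M d, ctDelta q (f * genHL q (-a) (fun i => -(a i + c i))) •
      genHL q a (fun i => a i + c i) := by
  have hle := suppIn_le_span (K := K) (boxFin m N M d : Set (Fin m → ℤ)) id
  rw [Set.image_id, coe_boxFin] at hle
  refine eq_sum_of_dual (boxFin m N M d) xp (fun a => genHL q a (fun i => a i + c i))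
    (fun a => ctDelta q ∘ₗ LinearMap.mulRight K (genHL q (-a) (fun i => -(a i + c i))))
    (fun a ha => ?_) (fun a _ b _ => ?_) ?_
  · rw [coe_boxFin]
    exact hle (genHL_mem_box q _ _ (mem_boxFin.1 ha))
  · exact ortho hq c a b hc hinj
  · rw [coe_boxFin]
    exact hle hf

theorem genHL_dual_expand {q : K} (hq : q ≠ 0) {c : Fin m → ℝ} (hc : Narrow c)
    (hinj : Function.Injective c) {N M d : ℤ} {f : Lau K (Fin m)}
    (hf : f ∈ suppIn K (Neg.neg '' box m N M d)) :
    f = ∑ a ∈ boxFin m N M d, ctDelta q (genHL q a (fun i => a i + c i) * f) •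
      genHL q (-a) (fun i => -(a i + c i)) := by
  have hle := suppIn_le_span (K := K) (boxFin m N M d : Set (Fin m → ℤ)) Neg.neg
  rw [coe_boxFin] at hle
  refine eq_sum_of_dual (boxFin m N M d) (fun a => xp (-a))
    (fun a => genHL q (-a) (fun i => -(a i + c i)))
    (fun a => ctDelta q ∘ₗ LinearMap.mulLeft K (genHL q a (fun i => a i + c i)))
    (fun a ha => ?_) (fun a _ b _ => ?_) ?_
  · rw [coe_boxFin]
    have ha := mem_boxFin.1 ha
    refine hle (suppIn_mono ?_ (genHL_mem_box q (N := -M) (M := -N) (d := -d) _ _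
      ⟨fun i => ?_, ?_⟩))
    · refine fun γ hγ => ⟨-γ, ⟨fun i => ?_, ?_⟩, neg_neg γ⟩
      · have := hγ.1 i
        simp only [Pi.neg_apply]
        omega
      · simp only [Pi.neg_apply, sum_neg_distrib, hγ.2, neg_neg]
    · have := ha.1 i
      simp only [Pi.neg_apply]
      omega
    · simp only [Pi.neg_apply, sum_neg_distrib, ha.2]
  · exact (ortho hq c b a hc hinj).trans (if_congr eq_comm rfl rfl)
  · rw [coe_boxFin]
    exact hle hf

/-- The non-symmetric Hall–Littlewood polynomials for a given `c` span the Laurent polynomials. -/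
theorem genHL_span {q : K} (hq : q ≠ 0) {c : Fin m → ℝ} (hc : Narrow c)
    (hinj : Function.Injective c) (f : Lau K (Fin m)) :
    f ∈ Submodule.span K (Set.range fun a : Fin m → ℤ => genHL q a (fun i => a i + c i)) := by
  induction f using lau_induction with
  | hx γ =>
    have hγ : (xp γ : Lau K (Fin m)) ∈ suppIn K (box m (-∑ i, |γ i|) (∑ i, |γ i|) (∑ i, γ i)) := by
      refine xp_mem_suppIn ⟨fun i => ?_, rfl⟩
      have h2 := single_le_sum (f := fun i => |γ i|) (fun i _ => abs_nonneg _) (mem_univ i)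
      exact abs_le.1 h2
    rw [genHL_expand hq hc hinj hγ]
    exact Submodule.sum_mem _ fun a _ => Submodule.smul_mem _ _ (Submodule.subset_span ⟨a, rfl⟩)
  | hadd f g hf hg => exact Submodule.add_mem _ hf hg
  | hsmul c f hf => exact Submodule.smul_mem _ _ hf

/-- The coefficients of the expansion in the basis of non-symmetric Hall–Littlewood polynomials
are computed by pairing with the dual basis. -/
theorem expansion_genHL {n : ℕ} {q : K} (hq : q ≠ 0) {c : Fin (n + 1) → ℝ} (hc : Narrow c)
    (hinj : Function.Injective c) (f : Laurent K n) (β : Weight n) :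
    expansion (K := K) (fun γ : Weight n =>
      algebraMap (Laurent K n) (RatFn K n) (genHL q γ (fun i => γ i + c i)))
      (algebraMap (Laurent K n) (RatFn K n) f) β =
      ctDelta q (f * genHL q (-β) (fun i => -(β i + c i))) := by
  set E : Weight n → Laurent K n := fun γ => genHL q γ (fun i => γ i + c i)
  let ι : Laurent K n →ₗ[K] RatFn K n := (IsScalarTower.toAlgHom K (Laurent K n) (RatFn K n)).toLinearMap
  have hι : Function.Injective ι := IsFractionRing.injective (Laurent K n) (RatFn K n)
  have hlc : ∀ c' : Weight n →₀ K, Finsupp.linearCombination K (fun γ => ι (E γ)) c' =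
      ι (Finsupp.linearCombination K E c') := fun c' => by
    rw [Finsupp.apply_linearCombination]
    rfl
  have hex : ∃ c' : Weight n →₀ K, Finsupp.linearCombination K (fun γ => ι (E γ)) c' = ι f := by
    obtain ⟨c', hc'⟩ := (Finsupp.mem_span_range_iff_exists_finsupp).1 (genHL_span hq hc hinj f)
    refine ⟨c', ?_⟩
    rw [hlc, Finsupp.linearCombination_apply, hc']
  have h := Classical.epsilon_spec hex
  rw [hlc] at h
  have h' := hι h
  change expansion (fun γ => ι (E γ)) (ι f) β = _
  set e : Weight n →₀ K := expansion (fun γ => ι (E γ)) (ι f) with he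
  have h2 : Finsupp.linearCombination K E e = f := h'
  rw [← h2, Finsupp.linearCombination_apply, Finsupp.sum, sum_mul, map_sum]
  have h3 : ∀ γ, ctDelta q (e γ • E γ * genHL q (-β) (fun i => -(β i + c i))) =
      if γ = β then e γ else 0 := fun γ => by
    have := ortho hq c γ β hc hinj
    rw [Ortho, pairing] at this
    rw [smul_mul_assoc, map_smul, this, smul_eq_mul, mul_ite, mul_one, mul_zero]
  simp only [h3]
  rw [Finset.sum_ite_eq']
  split_ifs with h4
  · rfl
  · exact Finsupp.notMem_support_iff.1 h4

end Expansion

/-! ### Reduced words -/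

section Words

variable {n : ℕ}

theorem ascCount_le_swap_add_one {m : ℕ} {a b : Fin m} (hab : (a : ℕ) + 1 = b) (r : Fin m → ℝ) :
    ascCount r ≤ ascCount (r ∘ swap a b) + 1 := by
  classical
  unfold ascCount
  rw [← tsub_le_iff_right]
  refine le_trans ?_ (Finset.card_le_card_of_injOn
    (s := ({p : Fin m × Fin m | p.1 < p.2 ∧ r p.1 < r p.2} : Finset _).erase (a, b))
    (Prod.map (swap a b) (swap a b)) ?_
    ((swap a b).injective.prodMap (swap a b).injective).injOn)
  · exact Finset.pred_card_le_card_erase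
  · rintro ⟨i, j⟩ hp
    simp only [coe_erase, coe_filter, mem_univ, true_and, Set.mem_sdiff, Set.mem_ofPred_eq,
      Set.mem_singleton_iff, Prod.mk.injEq] at hp
    simp only [coe_filter, mem_univ, true_and, Set.mem_ofPred_eq, Function.comp, Prod.map_apply,
      swap_apply_self]
    exact ⟨swap_adj_lt hab hp.1.1 hp.2, hp.1.2⟩

/-- The number of inversions of `w⁻¹`. -/
def invCount (w : Perm (Fin (n + 1))) : ℕ := ascCount fun j => -((w⁻¹ j : ℕ) : ℝ)

theorem simple_adj (i : Fin n) : ((i.castSucc : Fin (n + 1)) : ℕ) + 1 = i.succ := by simp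

theorem simple_mul_simple_mul (i : Fin n) (w : Perm (Fin (n + 1))) :
    simple i * (simple i * w) = w := by
  rw [← mul_assoc, simple, swap_mul_self, one_mul]

theorem invCount_simple_mul (i : Fin n) (w : Perm (Fin (n + 1))) :
    invCount (simple i * w) = ascCount ((fun j => -((w⁻¹ j : ℕ) : ℝ)) ∘ swap i.castSucc i.succ) := by
  rw [invCount, mul_inv_rev, simple, swap_inv]
  rfl

theorem invCount_simple_mul_le (i : Fin n) (w : Perm (Fin (n + 1))) :
    invCount (simple i * w) ≤ invCount w + 1 := by
  have h := ascCount_le_swap_add_one (simple_adj i)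
    ((fun j => -((w⁻¹ j : ℕ) : ℝ)) ∘ swap i.castSucc i.succ)
  rwa [comp_swap_swap, ← invCount_simple_mul] at h

theorem invCount_simple_mul_lt {i : Fin n} {w : Perm (Fin (n + 1))}
    (h : w⁻¹ i.succ < w⁻¹ i.castSucc) : invCount (simple i * w) < invCount w := by
  rw [invCount_simple_mul]
  refine ascCount_swap_lt (simple_adj i) ?_
  rw [Fin.lt_def] at h
  simpa using h

theorem invCount_le_length (L : List (Fin n)) : invCount (L.map simple).prod ≤ L.length := by
  induction L with
  | nil =>
    classical
    simp only [List.map_nil, List.prod_nil, List.length_nil, invCount, ascCount, Nat.le_zero,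
      inv_one, Perm.one_apply, neg_lt_neg_iff, Nat.cast_lt, card_eq_zero]
    refine filter_eq_empty_iff.2 fun p _ h => ?_
    exact absurd h.1 (not_lt.2 (Fin.le_def.2 (le_of_lt h.2)))
  | cons i L ih =>
    rw [List.map_cons, List.prod_cons, List.length_cons]
    exact (invCount_simple_mul_le i _).trans (by omega)

theorem exists_word_length_le (w : Perm (Fin (n + 1))) :
    ∃ L : List (Fin n), (L.map simple).prod = w ∧ L.length ≤ invCount w := by
  induction hk : invCount w using Nat.strong_induction_on generalizing w with
  | _ k ih =>
    by_cases h : ∃ i : Fin n, w⁻¹ i.succ < w⁻¹ i.castSucc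
    · obtain ⟨i, hi⟩ := h
      have hlt := invCount_simple_mul_lt hi
      obtain ⟨L, hL, hlen⟩ := ih _ (hk ▸ hlt) (simple i * w) rfl
      refine ⟨i :: L, ?_, ?_⟩
      · rw [List.map_cons, List.prod_cons, hL, simple_mul_simple_mul]
      · rw [List.length_cons]
        omega
    · push Not at h
      have hm : StrictMono (w⁻¹ : Perm (Fin (n + 1))) := by
        refine Fin.strictMono_iff_lt_succ.2 fun i => lt_of_le_of_ne (h i) fun e => ?_
        exact absurd ((w⁻¹).injective e) (Fin.castSucc_lt_succ (i := i)).ne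
      have h1 : w⁻¹ = 1 := by
        ext i
        have := congrFun (Subsingleton.elim (StrictMono.orderIsoOfSurjective _ hm
          (w⁻¹).surjective) (OrderIso.refl _) ▸ rfl : (fun i => StrictMono.orderIsoOfSurjective _ hm
          (w⁻¹).surjective i) = fun i => i) i
        exact congrArg Fin.val this
      refine ⟨[], ?_, by simp⟩
      rw [inv_eq_one] at h1
      simp [h1]

/-- The words in the simple transpositions which can be built from right to left by adding one
inversion at a time. -/
def Good : List (Fin n) → Prop
  | [] => True
  | i :: L => Good L ∧ ((L.map simple).prod)⁻¹ i.castSucc < ((L.map simple).prod)⁻¹ i.succ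

theorem good_of_isReducedWord {w : Perm (Fin (n + 1))} {L : List (Fin n)}
    (h : IsReducedWord w L) : Good L := by
  induction L generalizing w with
  | nil => trivial
  | cons i L ih =>
    obtain ⟨h1, h2⟩ := h
    obtain ⟨L₀, hL₀, hlen₀⟩ := exists_word_length_le w
    have h3 := h2 L₀ hL₀
    rw [List.length_cons] at h3
    rw [List.map_cons, List.prod_cons] at h1
    set w' := (L.map simple).prod with hw'
    have h4 : simple i * w = w' := by rw [← h1, simple_mul_simple_mul]
    have h5 := invCount_simple_mul_le i w'
    have h6 := invCount_le_length L
    rw [h1] at h5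
    rw [← hw'] at h6
    refine ⟨ih (w := w') ⟨rfl, fun L' hL' => ?_⟩, ?_⟩
    · have := h2 (i :: L') (by rw [List.map_cons, List.prod_cons, hL', h1])
      simpa using this
    · rw [← hw']
      by_contra hn
      have hne : w'⁻¹ i.succ ≠ w'⁻¹ i.castSucc := fun e =>
        absurd ((w'⁻¹).injective e) (Fin.castSucc_lt_succ (i := i)).ne'
      have h7 := invCount_simple_mul_lt (lt_of_le_of_ne (not_lt.1 hn) hne)
      rw [h1] at h7
      omega

end Words

/-! ### Identification of the twisted non-symmetric Hall–Littlewood polynomials -/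

section Link

variable {K : Type} [Field K] {n : ℕ}

/-- Laurent polynomials as rational functions. -/
abbrev toRat (K : Type) [Field K] (n : ℕ) : Lau K (Fin (n + 1)) →ₐ[K] RatFn K n :=
  IsScalarTower.toAlgHom K (Laurent K n) (RatFn K n)

theorem toRat_injective : Function.Injective (toRat K n) :=
  IsFractionRing.injective (Laurent K n) (RatFn K n)

theorem mono_eq (γ : Weight n) : (mono γ : RatFn K n) = toRat K n (xp γ) := rfl

theorem var_eq (i : Fin (n + 1)) : (var i : RatFn K n) = toRat K n (xp (Pi.single i 1)) := rfl

theorem permWeight_apply (w : Perm (Fin (n + 1))) (γ : Weight n) :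
    permWeight w γ = γ ∘ ⇑w⁻¹ := rfl

theorem permRatFn_toRat (w : Perm (Fin (n + 1))) (f : Lau K (Fin (n + 1))) :
    permRatFn w (toRat K n f) = toRat K n (mapX (reidx (w⁻¹ : Perm _)) f) := by
  induction f using lau_induction with
  | hx γ =>
    simp only [mapX_xp]
    show permRatFn w (algebraMap (Laurent K n) (RatFn K n) (xp γ)) = _
    rw [permRatFn, IsFractionRing.algEquivOfAlgEquiv_algebraMap]
    show algebraMap (Laurent K n) (RatFn K n) _ = algebraMap (Laurent K n) (RatFn K n) _
    congr 1
    simp only [xp, AddMonoidAlgebra.domCongr_single]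
    rfl
  | hadd f g hf hg => simp only [map_add, hf, hg]
  | hsmul c f hf => simp only [map_smul, hf]

theorem var_div_var (a b : Fin (n + 1)) :
    (var a / var b : RatFn K n) = toRat K n (xp (root a b)) := by
  have hb : (var b : RatFn K n) ≠ 0 := by
    rw [var_eq, Ne, map_eq_zero_iff _ toRat_injective]
    exact xp_ne_zero _
  rw [div_eq_iff hb, var_eq, var_eq, ← map_mul, ← xp_add]
  congr 2
  simp [root]

theorem one_sub_var_ne_zero {a b : Fin (n + 1)} (h : a ≠ b) :
    (1 - var a / var b : RatFn K n) ≠ 0 := by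
  rw [var_div_var, ← map_one (toRat K n), ← map_sub, Ne, map_eq_zero_iff _ toRat_injective]
  exact one_sub_xp_ne_zero (root_ne_zero h)

theorem castSucc_ne_succ (i : Fin n) : i.castSucc ≠ i.succ := (Fin.castSucc_lt_succ (i := i)).ne

theorem heckeGen_apply (q : K) (i : Fin n) (f : RatFn K n) :
    heckeGen q i f = q • permRatFn (simple i) f +
      (1 - q) • (1 / (1 - var i.succ / var i.castSucc) * (permRatFn (simple i) f - f)) := rfl

theorem heckeGen_toRat {q : K} (hq : q ≠ 0) (i : Fin n) (f : Lau K (Fin (n + 1))) :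
    heckeGen q⁻¹ i (toRat K n f) = q⁻¹ • toRat K n (heckeU q i.castSucc i.succ f) := by
  have hs : permRatFn (simple i) (toRat K n f) = toRat K n (sw i.castSucc i.succ f) := by
    rw [permRatFn_toRat, simple, swap_inv]
    rfl
  have hd : 1 / (1 - var i.succ / var i.castSucc) * (toRat K n (sw i.castSucc i.succ f) -
      toRat K n f) = toRat K n (divDiff i.castSucc i.succ f) := by
    rw [one_div, inv_mul_eq_iff_eq_mul₀ (one_sub_var_ne_zero (castSucc_ne_succ i).symm), ← map_sub,
      ← mul_divDiff, map_mul, map_sub, map_one, var_div_var]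
  rw [heckeGen_apply, hs, hd, heckeU_apply, map_add, map_smul, smul_add, smul_smul]
  congr 2
  rw [mul_sub, inv_mul_cancel₀ hq, mul_one]

theorem permRatFn_simple_simple (i : Fin n) (f : RatFn K n) :
    permRatFn (simple i) (permRatFn (simple i) f) = f := by
  obtain ⟨a, b, -, rfl⟩ := IsFractionRing.div_surjective (A := Laurent K n) f
  have key : ∀ g : Laurent K n, permRatFn (simple i) (permRatFn (simple i)
      (algebraMap (Laurent K n) (RatFn K n) g)) = algebraMap (Laurent K n) (RatFn K n) g := by
    intro g
    have := permRatFn_toRat (simple i) g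
    change permRatFn (simple i) (algebraMap (Laurent K n) (RatFn K n) g) = _ at this
    rw [this, permRatFn_toRat, mapX_comp]
    show toRat K n _ = toRat K n g
    congr 1
    convert mapX_id g
    refine AddMonoidHom.ext fun γ => funext fun j => ?_
    simp [simple]
  rw [map_div₀, map_div₀, key, key]

/-- The quadratic relation `T (T - (q - 1)) = q`. -/
theorem heckeGen_quadratic (q : K) (i : Fin n) (f : RatFn K n) :
    heckeGen q i (heckeGen q i f) = (q - 1) • heckeGen q i f + q • f := by
  have hy : (1 - var i.succ / var i.castSucc : RatFn K n) ≠ 0 :=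
    one_sub_var_ne_zero (castSucc_ne_succ i).symm
  have hs : permRatFn (simple i) (1 / (1 - var i.succ / var i.castSucc) : RatFn K n) =
      1 - 1 / (1 - var i.succ / var i.castSucc) := by
    have h1 : permRatFn (simple i) (var i.succ / var i.castSucc : RatFn K n) =
        toRat K n (xp (root i.castSucc i.succ)) := by
      rw [var_div_var, permRatFn_toRat, simple, swap_inv]
      exact congrArg _ (sw_xp_root _ _)
    have h2 : (var i.succ / var i.castSucc : RatFn K n) *
        toRat K n (xp (root i.castSucc i.succ)) = 1 := by
      rw [var_div_var, ← map_mul, mul_comm, xp_root_mul, map_one]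
    have h3 : (1 - toRat K n (xp (root i.castSucc i.succ)) : RatFn K n) ≠ 0 := by
      rw [← map_one (toRat K n), ← map_sub, Ne, map_eq_zero_iff _ toRat_injective]
      exact one_sub_xp_ne_zero (root_ne_zero (castSucc_ne_succ i))
    rw [map_div₀, map_sub, map_one, h1]
    field_simp
    linear_combination -h2
  have hsf := permRatFn_simple_simple i f
  simp only [heckeGen_apply, map_add, map_sub, map_smul, map_mul, hs, hsf]
  simp only [Algebra.smul_def, map_sub, map_one]
  ring

theorem isUnit_heckeGen {q : K} (hq : q ≠ 0) (i : Fin n) : IsUnit (heckeGen q i) := by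
  have h : heckeGen q i * heckeGen q i = (q - 1) • heckeGen q i + q • 1 :=
    LinearMap.ext fun f => heckeGen_quadratic q i f
  have h1 : heckeGen q i * (q⁻¹ • (heckeGen q i - (q - 1) • 1)) = 1 := by
    rw [mul_smul_comm, mul_sub, h, mul_smul_comm, mul_one, add_sub_cancel_left, smul_smul,
      inv_mul_cancel₀ hq, one_smul]
  have h2 : (q⁻¹ • (heckeGen q i - (q - 1) • 1)) * heckeGen q i = 1 := by
    rw [smul_mul_assoc, sub_mul, h, smul_mul_assoc, one_mul, add_sub_cancel_left, smul_smul,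
      inv_mul_cancel₀ hq, one_smul]
  exact ⟨⟨_, _, h1, h2⟩, rfl⟩

theorem isUnit_heckeT {q : K} (hq : q ≠ 0) (w : Perm (Fin (n + 1))) : IsUnit (heckeT q w) := by
  rw [heckeT]
  refine List.prod_isUnit fun x hx => ?_
  obtain ⟨i, -, rfl⟩ := List.mem_map.1 hx
  exact isUnit_heckeGen hq i

theorem add_lt_add_iff_of_narrow {c d : ℝ} (h1 : c - d < 1) (h2 : d - c < 1) (x y : ℤ) :
    (x : ℝ) + c < y + d ↔ x < y ∨ x = y ∧ c < d := by
  constructor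
  · intro h
    have h3 : (x : ℝ) < y + 1 := by linarith
    have h4 : x < y + 1 := by exact_mod_cast h3
    rcases lt_or_eq_of_le (Int.lt_add_one_iff.1 h4) with h5 | h5
    · exact Or.inl h5
    · subst h5
      exact Or.inr ⟨rfl, by linarith⟩
  · rintro (h | ⟨rfl, h⟩)
    · have : (x : ℝ) + 1 ≤ y := by exact_mod_cast h
      linarith
    · linarith

/-- The untwisted case: the word of a sorting permutation builds `genHL`. -/
theorem word_genHL {q : K} (hq : q ≠ 0) {c : Fin (n + 1) → ℝ} (hc : Narrow c) (hmono : StrictMono c)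
    {μ : Weight n} (hμ : Antitone μ) (L : List (Fin n)) (hL : Good L)
    (hst : ∀ a b, a < b → μ a = μ b → (L.map simple).prod a < (L.map simple).prod b) :
    ((L.map (heckeGen q⁻¹)).prod) (mono μ) = (q⁻¹) ^ L.length •
      toRat K n (genHL q (μ ∘ ⇑((L.map simple).prod)⁻¹)
        (fun i => ((μ ∘ ⇑((L.map simple).prod)⁻¹) i : ℝ) + c i)) := by
  induction L with
  | nil =>
    simp only [List.map_nil, List.prod_nil, List.length_nil, pow_zero, one_smul]
    have e : μ ∘ ⇑(1 : Perm (Fin (n + 1)))⁻¹ = μ := by funext i; simp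
    rw [e, genHL_of_weight_antitone q μ _ hμ (by simpa using hc)]
    rfl
  | cons i L ih =>
    rw [List.map_cons, List.prod_cons] at hst
    obtain ⟨hL', hlt⟩ := hL
    rw [List.map_cons, List.map_cons, List.prod_cons, List.prod_cons, List.length_cons]
    set v := (L.map simple).prod with hv
    set a := i.castSucc with ha
    set b := i.succ with hb
    have hab : (a : ℕ) + 1 = b := simple_adj i
    have nab := ne_of_adj hab
    have hst' : ∀ a' b', a' < b' → μ a' = μ b' → v a' < v b' := by
      intro a' b' h1 h2
      have h3 := hst a' b' h1 h2
      by_contra hn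
      have hne : v b' ≠ v a' := fun e => h1.ne' (v.injective e)
      have hn' := lt_of_le_of_ne (not_lt.1 hn) hne
      have h4 : v b' = a ∧ v a' = b := by
        by_contra h5
        exact absurd h3 (not_lt.2 (swap_adj_lt hab hn' h5).le)
      rw [← h4.1, ← h4.2] at hlt
      simp only [Perm.inv_def, symm_apply_apply] at hlt
      exact absurd h1 (not_lt.2 hlt.le)
    rw [Module.End.mul_apply, ih hL' hst', map_smul, heckeGen_toRat hq, smul_smul, ← pow_succ]
    congr 2
    set lam := μ ∘ ⇑v⁻¹ with hlam
    have e1 : μ ∘ ⇑(simple i * v)⁻¹ = lam ∘ swap a b := by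
      rw [mul_inv_rev, simple, swap_inv]
      rfl
    have hgt : lam b < lam a := by
      refine lt_of_le_of_ne (hμ hlt.le) fun e => ?_
      have := hst _ _ hlt e.symm
      simp only [Perm.mul_apply, Perm.inv_def, apply_symm_apply] at this
      rw [simple, swap_apply_left, swap_apply_right, Fin.lt_def] at this
      omega
    rw [e1]
    have hr : (fun j => ((lam ∘ swap a b) j : ℝ) + c j) a < (fun j => ((lam ∘ swap a b) j : ℝ) + c j) b := by
      simp only [Function.comp, swap_apply_left, swap_apply_right]
      rw [add_lt_add_iff_of_narrow (hc _ _) (hc _ _)]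
      exact Or.inl hgt
    have hcab : c a < c b := hmono (by rw [Fin.lt_def]; omega)
    rw [genHL_step q (lam ∘ swap a b) (fun j => ((lam ∘ swap a b) j : ℝ) + c j) hab hr,
      comp_swap_swap, heckeA_neg q a b (by
      simp only [add_sub_cancel_left, not_lt]; exact hcab.le)]
    congr 1
    have hcs : ∀ j k, ¬(j = a ∧ k = b) → ¬(j = b ∧ k = a) →
        (c (swap a b j) < c (swap a b k) ↔ c j < c k) := by
      intro j k h1 h2
      rw [hmono.lt_iff_lt, hmono.lt_iff_lt]
      rcases lt_trichotomy j k with h | h | h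
      · exact ⟨fun _ => h, fun _ => swap_adj_lt hab h h1⟩
      · subst h; simp
      · have := swap_adj_lt hab h (fun e => h2 ⟨e.2, e.1⟩)
        exact ⟨fun h' => absurd h' (not_lt.2 this.le), fun h' => absurd h' (not_lt.2 h.le)⟩
    refine genHL_congr q lam _ _ (fun j k => ?_) (fun j k hjk h => ?_)
    · simp only [Function.comp, swap_apply_self]
      rw [add_lt_add_iff_of_narrow (hc _ _) (hc _ _), add_lt_add_iff_of_narrow (hc _ _) (hc _ _)]
      by_cases h1 : j = a ∧ k = b
      · rw [h1.1, h1.2]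
        simp [hgt.ne', not_lt.2 hgt.le]
      by_cases h2 : j = b ∧ k = a
      · rw [h2.1, h2.2]
        simp [hgt]
      rw [hcs j k h1 h2]
    · simp only [Function.comp, swap_apply_self, add_sub_cancel_left]
      refine (hcs k j (fun e => ?_) (fun e => ?_)).symm
      · rw [e.1, e.2, Fin.lt_def] at hjk
        omega
      · rw [add_lt_add_iff_of_narrow (hc _ _) (hc _ _), e.1, e.2] at h
        rcases h with h | h
        · exact absurd h (not_lt.2 hgt.le)
        · exact hgt.ne' h.1

theorem nsHL_eq {q : K} (hq : q ≠ 0) {c : Fin (n + 1) → ℝ} (hc : Narrow c) (hmono : StrictMono c)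
    (μ : Weight n) : nsHL q⁻¹ μ = toRat K n (genHL q μ (fun i => μ i + c i)) := by
  have hred := (exists_isReducedWord (sortPerm μ)).choose_spec
  have hsort : Monotone ((fun i => -μ i) ∘ sortPerm μ) := Tuple.monotone_sort _
  have hdom : domRep μ = μ ∘ ⇑(sortPerm μ) := by
    rw [domRep, permWeight_apply, inv_inv]
  have hanti : Antitone (μ ∘ ⇑(sortPerm μ)) := fun i j hij => by
    have := hsort hij
    simpa using this
  have h := word_genHL hq hc hmono hanti (reducedWord (sortPerm μ)) (good_of_isReducedWord hred) ?_
  · have hprod : ((reducedWord (sortPerm μ)).map simple).prod = sortPerm μ := hred.1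
    rw [hprod] at h
    have e : (μ ∘ ⇑(sortPerm μ)) ∘ ⇑(sortPerm μ)⁻¹ = μ := by funext i; simp
    rw [e] at h
    rw [nsHL, heckeT, hdom, h, len, smul_smul, inv_mul_cancel₀ (by positivity), one_smul]
  · have hprod : ((reducedWord (sortPerm μ)).map simple).prod = sortPerm μ := hred.1
    rw [hprod]
    intro a b hab e
    exact (Tuple.eq_sort_iff.1 (rfl : sortPerm μ = Tuple.sort fun i => -μ i)).2 a b hab
      (congrArg Neg.neg e)

/-- The inversions `i < j` of `τ` with `w j ≤ w i`. -/
def invSet (τ : Perm (Fin (n + 1))) (w : Weight n) : Finset (Fin (n + 1) × Fin (n + 1)) :=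
  {p | p.1 < p.2 ∧ τ p.2 < τ p.1 ∧ w p.2 ≤ w p.1}

/-- A word for `τ` carries `genHL` to the polynomial permuted by `τ`, if `τ` inverts only pairs at
which `c` decreases. A factor `q⁻¹` arises at each letter which is not an ascent of the weight. -/
theorem word_twist {q : K} (hq : q ≠ 0) (w : Weight n) {c : Fin (n + 1) → ℝ} (hc : Narrow c)
    (hinj : Function.Injective c) (L : List (Fin n)) (hL : Good L)
    (hτ : ∀ i j, i < j → (L.map simple).prod j < (L.map simple).prod i → c j < c i) :
    ((L.map (heckeGen q⁻¹)).prod) (toRat K n (genHL q w (fun i => w i + c i))) =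
      (q⁻¹) ^ #(invSet (L.map simple).prod w) •
        toRat K n (genHL q (w ∘ ⇑((L.map simple).prod)⁻¹)
          ((fun i => (w i : ℝ) + c i) ∘ ⇑((L.map simple).prod)⁻¹)) := by
  induction L with
  | nil =>
    have e : invSet (1 : Perm (Fin (n + 1))) w = ∅ :=
      filter_eq_empty_iff.2 fun p _ h => absurd h.1 (not_lt.2 h.2.1.le)
    simp only [List.map_nil, List.prod_nil, e, card_empty, pow_zero, one_smul]
    rfl
  | cons k L ih =>
    rw [List.map_cons, List.prod_cons] at hτ
    obtain ⟨hL', hlt⟩ := hL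
    rw [List.map_cons, List.map_cons, List.prod_cons, List.prod_cons]
    set v := (L.map simple).prod with hv
    set a := k.castSucc with ha
    set b := k.succ with hb
    have hab : (a : ℕ) + 1 = b := simple_adj k
    have nab := ne_of_adj hab
    have hva : v (v⁻¹ a) = a := by simp
    have hvb : v (v⁻¹ b) = b := by simp
    -- the inversions of `s v` are those of `v` together with the pair `(v⁻¹ a, v⁻¹ b)`
    have hinv : ∀ i j, i < j → ((simple k * v) j < (simple k * v) i ↔
        v j < v i ∨ i = v⁻¹ a ∧ j = v⁻¹ b) := by
      intro i j hij
      rw [Perm.mul_apply, Perm.mul_apply]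
      constructor
      · intro h
        by_contra! hn
        have h1 : v i < v j := lt_of_le_of_ne hn.1 fun e => hij.ne (v.injective e)
        by_cases h2 : v i = a ∧ v j = b
        · refine hn.2 ?_ ?_
          · rw [← h2.1]; simp
          · rw [← h2.2]; simp
        · exact absurd (swap_adj_lt hab h1 h2) (not_lt.2 h.le)
      · rintro (h | ⟨rfl, rfl⟩)
        · refine swap_adj_lt hab h fun e => ?_
          have h1 : j = v⁻¹ a := by rw [ha, ← e.1]; simp
          have h2 : i = v⁻¹ b := by rw [hb, ← e.2]; simp
          rw [← h1, ← h2] at hlt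
          exact absurd hij (not_lt.2 hlt.le)
        · rw [hva, hvb, simple, swap_apply_left, swap_apply_right, Fin.lt_def]
          omega
    have hcab : c (v⁻¹ b) < c (v⁻¹ a) := hτ _ _ hlt ((hinv _ _ hlt).2 (Or.inr ⟨rfl, rfl⟩))
    rw [Module.End.mul_apply, ih hL' fun i j hij h => hτ i j hij ((hinv i j hij).2 (Or.inl h)),
      map_smul, heckeGen_toRat hq, heckeU_genHL q hab, map_smul, smul_smul, smul_smul]
    · have e1 : ∀ {α : Type} (f : Fin (n + 1) → α), (f ∘ ⇑v⁻¹) ∘ swap a b =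
          f ∘ ⇑(simple k * v)⁻¹ := fun f => by
        rw [mul_inv_rev, simple, swap_inv]
        rfl
      rw [e1, e1]
      congr 1
      have hr : ((fun i => (w i : ℝ) + c i) ∘ ⇑v⁻¹) a < ((fun i => (w i : ℝ) + c i) ∘ ⇑v⁻¹) b ↔
          w (v⁻¹ a) < w (v⁻¹ b) := by
        simp only [Function.comp]
        rw [add_lt_add_iff_of_narrow (hc _ _) (hc _ _)]
        exact ⟨fun h => h.resolve_right fun h => absurd h.2 (not_lt.2 hcab.le), Or.inl⟩
      have hmem : ∀ p, p ∈ invSet (simple k * v) w ↔ p ∈ invSet v w ∨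
          p = (v⁻¹ a, v⁻¹ b) ∧ w (v⁻¹ b) ≤ w (v⁻¹ a) := by
        rintro ⟨i, j⟩
        simp only [invSet, mem_filter, mem_univ, true_and, Prod.mk.injEq]
        constructor
        · rintro ⟨h1, h2, h3⟩
          rcases (hinv i j h1).1 h2 with h | ⟨rfl, rfl⟩
          · exact Or.inl ⟨h1, h, h3⟩
          · exact Or.inr ⟨⟨rfl, rfl⟩, h3⟩
        · rintro (⟨h1, h2, h3⟩ | ⟨⟨rfl, rfl⟩, h3⟩)
          · exact ⟨h1, (hinv i j h1).2 (Or.inl h2), h3⟩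
          · exact ⟨hlt, (hinv _ _ hlt).2 (Or.inr ⟨rfl, rfl⟩), h3⟩
      have hnot : (v⁻¹ a, v⁻¹ b) ∉ invSet v w := by
        simp only [invSet, mem_filter, mem_univ, true_and, hva, hvb]
        rintro ⟨-, h, -⟩
        rw [Fin.lt_def] at h
        omega
      by_cases h : w (v⁻¹ a) < w (v⁻¹ b)
      · have e2 : invSet (simple k * v) w = invSet v w := by
          ext p
          rw [hmem]
          exact or_iff_left fun h' => absurd h'.2 (not_le.2 h)
        rw [if_pos (hr.2 h), e2, mul_assoc, inv_mul_cancel₀ hq, mul_one]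
      · have e2 : invSet (simple k * v) w = insert (v⁻¹ a, v⁻¹ b) (invSet v w) := by
          ext p
          rw [hmem, mem_insert, and_iff_left (not_lt.1 h), or_comm]
        rw [if_neg (fun h' => h (hr.1 h')), e2, card_insert_of_notMem hnot, mul_one, pow_succ]
    · exact add_ne_add_of_narrow hc hinj (fun e => nab (v⁻¹.injective e)) _ _
    · simpa using hcab

/-- The twisted non-symmetric Hall–Littlewood polynomials are the polynomials `genHL` attached to
`w + c`, for any `c` in the relative order of `σ` whose entries differ by less than `1`. -/
theorem twistedHL_eq {q : K} (hq : q ≠ 0) {σ : Perm (Fin (n + 1))} {c : Fin (n + 1) → ℝ}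
    (hc : Narrow c) (hσ : ∀ i j, σ i < σ j ↔ c i < c j) (w : Weight n) :
    twistedHL q⁻¹ σ⁻¹ w = toRat K n (genHL q w (fun i => w i + c i)) := by
  have hinj : Function.Injective c := fun i j h => by
    by_contra hne
    rcases lt_or_gt_of_ne (σ.injective.ne hne) with h1 | h1
    · exact absurd h ((hσ _ _).1 h1).ne
    · exact absurd h ((hσ _ _).1 h1).ne'
  have hred := (exists_isReducedWord σ).choose_spec
  have hprod : ((reducedWord σ).map simple).prod = σ := hred.1
  have h := word_twist hq w hc hinj (reducedWord σ) (good_of_isReducedWord hred)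
    (by rw [hprod]; exact fun i j _ h => (hσ j i).1 h)
  rw [hprod] at h
  have hmono : StrictMono (c ∘ ⇑σ⁻¹) := fun i j hij => by
    rw [Function.comp, Function.comp, ← hσ]
    simpa using hij
  have hns := nsHL_eq hq (c := c ∘ ⇑σ⁻¹) (fun i j => hc _ _) hmono (w ∘ ⇑σ⁻¹)
  have e : (fun i => ((w ∘ ⇑σ⁻¹) i : ℝ) + (c ∘ ⇑σ⁻¹) i) = (fun i => (w i : ℝ) + c i) ∘ ⇑σ⁻¹ := rfl
  rw [e] at hns
  have hexp : twistExponent σ⁻¹ w = #(invSet σ w) := by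
    rw [twistExponent, invSet, inv_inv]
  rw [twistedHL, inv_inv, permWeight_apply, hns, hexp, ← map_smul, ← h]
  change Ring.inverse (heckeT q⁻¹ σ) (heckeT q⁻¹ σ _) = _
  rw [← Module.End.mul_apply, Ring.inverse_mul_cancel _ (isUnit_heckeT (inv_ne_zero hq) σ),
    Module.End.one_apply]

/-- The coefficients of the LLT series, as constant terms. -/
theorem lltSeries_eq {q : K} (hq : q ≠ 0) {σ : Perm (Fin (n + 1))} {c : Fin (n + 1) → ℝ}
    (hc : Narrow c) (hσ : ∀ i j, σ i < σ j ↔ c i < c j) (α β : Weight n) (μ : DomWeight n)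
    {χ : Laurent K n} (hχ : toRat K n χ = irrChar μ) :
    lltSeries q σ β α μ = ctDelta q (χ * genHL q α (fun i => α i + c i) *
      genHL q (-β) (fun i => -(β i + c i))) := by
  have hinj : Function.Injective c := fun i j h => by
    by_contra hne
    rcases lt_or_gt_of_ne (σ.injective.ne hne) with h1 | h1
    · exact absurd h ((hσ _ _).1 h1).ne
    · exact absurd h ((hσ _ _).1 h1).ne'
  rw [lltSeries]
  simp only [twistedHL_eq hq hc hσ]
  rw [← hχ, ← map_mul]
  exact expansion_genHL hq hc hinj _ β

end Link

/-! ### Irreducible characters -/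

section Characters

variable {K : Type} [Field K] {n : ℕ}

theorem xp_sum {ι α : Type} (s : Finset α) (f : α → ι → ℤ) :
    (xp (∑ i ∈ s, f i) : Lau K ι) = ∏ i ∈ s, xp (f i) := by
  classical
  induction s using Finset.induction_on with
  | empty => simp
  | insert a s ha ih => rw [sum_insert ha, prod_insert ha, xp_add, ih]

/-- The action of a permutation on Laurent polynomials. -/
abbrev act (w : Perm (Fin (n + 1))) : Lau K (Fin (n + 1)) →ₐ[K] Lau K (Fin (n + 1)) :=
  mapX (reidx ⇑w⁻¹)

/-- The weight `ρ`, up to a constant vector. -/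
def rho : Weight n := fun i => -((i : ℕ) : ℤ)

/-- The inverse of the variable `x_i`. -/
def invVar (i : Fin (n + 1)) : Lau K (Fin (n + 1)) := xp (-Pi.single i 1)

theorem reidx_single (w : Perm (Fin (n + 1))) (i : Fin (n + 1)) (k : ℤ) :
    (Pi.single i k : Weight n) ∘ ⇑w⁻¹ = Pi.single (w i) k := by
  funext j
  have h : w⁻¹ j = i ↔ j = w i := Perm.inv_eq_iff_eq
  simp only [Function.comp, Pi.single_apply, h]

theorem act_invVar (w : Perm (Fin (n + 1))) (i : Fin (n + 1)) :
    act w (invVar i : Lau K (Fin (n + 1))) = invVar (w i) := by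
  rw [invVar, mapX_xp, map_neg, reidx_apply, reidx_single, invVar]

/-- The Vandermonde determinant in the inverses of the variables. -/
def vand (K : Type) [Field K] (n : ℕ) : Lau K (Fin (n + 1)) :=
  (Matrix.vandermonde (invVar (K := K) (n := n))).det

/-- The denominator `∏_{i<j} (1 - x_j / x_i)` of the Weyl character formula. -/
def weylDen (K : Type) [Field K] (n : ℕ) : Lau K (Fin (n + 1)) :=
  ∏ i : Fin (n + 1), ∏ j ∈ Ioi i, (1 - xp (root j i))

theorem rho_eq_sum : (rho : Weight n) = ∑ i : Fin (n + 1), ∑ j ∈ Ioi i, -Pi.single j 1 := by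
  have h : (rho : Weight n) = ∑ j : Fin (n + 1), ∑ i ∈ Iio j, -Pi.single j 1 := by
    funext k
    simp [rho, Finset.sum_apply, Pi.single_apply]
  rw [h]
  refine Finset.sum_comm' fun i j => ?_
  simp

theorem vand_eq : vand K n = xp rho * weylDen K n := by
  rw [vand, Matrix.det_vandermonde, weylDen, rho_eq_sum, xp_sum, ← prod_mul_distrib]
  refine prod_congr rfl fun i _ => ?_
  rw [xp_sum, ← prod_mul_distrib]
  refine prod_congr rfl fun j _ => ?_
  rw [mul_sub, mul_one, ← xp_add, invVar, invVar]
  congr 2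
  rw [root]
  abel

theorem act_vand (w : Perm (Fin (n + 1))) :
    act w (vand K n) = ((Perm.sign w : ℤ) : Lau K (Fin (n + 1))) * vand K n := by
  rw [vand, AlgHom.map_det, ← Matrix.det_permute]
  congr 1
  ext1 i j
  simp only [AlgHom.mapMatrix_apply, Matrix.map_apply, Matrix.vandermonde_apply, map_pow,
    act_invVar, Matrix.submatrix_apply, id]

theorem vand_ne_zero : vand K n ≠ 0 := by
  rw [vand_eq]
  refine mul_ne_zero (xp_ne_zero _) (prod_ne_zero_iff.2 fun i _ => prod_ne_zero_iff.2 fun j hj => ?_)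
  exact one_sub_xp_ne_zero (root_ne_zero (mem_Ioi.1 hj).ne')

/-- The antisymmetrization `∑_w sgn(w) w(f)`. -/
def alt (f : Lau K (Fin (n + 1))) : Lau K (Fin (n + 1)) :=
  ∑ w : Perm (Fin (n + 1)), ((Perm.sign w : ℤ) : Lau K (Fin (n + 1))) * act w f

theorem weylSym_add (f g : RatFn K n) : weylSym (f + g) = weylSym f + weylSym g := by
  simp [weylSym, add_div, sum_add_distrib]

theorem weylSym_smul (c : K) (f : RatFn K n) : weylSym (c • f) = c • weylSym f := by
  simp [weylSym, smul_div_assoc, smul_sum]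

theorem weylDen_toRat : ∏ i : Fin (n + 1), ∏ j ∈ Ioi i, (1 - var j / var i : RatFn K n) =
    toRat K n (weylDen K n) := by
  simp only [weylDen, map_prod, map_sub, map_one, var_div_var]

theorem weylSym_mul_vand (f : Lau K (Fin (n + 1))) :
    weylSym (toRat K n f) * toRat K n (vand K n) = toRat K n (alt (xp rho * f)) := by
  have hV : toRat K n (vand K n) ≠ 0 := by
    rw [Ne, map_eq_zero_iff _ toRat_injective]
    exact vand_ne_zero
  have hD : toRat K n (weylDen K n) ≠ 0 := by
    have := hV
    rw [vand_eq, map_mul] at this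
    exact right_ne_zero_of_mul this
  rw [weylSym, sum_mul, alt, map_sum, weylDen_toRat]
  refine sum_congr rfl fun w _ => ?_
  have h1 : toRat K n (vand K n) =
      ((Perm.sign w : ℤ) : RatFn K n) * permRatFn w (toRat K n (vand K n)) := by
    rw [permRatFn_toRat, act_vand, map_mul, map_intCast, ← mul_assoc, ← Int.cast_mul,
      ← Units.val_mul, Int.units_mul_self, Units.val_one, Int.cast_one, one_mul]
  have h2 : toRat K n f / toRat K n (weylDen K n) * toRat K n (vand K n) =
      toRat K n (xp rho * f) := by
    rw [vand_eq, map_mul, map_mul]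
    field_simp
  rw [map_mul, map_intCast, ← permRatFn_toRat, ← h2, map_mul]
  conv_lhs => rw [h1]
  ring

theorem act_xp (w : Perm (Fin (n + 1))) (γ : Weight n) :
    act w (xp γ : Lau K (Fin (n + 1))) = xp (γ ∘ ⇑w⁻¹) := mapX_xp _ _

theorem reidx_perm_injective (w : Perm (Fin (n + 1))) :
    Function.Injective (reidx (w : Fin (n + 1) → Fin (n + 1))) := fun a b h => by
  funext i
  have := congrFun h (w⁻¹ i)
  simpa using this

theorem coeff_act (w : Perm (Fin (n + 1))) (f : Lau K (Fin (n + 1))) (γ : Weight n) :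
    (act w f).coeff γ = f.coeff (γ ∘ w) := by
  rw [← coeff_mapX _ (reidx_perm_injective w⁻¹) f (γ ∘ w)]
  congr 1
  funext i
  simp

/-- The alternant of a monomial as a determinant. -/
theorem alt_xp (N : ℤ) (e : Fin (n + 1) → ℕ) (γ : Weight n) (h : ∀ i, γ i = N - e i) :
    (alt (xp γ) : Lau K (Fin (n + 1))) =
      xp (fun _ => N) * (Matrix.of fun i j => invVar i ^ e j).det := by
  rw [alt, Matrix.det_apply', mul_sum]
  refine sum_congr rfl fun w _ => ?_
  rw [mul_left_comm]
  congr 1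
  simp only [Matrix.of_apply, invVar, xp_pow]
  rw [← xp_sum, ← xp_add, act_xp]
  congr 1
  funext i
  simp only [Function.comp, Pi.add_apply, Finset.sum_apply, Pi.smul_apply, Pi.neg_apply,
    Pi.single_apply, h, smul_neg, sum_neg_distrib, smul_ite, smul_zero, sub_eq_add_neg]
  rw [Finset.sum_eq_single (w⁻¹ i)]
  · simp
  · intro j _ hj
    rw [if_neg]
    rintro rfl
    simp at hj
  · simp

theorem exists_alt_xp (γ : Weight n) : ∃ (N : ℤ) (e : Fin (n + 1) → ℕ), ∀ i, γ i = N - e i := by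
  refine ⟨∑ i, |γ i|, fun i => (∑ i, |γ i| - γ i).toNat, fun i => ?_⟩
  have h1 := le_abs_self (γ i)
  have h2 := single_le_sum (f := fun i => |γ i|) (fun i _ => abs_nonneg _) (mem_univ i)
  dsimp only at h2 ⊢
  omega

theorem alt_xp_eq_zero {γ : Weight n} (h : ¬Function.Injective γ) :
    (alt (xp γ) : Lau K (Fin (n + 1))) = 0 := by
  obtain ⟨N, e, he⟩ := exists_alt_xp γ
  rw [Function.not_injective_iff] at h
  obtain ⟨i, j, h1, h2⟩ := h
  rw [alt_xp N e γ he, Matrix.det_zero_of_column_eq h2, mul_zero]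
  intro k
  have : e i = e j := by
    have := he i
    have := he j
    omega
  simp [this]

theorem alt_xp_comp (s : Perm (Fin (n + 1))) (γ : Weight n) :
    (alt (xp (γ ∘ s)) : Lau K (Fin (n + 1))) = ((Perm.sign s : ℤ) : Lau K (Fin (n + 1))) *
      alt (xp γ) := by
  obtain ⟨N, e, he⟩ := exists_alt_xp γ
  rw [alt_xp N e γ he, alt_xp N (e ∘ s) (γ ∘ s) fun i => he _, mul_left_comm, ← Matrix.det_permute']
  rfl

/-- Alternants are divisible by the Vandermonde determinant: reduce the powers of the variables
modulo the polynomial which has the variables as roots. -/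
theorem vand_dvd_alt (γ : Weight n) : ∃ χ : Lau K (Fin (n + 1)), χ * vand K n = alt (xp γ) := by
  obtain ⟨N, e, he⟩ := exists_alt_xp γ
  set P : Polynomial (Lau K (Fin (n + 1))) := ∏ i, (Polynomial.X - Polynomial.C (invVar i)) with hP
  have hmon : P.Monic := Polynomial.monic_prod_of_monic _ _ fun i _ => Polynomial.monic_X_sub_C _
  have hdeg : P.natDegree = n + 1 := by
    rw [hP, Polynomial.natDegree_prod_of_monic _ _ fun i _ => Polynomial.monic_X_sub_C _]
    simp
  have hroot : ∀ i, P.eval (invVar i) = 0 := fun i => by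
    rw [hP, Polynomial.eval_prod]
    exact prod_eq_zero (mem_univ i) (by simp)
  let r : Fin (n + 1) → Polynomial (Lau K (Fin (n + 1))) := fun j => (Polynomial.X ^ e j) %ₘ P
  refine ⟨xp (fun _ => N) * (Matrix.of fun k j : Fin (n + 1) => (r j).coeff k).det, ?_⟩
  rw [alt_xp N e γ he, mul_assoc, mul_comm (Matrix.det _), vand, ← Matrix.det_mul]
  congr 2
  ext1 i j
  have hlt : (r j).natDegree < n + 1 := by
    refine lt_of_lt_of_eq (Polynomial.natDegree_modByMonic_lt _ hmon fun h => ?_) hdeg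
    rw [h, Polynomial.natDegree_one] at hdeg
    omega
  have h1 : (r j).eval (invVar i) = invVar i ^ e j := by
    have h2 := congrArg (Polynomial.eval (invVar i)) (Polynomial.modByMonic_add_div
      (Polynomial.X ^ e j) P)
    rw [Polynomial.eval_add, Polynomial.eval_mul, hroot, zero_mul, add_zero] at h2
    simpa using h2
  rw [Matrix.mul_apply, Matrix.of_apply, ← h1, Polynomial.eval_eq_sum_range' hlt, Finset.sum_range]
  refine sum_congr rfl fun k _ => ?_
  rw [Matrix.vandermonde_apply, Matrix.of_apply, mul_comm]

/-- The irreducible character `χ_μ` as a Laurent polynomial. -/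
def charLau (K : Type) [Field K] {n : ℕ} (μ : DomWeight n) : Lau K (Fin (n + 1)) :=
  (vand_dvd_alt (K := K) (rho + μ.1)).choose

theorem charLau_mul_vand (μ : DomWeight n) :
    charLau K μ * vand K n = alt (xp (rho + μ.1)) :=
  (vand_dvd_alt (K := K) (rho + μ.1)).choose_spec

theorem toRat_vand_ne_zero : toRat K n (vand K n) ≠ 0 := by
  rw [Ne, map_eq_zero_iff _ toRat_injective]
  exact vand_ne_zero

theorem toRat_charLau (μ : DomWeight n) : toRat K n (charLau K μ) = irrChar μ := by
  apply mul_right_cancel₀ (toRat_vand_ne_zero (K := K))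
  rw [irrChar, mono_eq, weylSym_mul_vand, ← map_mul, charLau_mul_vand, xp_add]

theorem permRatFn_mul (v w : Perm (Fin (n + 1))) (f : RatFn K n) :
    permRatFn v (permRatFn w f) = permRatFn (v * w) f := by
  obtain ⟨a, b, -, rfl⟩ := IsFractionRing.div_surjective (A := Laurent K n) f
  have key : ∀ g : Laurent K n, permRatFn v (permRatFn w
      (algebraMap (Laurent K n) (RatFn K n) g)) =
        permRatFn (v * w) (algebraMap (Laurent K n) (RatFn K n) g) := by
    intro g
    change permRatFn v (permRatFn w (toRat K n g)) = permRatFn (v * w) (toRat K n g)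
    rw [permRatFn_toRat, permRatFn_toRat, permRatFn_toRat, mapX_comp, mul_inv_rev]
    rfl
  rw [map_div₀, map_div₀, key, key, map_div₀]

theorem permRatFn_weylSym (v : Perm (Fin (n + 1))) (f : RatFn K n) :
    permRatFn v (weylSym f) = weylSym f := by
  rw [weylSym, map_sum]
  simp only [permRatFn_mul]
  exact Fintype.sum_equiv (Equiv.mulLeft v) _ _ fun w => rfl

theorem act_charLau (w : Perm (Fin (n + 1))) (μ : DomWeight n) :
    act w (charLau K μ) = charLau K μ := by
  apply toRat_injective
  rw [← permRatFn_toRat, toRat_charLau, irrChar, permRatFn_weylSym]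

theorem rho_add_strictAnti (μ : DomWeight n) : StrictAnti (rho + μ.1) := by
  intro i j hij
  have h1 := μ.2 hij.le
  have h2 : ((i : ℕ) : ℤ) < (j : ℕ) := by exact_mod_cast hij
  simp only [Pi.add_apply, rho]
  omega

theorem intCast_mul_eq (k : ℤ) (g : Lau K (Fin (n + 1))) :
    (k : Lau K (Fin (n + 1))) * g = (k : K) • g := by
  rw [Algebra.smul_def, map_intCast]

theorem coeff_alt (f : Lau K (Fin (n + 1))) (γ : Weight n) :
    (alt f).coeff γ = ∑ w : Perm (Fin (n + 1)), ((Perm.sign w : ℤ) : K) * f.coeff (γ ∘ w) := by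
  have h : ∀ g : Lau K (Fin (n + 1)), g.coeff γ = ct (xp (-γ) * g) := fun g =>
    (ct_xp_neg_mul γ g).symm
  rw [h, alt, mul_sum, map_sum]
  refine sum_congr rfl fun w _ => ?_
  rw [intCast_mul_eq, mul_smul_comm, map_smul, ← h, coeff_act, smul_eq_mul]

theorem strictAnti_comp_eq {γ δ : Weight n} (hγ : StrictAnti γ) (hδ : StrictAnti δ)
    {w : Perm (Fin (n + 1))} (h : δ = γ ∘ w) : w = 1 := by
  have hm : StrictMono w := fun i j hij => by
    have := hδ hij
    rw [h] at this
    exact hγ.lt_iff_gt.1 this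
  have := Subsingleton.elim (StrictMono.orderIsoOfSurjective _ hm w.surjective) (OrderIso.refl _)
  ext i
  exact congrArg Fin.val (congrArg (fun e : Fin (n + 1) ≃o Fin (n + 1) => e i) this)

theorem coeff_alt_xp {γ δ : Weight n} (hγ : StrictAnti γ) (hδ : StrictAnti δ) :
    (alt (xp δ) : Lau K (Fin (n + 1))).coeff γ = if δ = γ then 1 else 0 := by
  rw [coeff_alt]
  simp only [coeff_xp]
  rw [Finset.sum_eq_single 1]
  · simp
  · intro w _ hw
    rw [if_neg (fun h => hw (strictAnti_comp_eq hγ hδ h)), mul_zero]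
  · simp

/-- Weyl symmetrizations are combinations of irreducible characters: `ρ + γ` has repeated entries,
or it can be sorted into `ρ + μ` with `μ` dominant. -/
theorem weylSym_mem_span (f : Lau K (Fin (n + 1))) :
    weylSym (toRat K n f) ∈ Submodule.span K (Set.range (irrChar (K := K) (n := n))) := by
  induction f using lau_induction with
  | hadd f g hf hg =>
    rw [map_add, weylSym_add]
    exact Submodule.add_mem _ hf hg
  | hsmul c f hf =>
    rw [map_smul, weylSym_smul]
    exact Submodule.smul_mem _ _ hf
  | hx γ =>
    by_cases hinj : Function.Injective (rho + γ)
    · set s := Tuple.sort fun i => -((rho + γ : Weight n) i) with hs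
      have hmon : Monotone ((fun i => -((rho + γ : Weight n) i)) ∘ s) := Tuple.monotone_sort _
      have hanti : StrictAnti ((rho + γ : Weight n) ∘ s) := by
        intro i j hij
        have h1 := hmon hij.le
        simp only [Function.comp, neg_le_neg_iff] at h1 ⊢
        exact lt_of_le_of_ne h1 fun h => hij.ne' (s.injective (hinj h))
      let μ : DomWeight n := ⟨(rho + γ : Weight n) ∘ s - rho, by
        refine Fin.antitone_iff_succ_le.2 fun i => ?_
        have h1 := hanti (Fin.castSucc_lt_succ (i := i))
        simp only [Pi.sub_apply, rho, Fin.val_succ, Fin.val_castSucc]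
        push_cast
        omega⟩
      have hμ : rho + μ.1 = (rho + γ : Weight n) ∘ s := by simp [μ]
      have h2 : (((Perm.sign s : ℤ) : K)) • weylSym (toRat K n (xp γ)) = irrChar (K := K) μ := by
        apply mul_right_cancel₀ (toRat_vand_ne_zero (K := K))
        rw [smul_mul_assoc, weylSym_mul_vand, ← toRat_charLau, ← map_mul, charLau_mul_vand, hμ,
          alt_xp_comp, map_mul, map_intCast, xp_add, Algebra.smul_def, map_intCast]
      have h3 : weylSym (toRat K n (xp γ)) = (((Perm.sign s : ℤ) : K)) • irrChar (K := K) μ := by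
        rw [← h2, smul_smul, ← Int.cast_mul, ← Units.val_mul, Int.units_mul_self, Units.val_one,
          Int.cast_one, one_smul]
      rw [h3]
      exact Submodule.smul_mem _ _ (Submodule.subset_span ⟨μ, rfl⟩)
    · have h : weylSym (toRat K n (xp γ)) = 0 := by
        apply mul_right_cancel₀ (toRat_vand_ne_zero (K := K))
        rw [weylSym_mul_vand, ← xp_add, alt_xp_eq_zero hinj, map_zero, zero_mul]
      rw [h]
      exact Submodule.zero_mem _

theorem irrCoeff_weylSym (f : Lau K (Fin (n + 1))) (μ : DomWeight n) :
    irrCoeff (weylSym (toRat K n f)) μ = (alt (xp rho * f)).coeff (rho + μ.1) := by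
  have hex : ∃ c : DomWeight n →₀ K,
      Finsupp.linearCombination K (irrChar (K := K) (n := n)) c = weylSym (toRat K n f) := by
    obtain ⟨c, hc⟩ := Finsupp.mem_span_range_iff_exists_finsupp.1 (weylSym_mem_span f)
    exact ⟨c, by rw [Finsupp.linearCombination_apply, hc]⟩
  have h := Classical.epsilon_spec hex
  change Finsupp.linearCombination K _ (expansion _ _) = _ at h
  rw [irrCoeff]
  set e : DomWeight n →₀ K := expansion (irrChar (K := K) (n := n)) (weylSym (toRat K n f))
  have h2 : ∑ ν ∈ e.support, e ν • alt (xp (rho + ν.1)) = alt (xp rho * f) := by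
    apply toRat_injective
    rw [← weylSym_mul_vand, ← h, Finsupp.linearCombination_apply, Finsupp.sum, sum_mul, map_sum]
    refine sum_congr rfl fun ν _ => ?_
    rw [map_smul, smul_mul_assoc, ← charLau_mul_vand, map_mul, toRat_charLau]
  rw [← h2, ← ct_xp_neg_mul, mul_sum, map_sum]
  have h3 : ∀ ν : DomWeight n, ct (xp (-(rho + μ.1)) * e ν • alt (xp (rho + ν.1))) =
      if ν = μ then e ν else 0 := fun ν => by
    rw [mul_smul_comm, map_smul, ct_xp_neg_mul,
      coeff_alt_xp (rho_add_strictAnti μ) (rho_add_strictAnti ν), smul_eq_mul,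
      mul_ite, mul_one, mul_zero]
    exact if_congr (by rw [add_right_inj, Subtype.ext_iff]) rfl rfl
  simp only [h3]
  rw [Finset.sum_ite_eq']
  split_ifs with h4
  · rfl
  · exact Finsupp.notMem_support_iff.1 h4

/-- The inversion of all the variables. -/
def bar : Lau K (Fin (n + 1)) →ₐ[K] Lau K (Fin (n + 1)) := mapX (-AddMonoidHom.id _)

theorem bar_xp (γ : Weight n) : bar (xp γ : Lau K (Fin (n + 1))) = xp (-γ) := by
  rw [bar, mapX_xp]
  rfl

/-- The product `∏_{i<j} (1 - x_i / x_j)`. -/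
def weylNum (K : Type) [Field K] (n : ℕ) : Lau K (Fin (n + 1)) :=
  ∏ i : Fin (n + 1), ∏ j ∈ Ioi i, (1 - xp (root i j))

theorem bar_weylDen : bar (weylDen K n) = weylNum K n := by
  simp only [weylDen, weylNum, map_prod, map_sub, map_one, bar_xp, neg_root]

/-- The Weyl integration formula. -/
theorem irrCoeff_weylSym_eq_ct (f : Lau K (Fin (n + 1))) (μ : DomWeight n) :
    irrCoeff (weylSym (toRat K n f)) μ = ct (f * bar (charLau K μ) * weylNum K n) := by
  have h1 : f * bar (charLau K μ) * weylNum K n =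
      xp rho * f * bar (alt (xp (rho + μ.1))) := by
    have h := xp_mul_neg (K := K) (rho (n := n))
    rw [← charLau_mul_vand, map_mul, vand_eq, map_mul, bar_weylDen, bar_xp]
    linear_combination (-f * bar (charLau K μ) * weylNum K n) * h
  rw [irrCoeff_weylSym, h1, coeff_alt, alt, map_sum, mul_sum, map_sum]
  refine Fintype.sum_equiv (Equiv.inv _) _ _ fun w => ?_
  rw [map_mul bar, map_intCast, act_xp, bar_xp, Equiv.inv_apply, inv_inv, Perm.sign_inv,
    mul_left_comm, mul_comm (xp rho * f), intCast_mul_eq, map_smul, smul_eq_mul]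
  congr 1
  exact (ct_xp_neg_mul _ _).symm

end Characters

/-! ### Hall–Littlewood symmetrization -/

section HallLittlewood

variable {K : Type} [Field K] {n : ℕ}

/-- The positive roots, as pairs of indices. -/
abbrev PosRoot (n : ℕ) := {p : Fin (n + 1) × Fin (n + 1) // p.1 < p.2}

/-- The exponent of `∏_{i<j} (x_i / x_j) ^ m_{ij}`. -/
def rootSum (m : PosRoot n → ℕ) : Weight n := ∑ p, m p • root p.1.1 p.1.2

theorem height_sum {α : Type*} {k : ℕ} (s : Finset α) (f : α → Fin k → ℤ) :
    height (∑ i ∈ s, f i) = ∑ i ∈ s, height (f i) := by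
  classical
  induction s using Finset.induction_on with
  | empty => simp [height]
  | insert a s ha ih => rw [sum_insert ha, sum_insert ha, height_add, ih]

theorem le_height_rootSum (m : PosRoot n → ℕ) : (∑ p, m p : ℕ) ≤ height (rootSum m) := by
  rw [rootSum, height_sum, Nat.cast_sum]
  refine sum_le_sum fun p _ => ?_
  have h1 := (root_mem_rootCone p.2).1
  have h2 : height (m p • root p.1.1 p.1.2) = m p * height (root p.1.1 p.1.2) := by
    simp only [height, Pi.smul_apply, nsmul_eq_mul, mul_sum, mul_neg, neg_inj]
    refine sum_congr rfl fun i _ => by ring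
  rw [h2]
  nlinarith [(m p).cast_nonneg (α := ℤ)]

theorem ct_mul_rootSum_eventually (g : Lau K (Fin (n + 1))) :
    ∃ N, ∀ m : PosRoot n → ℕ, N ≤ ∑ p, m p → ct (g * xp (rootSum m)) = 0 := by
  induction g using lau_induction with
  | hx γ =>
    refine ⟨(1 - height γ).toNat, fun m hm => ?_⟩
    rw [← xp_add]
    refine ct_xp_of_ne fun h => ?_
    have h1 := le_height_rootSum m
    have h2 := height_add γ (rootSum m)
    rw [h] at h2
    have h3 : height (0 : Weight n) = 0 := by simp [height]
    omega
  | hadd f g hf hg =>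
    obtain ⟨N₁, h₁⟩ := hf
    obtain ⟨N₂, h₂⟩ := hg
    refine ⟨max N₁ N₂, fun m hm => ?_⟩
    rw [add_mul, map_add, h₁ m ((le_max_left _ _).trans hm), h₂ m ((le_max_right _ _).trans hm),
      add_zero]
  | hsmul c f hf =>
    obtain ⟨N, h⟩ := hf
    refine ⟨N, fun m hm => ?_⟩
    rw [smul_mul_assoc, map_smul, h m hm, smul_zero]

theorem coeff_delta (k : ℕ) : PowerSeries.coeff k (delta K (n + 1)) =
    weylNum K n * ∑ l ∈ finsuppAntidiag (univ : Finset (PosRoot n)) k, xp (rootSum l) := by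
  have h : delta K (n + 1) = PowerSeries.C (weylNum K n) *
      ∏ p : PosRoot n, geom (xp (root p.1.1 p.1.2)) := by
    have e : ∏ p : PosRoot n, geom (xp (root p.1.1 p.1.2) : Lau K (Fin (n + 1))) =
        ∏ i : Fin (n + 1), ∏ j ∈ Ioi i, geom (xp (root i j)) := by
      rw [prod_Ioi_eq_prod_filter]
      exact (Finset.prod_subtype _ (by simp) fun p : Fin (n + 1) × Fin (n + 1) =>
        geom (xp (root p.1 p.2))).symm
    rw [e, delta, weylNum, map_prod, ← prod_mul_distrib]
    refine prod_congr rfl fun i _ => ?_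
    rw [map_prod, ← prod_mul_distrib]
    exact prod_congr rfl fun j _ => by rw [deltaFactor]
  rw [h, PowerSeries.coeff_C_mul, PowerSeries.coeff_prod]
  refine congrArg _ (sum_congr rfl fun l _ => ?_)
  rw [rootSum, xp_sum]
  refine prod_congr rfl fun p _ => ?_
  rw [geom, PowerSeries.coeff_mk, xp_pow]

/-- The coefficients of a Hall–Littlewood symmetrization, as constant terms. -/
theorem hallLittlewoodSym_toRat (q : K) (φ : Lau K (Fin (n + 1))) (μ : DomWeight n) :
    hallLittlewoodSym q (toRat K n φ) μ = ctDelta q (φ * bar (charLau K μ)) := by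
  classical
  set g := φ * bar (charLau K μ) * weylNum K n with hg
  have hterm : ∀ m : PosRoot n → ℕ, irrCoeff (weylSym (toRat K n φ * ∏ p : PosRoot n,
      (algebraMap K (RatFn K n) q * (var p.1.1 / var p.1.2)) ^ m p)) μ =
      q ^ (∑ p, m p) * ct (g * xp (rootSum m)) := by
    intro m
    have e : toRat K n φ * ∏ p : PosRoot n,
        (algebraMap K (RatFn K n) q * (var p.1.1 / var p.1.2)) ^ m p =
        toRat K n (q ^ (∑ p, m p) • (φ * xp (rootSum m))) := by
      rw [map_smul, map_mul, rootSum, xp_sum, map_prod, Algebra.smul_def, mul_left_comm, map_pow,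
        ← prod_pow_eq_pow_sum, ← prod_mul_distrib]
      congr 1
      refine prod_congr rfl fun p _ => ?_
      rw [mul_pow, var_div_var, ← map_pow (toRat K n), xp_pow]
    rw [e, irrCoeff_weylSym_eq_ct, smul_mul_assoc, smul_mul_assoc, map_smul, smul_eq_mul, hg]
    congr 2
    ring
  obtain ⟨N, hN⟩ := ct_mul_rootSum_eventually g
  have hcoeff : ∀ k, ct (φ * bar (charLau K μ) * PowerSeries.coeff k (delta K (n + 1))) =
      ∑ l ∈ finsuppAntidiag (univ : Finset (PosRoot n)) k, ct (g * xp (rootSum l)) := by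
    intro k
    rw [coeff_delta, ← mul_assoc, mul_sum, map_sum]
  rw [ctDelta, ctWith_eq_sum q inCone_delta _ (N := N), hallLittlewoodSym]
  · simp only [hterm, hcoeff]
    rw [← finsum_comp_equiv Finsupp.equivFunOnFinite, finsum_eq_sum_of_support_subset
      (s := (range N).biUnion fun k => finsuppAntidiag (univ : Finset (PosRoot n)) k), sum_biUnion]
    · refine sum_congr rfl fun k _ => ?_
      rw [mul_sum]
      refine sum_congr rfl fun l hl => ?_
      rw [mem_finsuppAntidiag] at hl
      show q ^ (∑ p, l p) * _ = _
      rw [hl.1]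
      rfl
    · intro k _ k' _ hne
      refine disjoint_left.2 fun l hl hl' => hne ?_
      rw [mem_finsuppAntidiag] at hl hl'
      rw [← hl.1, hl'.1]
    · intro l hl
      by_contra hn
      refine hl ?_
      show q ^ (∑ p, l p) * ct (g * xp (rootSum l)) = 0
      rw [hN l, mul_zero]
      by_contra hlt
      refine hn ?_
      rw [mem_coe, mem_biUnion]
      exact ⟨∑ p, l p, mem_range.2 (not_le.1 hlt), mem_finsuppAntidiag.2 ⟨rfl, subset_univ _⟩⟩
  · intro k hk
    rw [hcoeff]
    refine sum_eq_zero fun l hl => hN l ?_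
    rw [mem_finsuppAntidiag] at hl
    rwa [hl.1]

/-- The substitution `x_i ↦ 1 / x_{l + 1 - i}`. -/
def flip : Lau K (Fin (n + 1)) →ₐ[K] Lau K (Fin (n + 1)) := mapX (-reidx Fin.rev)

theorem flip_xp (γ : Weight n) : flip (xp γ : Lau K (Fin (n + 1))) = xp (-(γ ∘ Fin.rev)) :=
  mapX_xp _ _

theorem neg_root_comp_rev (i j : Fin (n + 1)) : -(root i j ∘ Fin.rev) = root j.rev i.rev := by
  have h := reidx_root Fin.revPerm i j
  rw [← neg_root i.rev j.rev]
  exact congrArg Neg.neg h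

theorem map_flip_delta : PowerSeries.map (flip (K := K) (n := n)).toRingHom (delta K (n + 1)) =
    delta K (n + 1) := by
  rw [delta, prod_Ioi_eq_prod_filter, map_prod]
  refine prod_nbij' (fun p => (p.2.rev, p.1.rev)) (fun p => (p.2.rev, p.1.rev)) ?_ ?_ ?_ ?_ ?_
  · rintro ⟨i, j⟩ h
    simpa using h
  · rintro ⟨i, j⟩ h
    simpa using h
  · rintro ⟨i, j⟩ _
    simp
  · rintro ⟨i, j⟩ _
    simp
  · rintro ⟨i, j⟩ _
    exact map_deltaFactor (K := K) _ (neg_root_comp_rev i j)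

theorem ctDelta_flip (q : K) (f : Lau K (Fin (n + 1))) : ctDelta q (flip f) = ctDelta q f := by
  rw [ctDelta, ctWith_apply q inCone_delta, ctWith_apply q inCone_delta]
  congr 1
  funext k
  congr 1
  have h := congrArg (PowerSeries.coeff k) (map_flip_delta (K := K) (n := n))
  rw [PowerSeries.coeff_map] at h
  conv_lhs => rw [← h]
  show ct (flip f * flip (PowerSeries.coeff k (delta K (n + 1)))) = _
  rw [← map_mul (flip (K := K) (n := n))]
  refine ct_mapX (K := K) (-reidx Fin.rev) (fun a b hab => ?_) _
  funext i
  have := congrFun hab i.rev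
  simpa using this

theorem flip_bar_charLau (μ : DomWeight n) : flip (bar (charLau K μ)) = charLau K μ := by
  rw [bar, flip, mapX_comp]
  conv_rhs => rw [← act_charLau Fin.revPerm μ]
  congr 2
  refine AddMonoidHom.ext fun γ => ?_
  funext i
  show - -γ i.rev = γ (Fin.revPerm⁻¹ i)
  rw [neg_neg]
  rfl

theorem hallLittlewoodSym_eq (q : K) (φ : Lau K (Fin (n + 1))) (μ : DomWeight n) :
    hallLittlewoodSym q (toRat K n φ) μ = ctDelta q (flip φ * charLau K μ) := by
  rw [hallLittlewoodSym_toRat, ← ctDelta_flip, map_mul, flip_bar_charLau]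

end HallLittlewood

/-! ### A Cauchy identity -/

section Cauchy

variable {K : Type} [Field K] {m : ℕ}

/-- The exponents of the monomials of degree `d` in the inverses of the variables. -/
def negPart (m : ℕ) (d : ℕ) : Set (Fin m → ℤ) := {γ | (∀ i, γ i ≤ 0) ∧ ∑ i, γ i = -d}

theorem mul_mem_negPart {d e : ℕ} {f g : Lau K (Fin m)} (hf : f ∈ suppIn K (negPart m d))
    (hg : g ∈ suppIn K (negPart m e)) : f * g ∈ suppIn K (negPart m (d + e)) := by
  refine mul_mem_suppIn (S := negPart m d) (T := negPart m e) (U := negPart m (d + e))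
    (fun a ha b hb => ⟨fun i => add_nonpos (ha.1 i) (hb.1 i), ?_⟩) hf hg
  simp only [Pi.add_apply, sum_add_distrib, ha.2, hb.2]
  omega

/-- Power series whose coefficient of `z^k` is a polynomial of degree `k` in the inverses of the
variables. -/
def InvGraded (G : PowerSeries (Lau K (Fin m))) : Prop :=
  ∀ k : ℕ, PowerSeries.coeff k G ∈ suppIn K (negPart m k)

theorem InvGraded.mul {G H : PowerSeries (Lau K (Fin m))} (hG : InvGraded G) (hH : InvGraded H) :
    InvGraded (G * H) := by
  intro k
  rw [PowerSeries.coeff_mul]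
  refine Submodule.sum_mem _ fun p hp => ?_
  rw [HasAntidiagonal.mem_antidiagonal] at hp
  rw [← hp]
  exact mul_mem_negPart (hG p.1) (hH p.2)

theorem invGraded_one : InvGraded (1 : PowerSeries (Lau K (Fin m))) := by
  intro k
  rw [PowerSeries.coeff_one]
  split_ifs with h
  · subst h
    exact xp_mem_suppIn (γ := 0) ⟨fun i => le_rfl, by simp⟩
  · exact Submodule.zero_mem _

theorem InvGraded.prod {α : Type*} (s : Finset α) {G : α → PowerSeries (Lau K (Fin m))}
    (hG : ∀ a ∈ s, InvGraded (G a)) : InvGraded (∏ a ∈ s, G a) :=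
  Finset.prod_induction G InvGraded (fun _ _ => InvGraded.mul) invGraded_one hG

theorem invGraded_geom (c : K) (j : Fin m) :
    InvGraded (geom (c • xp (-Pi.single j 1) : Lau K (Fin m))) := by
  intro k
  rw [geom, PowerSeries.coeff_mk, smul_pow, xp_pow]
  refine Submodule.smul_mem _ _ (xp_mem_suppIn ⟨fun i => ?_, ?_⟩)
  · simp only [Pi.smul_apply, Pi.neg_apply, Pi.single_apply]
    split_ifs <;> simp
  · simp [← Finset.mul_sum]

theorem invGraded_lin (c : K) (j : Fin m) :
    InvGraded (1 - PowerSeries.C (c • xp (-Pi.single j 1) : Lau K (Fin m)) * PowerSeries.X) := by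
  intro k
  rw [map_sub]
  refine Submodule.sub_mem _ (invGraded_one k) ?_
  rw [PowerSeries.coeff_C_mul, PowerSeries.coeff_X]
  split_ifs with h
  · subst h
    rw [mul_one]
    have := invGraded_geom c j 1
    rwa [geom, PowerSeries.coeff_mk, pow_one] at this
  · rw [mul_zero]
    exact Submodule.zero_mem _

theorem invGraded_ratioSeries (c d : K) :
    InvGraded (ratioSeries c d : PowerSeries (Lau K (Fin m))) :=
  (InvGraded.prod _ fun j _ => invGraded_lin c j).mul (InvGraded.prod _ fun j _ => invGraded_geom d j)

/-- The Laurent polynomials dual to the monomials `x^ν` with non-negative exponents, built one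
variable `z` at a time: `dualMono q ν` is the coefficient of `ξ^(ν 0)` in
`1 / (1 - ξ / z) ∏_j (1 - q ξ / x_j) / (1 - ξ / x_j)` times the dual monomial of the remaining
variables. -/
def dualMono (q : K) : {m : ℕ} → (Fin m → ℕ) → Lau K (Fin m)
  | 0, _ => 1
  | m + 1, ν => ∑ p ∈ antidiagonal (ν 0), xp (Pi.single 0 (-(p.1 : ℤ))) *
      inclSucc K m (PowerSeries.coeff p.2 (ratioSeries q 1) * dualMono q (fun i => ν i.succ))

theorem dualMono_succ (q : K) (ν : Fin (m + 1) → ℕ) :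
    dualMono q ν = ∑ p ∈ antidiagonal (ν 0), xp (Pi.single 0 (-(p.1 : ℤ))) *
      inclSucc K m (PowerSeries.coeff p.2 (ratioSeries q 1) * dualMono q (fun i => ν i.succ)) := by
  rw [dualMono]

theorem dualMono_mem (q : K) (ν : Fin m → ℕ) :
    dualMono q ν ∈ suppIn K (negPart m (∑ i, ν i)) := by
  induction m with
  | zero =>
    rw [dualMono]
    exact xp_mem_suppIn (γ := 0) ⟨fun i => le_rfl, by simp⟩
  | succ m ih =>
    rw [dualMono_succ]
    refine Submodule.sum_mem _ fun p hp => ?_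
    rw [HasAntidiagonal.mem_antidiagonal] at hp
    have h1 := mul_mem_negPart (invGraded_ratioSeries q 1 p.2) (ih fun i => ν i.succ)
    refine mul_mem_suppIn (S := {(Pi.single 0 (-(p.1 : ℤ)) : Fin (m + 1) → ℤ)})
      (T := negPart (m + 1) (p.2 + ∑ i : Fin m, ν i.succ))
      (U := negPart (m + 1) (∑ i, ν i)) (fun a ha b hb => ?_) (xp_mem_suppIn rfl)
      (mapX_mem_suppIn _ (S := negPart m (p.2 + ∑ i : Fin m, ν i.succ))
        (T := negPart (m + 1) (p.2 + ∑ i : Fin m, ν i.succ))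
        (fun a ha => ⟨fun i => ?_, ?_⟩) h1)
    · rw [Set.mem_singleton_iff] at ha
      subst ha
      refine ⟨fun i => add_nonpos ?_ (hb.1 i), ?_⟩
      · rw [Pi.single_apply]
        split_ifs <;> simp
      · simp only [Pi.add_apply, sum_add_distrib, hb.2, sum_pi_single', mem_univ, if_true,
          Fin.sum_univ_succ (fun i => ν i), ← hp]
        push_cast
        ring
    · refine Fin.cases (extz_succ_zero a).le (fun i => ?_) i
      rw [extz_apply _ (Fin.succ_injective m)]
      exact ha.1 i
    · rw [Fin.sum_univ_succ, extz_succ_zero, zero_add, ← ha.2]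
      exact sum_congr rfl fun i _ => extz_apply _ (Fin.succ_injective m) _ _

theorem ctDelta_first_of_pos (q : K) {k : ℤ} (hk : 0 < k) (G : Lau K (Fin m)) :
    ctDelta q (xp (Pi.single 0 k) * inclSucc K m G) = 0 :=
  ctDelta_eq_zero_of_first q (suppIn_mono
    (fun γ hγ => hk.trans_eq (Eq.symm hγ)) (xp_mul_mapX_succ_mem k G))

/-- The `dualMono q ν` are dual to the monomials with non-negative exponents. Taking the constant
term in the first variable produces the coefficients of the product of `ratioSeries 1 q` and
`ratioSeries q 1`, which is `1`. -/
theorem ctDelta_xp_mul_dualMono (q : K) (γ ν : Fin m → ℕ) :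
    ctDelta q (xp (fun i => (γ i : ℤ)) * dualMono q ν) = if γ = ν then 1 else 0 := by
  induction m with
  | zero =>
    have e : (fun i => (γ i : ℤ)) = (0 : Fin 0 → ℤ) := Subsingleton.elim _ _
    rw [dualMono, mul_one, e, xp_zero, ctDelta_one_zero, if_pos (Subsingleton.elim _ _)]
  | succ m ih =>
    have hxp : (xp (fun i => (γ i : ℤ)) : Lau K (Fin (m + 1))) =
        xp (Pi.single 0 (γ 0 : ℤ)) * inclSucc K m (xp fun i => (γ i.succ : ℤ)) := by
      rw [mapX_xp, ← xp_add]
      congr 1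
      funext i
      refine Fin.cases ?_ (fun j => ?_) i
      · rw [Pi.add_apply, Pi.single_eq_same, extz_succ_zero, add_zero]
      · rw [Pi.add_apply, Pi.single_eq_of_ne (Fin.succ_ne_zero j), zero_add,
          extz_apply _ (Fin.succ_injective m)]
    set k' := dualMono q (fun i => ν i.succ) with hk'
    set x' : Lau K (Fin m) := xp fun i => (γ i.succ : ℤ) with hx'
    have hterm : ∀ p : ℕ × ℕ, xp (Pi.single 0 (γ 0 : ℤ)) * inclSucc K m x' *
        (xp (Pi.single 0 (-(p.1 : ℤ))) *
          inclSucc K m (PowerSeries.coeff p.2 (ratioSeries q 1) * k')) =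
        xp (Pi.single 0 ((γ 0 : ℤ) - p.1)) *
          inclSucc K m (PowerSeries.coeff p.2 (ratioSeries q 1) * (x' * k')) := by
      intro p
      rw [sub_eq_add_neg, Pi.single_add, xp_add, map_mul, map_mul, map_mul]
      ring
    rw [dualMono_succ, hxp, mul_sum, map_sum]
    simp only [← hk', hterm]
    by_cases hle : γ 0 ≤ ν 0
    · obtain ⟨r, hr⟩ := Nat.exists_eq_add_of_le hle
      have h1 : ∑ p ∈ antidiagonal (ν 0), ctDelta q (xp (Pi.single 0 ((γ 0 : ℤ) - p.1)) *
          inclSucc K m (PowerSeries.coeff p.2 (ratioSeries q 1) * (x' * k'))) =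
          ∑ p ∈ antidiagonal r, ctDelta q (PowerSeries.coeff p.1 (ratioSeries 1 q) *
            (PowerSeries.coeff p.2 (ratioSeries q 1) * (x' * k'))) := by
        symm
        refine sum_of_injOn (fun p => (p.1 + γ 0, p.2)) ?_ ?_ ?_ ?_
        · rintro ⟨i, j⟩ _ ⟨i', j'⟩ _ h
          simpa using h
        · rintro ⟨i, j⟩ h
          simp only [mem_coe, HasAntidiagonal.mem_antidiagonal] at h ⊢
          omega
        · rintro ⟨i, j⟩ h h'
          rw [HasAntidiagonal.mem_antidiagonal] at h
          refine ctDelta_first_of_pos q ?_ _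
          by_contra hn
          refine h' ⟨(i - γ 0, j), ?_, ?_⟩
          · simp only [mem_coe, HasAntidiagonal.mem_antidiagonal] at h ⊢
            omega
          · simp only [Prod.mk.injEq, and_true]
            omega
        · rintro ⟨i, j⟩ _
          have e : (γ 0 : ℤ) - ((i + γ 0 : ℕ) : ℤ) = -(i : ℤ) := by push_cast; ring
          rw [e, ctDelta_first]
      have h2 : ∑ p ∈ antidiagonal r, ctDelta q (PowerSeries.coeff p.1 (ratioSeries 1 q) *
          (PowerSeries.coeff p.2 (ratioSeries q 1) * (x' * k'))) =
          ctDelta q (PowerSeries.coeff r (1 : PowerSeries (Lau K (Fin m))) * (x' * k')) := by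
        rw [← ratioSeries_mul_ratioSeries 1 q, PowerSeries.coeff_mul, sum_mul, map_sum]
        simp only [mul_assoc]
      rw [h1, h2, PowerSeries.coeff_one]
      have h3 := ih (fun i => γ i.succ) (fun i => ν i.succ)
      rw [← hx', ← hk'] at h3
      by_cases hr0 : r = 0
      · rw [if_pos hr0, one_mul, h3]
        refine if_congr ⟨fun h => ?_, fun h => by rw [h]⟩ rfl rfl
        funext i
        exact Fin.cases (by omega) (fun j => congrFun h j) i
      · rw [if_neg hr0, zero_mul, map_zero, if_neg]
        intro h
        rw [h] at hr
        omega
    · rw [if_neg (fun h => hle (by rw [h]))]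
      refine sum_eq_zero fun p hp => ctDelta_first_of_pos q ?_ _
      rw [HasAntidiagonal.mem_antidiagonal] at hp
      omega

theorem sum_piAntidiag_succ {M : Type*} [AddCommMonoid M] (d : ℕ) (F : (Fin (m + 1) → ℕ) → M) :
    ∑ ν ∈ piAntidiag univ d, F ν =
      ∑ p ∈ antidiagonal d, ∑ ν ∈ piAntidiag univ p.2, F (Fin.cons p.1 ν) := by
  rw [sum_sigma']
  refine sum_nbij' (fun ν => ⟨(ν 0, ∑ i : Fin m, ν i.succ), fun i => ν i.succ⟩)
    (fun x => Fin.cons x.1.1 x.2) ?_ ?_ ?_ ?_ ?_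
  · intro ν hν
    simp only [mem_piAntidiag, mem_univ, implies_true, and_true] at hν
    simp only [mem_sigma, HasAntidiagonal.mem_antidiagonal, mem_piAntidiag, mem_univ, implies_true,
      and_true]
    rw [← hν, Fin.sum_univ_succ]
  · rintro ⟨⟨a, b⟩, ν⟩ h
    simp only [mem_sigma, HasAntidiagonal.mem_antidiagonal, mem_piAntidiag, mem_univ, implies_true,
      and_true] at h ⊢
    rw [Fin.sum_univ_succ]
    simp [h]
  · intro ν _
    exact Fin.cons_self_tail ν
  · rintro ⟨⟨a, b⟩, ν⟩ h
    simp only [mem_sigma, HasAntidiagonal.mem_antidiagonal, mem_piAntidiag, mem_univ, implies_true,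
      and_true] at h
    obtain ⟨-, rfl⟩ := h
    simp
  · intro ν _
    exact congrArg F (Fin.cons_self_tail ν).symm

theorem map_ratioSeries {R : Type} [CommRing R] [Algebra K R] (θ : Lau K (Fin m) →ₐ[K] R) (c : K)
    (ξ : R) : PowerSeries.rescale ξ (PowerSeries.map θ.toRingHom (ratioSeries c 1)) =
      (∏ j : Fin m, (1 - PowerSeries.C (c • (ξ * θ (xp (-Pi.single j 1)))) * PowerSeries.X)) *
        ∏ j : Fin m, geom (ξ * θ (xp (-Pi.single j 1))) := by
  have hC : ∀ r : R, PowerSeries.rescale ξ (PowerSeries.C r) = PowerSeries.C r := fun r => by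
    ext k
    rw [PowerSeries.coeff_rescale, PowerSeries.coeff_C]
    split_ifs with h
    · rw [h, pow_zero, one_mul]
    · rw [mul_zero]
  rw [ratioSeries, linSeries, map_mul, map_mul, map_prod, map_prod, map_prod, map_prod]
  congr 1
  · refine prod_congr rfl fun j _ => ?_
    rw [map_sub, map_sub, map_one, map_one, map_mul, map_mul, PowerSeries.map_C, PowerSeries.map_X,
      hC, PowerSeries.rescale_X]
    have : θ.toRingHom (c • xp (-Pi.single j 1)) = c • θ (xp (-Pi.single j 1)) := map_smul θ _ _
    rw [this, ← mul_assoc, ← map_mul, smul_mul_assoc, mul_comm ξ]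
  · refine prod_congr rfl fun j _ => ?_
    rw [map_geom, one_smul]
    ext k
    rw [PowerSeries.coeff_rescale, geom, geom, PowerSeries.coeff_mk, PowerSeries.coeff_mk, mul_pow]
    rfl

/-- The generating function of the dual monomials. -/
theorem sum_dualMono {R : Type} [CommRing R] [Algebra K R] (q : K) (θ : Lau K (Fin m) →ₐ[K] R)
    (ξ : Fin m → R) (d : ℕ) :
    ∑ ν ∈ piAntidiag (univ : Finset (Fin m)) d, (∏ i, ξ i ^ ν i) * θ (dualMono q ν) =
      PowerSeries.coeff d
        ((∏ i : Fin m, ∏ j ∈ Ioi i,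
            (1 - PowerSeries.C (q • (ξ i * θ (xp (-Pi.single j 1)))) * PowerSeries.X)) *
          ∏ i : Fin m, ∏ j ∈ Ici i, geom (ξ i * θ (xp (-Pi.single j 1)))) := by
  induction m generalizing d with
  | zero =>
    simp only [univ_eq_empty, prod_empty, mul_one, one_mul, PowerSeries.coeff_one, dualMono,
      map_one, piAntidiag_empty, sum_const]
    split_ifs <;> simp
  | succ m ih =>
    set θ' := θ.comp (inclSucc K m) with hθ'
    have hθs : ∀ j : Fin m, θ' (xp (-Pi.single j 1)) = θ (xp (-Pi.single j.succ 1)) := fun j => by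
      rw [hθ', AlgHom.comp_apply, mapX_xp, map_neg, extz_single _ (Fin.succ_injective m)]
    set y₀ := θ (xp (-Pi.single 0 1)) with hy₀
    set B := (∏ i : Fin m, ∏ j ∈ Ioi i,
            (1 - PowerSeries.C (q • (ξ i.succ * θ' (xp (-Pi.single j 1)))) * PowerSeries.X)) *
          ∏ i : Fin m, ∏ j ∈ Ici i, geom (ξ i.succ * θ' (xp (-Pi.single j 1))) with hB
    set A := geom (ξ 0 * y₀) *
      PowerSeries.rescale (ξ 0) (PowerSeries.map θ'.toRingHom (ratioSeries q 1)) with hA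
    have hfact : (∏ i : Fin (m + 1), ∏ j ∈ Ioi i,
            (1 - PowerSeries.C (q • (ξ i * θ (xp (-Pi.single j 1)))) * PowerSeries.X)) *
          ∏ i : Fin (m + 1), ∏ j ∈ Ici i, geom (ξ i * θ (xp (-Pi.single j 1))) = A * B := by
      have hIci : ∏ j ∈ Ici (0 : Fin (m + 1)), geom (ξ 0 * θ (xp (-Pi.single j 1))) =
          geom (ξ 0 * y₀) * ∏ j : Fin m, geom (ξ 0 * θ (xp (-Pi.single j.succ 1))) := by
        have : Ici (0 : Fin (m + 1)) = univ := by ext; simp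
        rw [this, Fin.prod_univ_succ]
      have hIci' : ∀ (i : Fin m) (g : Fin (m + 1) → PowerSeries R),
          ∏ j ∈ Ici i.succ, g j = ∏ j ∈ Ici i, g j.succ := fun i g => by
        have : Ici i.succ = (Ici i).map (Fin.succEmb m) := by
          rw [Fin.map_succEmb_Ici]
        rw [this, prod_map]
        rfl
      rw [Fin.prod_univ_succ, Fin.prod_univ_succ, Fin.prod_Ioi_zero, hIci, hA, hB, map_ratioSeries]
      simp only [Fin.prod_Ioi_succ, hIci', hθs]
      ring
    have hcoeffA : ∀ k, PowerSeries.coeff k A = ξ 0 ^ k * ∑ p ∈ antidiagonal k, y₀ ^ p.1 *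
        θ' (PowerSeries.coeff p.2 (ratioSeries q 1)) := fun k => by
      rw [hA, PowerSeries.coeff_mul, mul_sum]
      refine sum_congr rfl fun p hp => ?_
      rw [HasAntidiagonal.mem_antidiagonal] at hp
      rw [geom, PowerSeries.coeff_mk, PowerSeries.coeff_rescale, PowerSeries.coeff_map, ← hp,
        pow_add, mul_pow]
      show _ * (_ * θ' _) = _
      ring
    rw [hfact, PowerSeries.coeff_mul, sum_piAntidiag_succ]
    refine sum_congr rfl fun p _ => ?_
    rw [hB, ← ih θ' (fun i => ξ i.succ) p.2, hcoeffA, mul_sum]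
    refine sum_congr rfl fun ν _ => ?_
    have hx : ∀ k : ℕ, θ (xp (Pi.single 0 (-(k : ℤ)))) = y₀ ^ k := fun k => by
      rw [hy₀, ← map_pow, xp_pow]
      congr 2
      rw [smul_neg, ← Pi.single_smul, Pi.single_neg]
      simp
    rw [dualMono_succ, map_sum, Fin.prod_univ_succ]
    simp only [Fin.cons_zero, Fin.cons_succ, map_mul θ, hx]
    have hi : ∀ f, θ (inclSucc K m f) = θ' f := fun f => rfl
    simp only [hi, map_mul θ', ← mul_assoc, ← sum_mul]
    ring

theorem sum_boxFin {M : Type*} [AddCommMonoid M] (d : ℕ) (F : (Fin m → ℤ) → M) :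
    ∑ a ∈ boxFin m 0 d d, F a = ∑ a ∈ piAntidiag (univ : Finset (Fin m)) d, F fun i => (a i : ℤ) := by
  symm
  refine sum_nbij' (fun a i => (a i : ℤ)) (fun a i => (a i).toNat) ?_ ?_ ?_ ?_ ?_
  · intro a ha
    simp only [mem_piAntidiag, mem_univ, implies_true, and_true] at ha
    refine mem_boxFin.2 ⟨fun i => ⟨by positivity, ?_⟩, ?_⟩
    · rw [← ha]
      show (a i : ℤ) ≤ _
      exact_mod_cast single_le_sum (f := a) (fun _ _ => Nat.zero_le _) (mem_univ i)
    · rw [← ha]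
      push_cast
      rfl
  · intro a ha
    have h := mem_boxFin.1 ha
    simp only [mem_piAntidiag, mem_univ, implies_true, and_true]
    zify
    rw [← h.2]
    exact sum_congr rfl fun i _ => Int.toNat_of_nonneg (h.1 i).1
  · intro a _
    simp
  · intro a ha
    have h := mem_boxFin.1 ha
    funext i
    exact Int.toNat_of_nonneg (h.1 i).1
  · intro a _
    rfl

theorem eq_sum_boxFin {N M d : ℤ} {f : Lau K (Fin m)} (hf : f ∈ suppIn K (box m N M d)) :
    f = ∑ γ ∈ boxFin m N M d, f.coeff γ • xp γ := by
  conv_lhs => rw [lau_eq_sum f]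
  refine sum_subset (fun γ hγ => mem_boxFin.2 (hf hγ)) fun γ _ hγ => ?_
  rw [Finsupp.notMem_support_iff.1 hγ, zero_smul]

/-- The Cauchy identity for the non-symmetric Hall–Littlewood polynomials and their duals. The sum
over two dual bases does not depend on the bases, so that it may be computed with the monomials
and the `dualMono q ν`. -/
theorem cauchy {q : K} (hq : q ≠ 0) {c : Fin m → ℝ} (hc : Narrow c) (hinj : Function.Injective c)
    {R : Type} [CommRing R] [Algebra K R] (θ₁ θ₂ : Lau K (Fin m) →ₐ[K] R) (d : ℕ) :
    ∑ a ∈ piAntidiag (univ : Finset (Fin m)) d,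
      θ₁ (genHL q (fun i => (a i : ℤ)) (fun i => ((a i : ℤ) : ℝ) + c i)) *
        θ₂ (genHL q (-fun i => (a i : ℤ)) (fun i => -(((a i : ℤ) : ℝ) + c i))) =
      PowerSeries.coeff d
        ((∏ i : Fin m, ∏ j ∈ Ioi i,
            (1 - PowerSeries.C (q • (θ₁ (xp (Pi.single i 1)) * θ₂ (xp (-Pi.single j 1)))) *
              PowerSeries.X)) *
          ∏ i : Fin m, ∏ j ∈ Ici i,
            geom (θ₁ (xp (Pi.single i 1)) * θ₂ (xp (-Pi.single j 1)))) := by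
  rw [← sum_dualMono]
  set E : (Fin m → ℤ) → Lau K (Fin m) := fun a => genHL q a (fun i => a i + c i) with hE
  set g : (Fin m → ℤ) → Lau K (Fin m) := fun a => genHL q (-a) (fun i => -(a i + c i)) with hg
  have hEmem : ∀ a ∈ boxFin m 0 d d, E a ∈ suppIn K (box m 0 d d) := fun a ha =>
    genHL_mem_box q _ _ (mem_boxFin.1 ha)
  have hdual : ∀ ν ∈ piAntidiag (univ : Finset (Fin m)) d,
      dualMono q ν = ∑ a ∈ boxFin m 0 d d, (E a).coeff (fun i => (ν i : ℤ)) • g a := by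
    intro ν hν
    simp only [mem_piAntidiag, mem_univ, implies_true, and_true] at hν
    have hmem : dualMono q ν ∈ suppIn K (Neg.neg '' box m 0 d d) := by
      refine suppIn_mono (S := negPart m (∑ i, ν i)) (T := Neg.neg '' box m 0 d d)
        (fun γ hγ => ⟨-γ, ⟨fun i => ?_, ?_⟩, neg_neg γ⟩) (dualMono_mem q ν)
      · have h1 := hγ.1 i
        have h2 := single_le_sum (f := fun i => -γ i)
          (fun i _ => by have := hγ.1 i; omega) (mem_univ i)
        rw [sum_neg_distrib, hγ.2, hν] at h2
        simp only [Pi.neg_apply]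
        omega
      · simp only [Pi.neg_apply, sum_neg_distrib, hγ.2, hν, neg_neg]
    rw [genHL_dual_expand hq hc hinj hmem]
    refine sum_congr rfl fun a ha => ?_
    congr 1
    conv_lhs => rw [show genHL q a (fun i => a i + c i) = E a from rfl,
      eq_sum_boxFin (hEmem a ha)]
    rw [sum_boxFin, sum_mul, map_sum]
    simp only [smul_mul_assoc, map_smul, ctDelta_xp_mul_dualMono, smul_eq_mul, mul_ite, mul_one,
      mul_zero]
    rw [sum_ite_eq', if_pos]
    simp [hν]
  have hxi : ∀ ν : Fin m → ℕ, ∏ i, θ₁ (xp (Pi.single i 1)) ^ ν i =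
      θ₁ (xp fun i => (ν i : ℤ)) := fun ν => by
    simp only [← map_pow, xp_pow]
    rw [← map_prod, ← xp_sum]
    congr 2
    funext i
    simp [Finset.sum_apply, Pi.single_apply]
  rw [← sum_boxFin d fun a => θ₁ (E a) * θ₂ (g a)]
  -- expand the first factor in monomials, exchange the sums, and collect the second factors to the
  -- dual monomials by `hdual`
  have h1 : ∀ a ∈ boxFin m 0 d d, θ₁ (E a) * θ₂ (g a) =
      ∑ ν ∈ piAntidiag (univ : Finset (Fin m)) d, θ₁ (xp fun i => (ν i : ℤ)) *
        ((E a).coeff (fun i => (ν i : ℤ)) • θ₂ (g a)) := by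
    intro a ha
    conv_lhs => rw [eq_sum_boxFin (hEmem a ha)]
    rw [sum_boxFin, map_sum, sum_mul]
    refine sum_congr rfl fun ν _ => ?_
    rw [map_smul, smul_mul_assoc, mul_smul_comm]
  rw [sum_congr rfl h1, sum_comm]
  refine sum_congr rfl fun ν hν => ?_
  rw [hxi, hdual ν hν, map_sum, mul_sum]
  refine sum_congr rfl fun a _ => ?_
  rw [map_smul]

end Cauchy

/-! ### The stable shuffle theorem -/

section Shuffle

variable {K : Type} [Field K] {n : ℕ}

/-- The series `∏_{i+1<j} (1 - q t x_i / x_j) / ∏_{i<j} (1 - t x_i / x_j)`. -/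
def catalanKernel (q : K) (n : ℕ) : PowerSeries (Lau K (Fin (n + 1))) :=
  (∏ i : Fin (n + 1), ∏ j ∈ univ.filter (fun j : Fin (n + 1) => (i : ℕ) + 1 < j),
    (1 - PowerSeries.C (q • xp (root i j)) * PowerSeries.X)) *
  ∏ i : Fin (n + 1), ∏ j ∈ Ioi i, geom (xp (root i j))

theorem catalanSeries_eq (q : K) (b : Weight n) :
    catalanSeries q b = PowerSeries.map (toRat K n).toRingHom
      (PowerSeries.C (xp b) * catalanKernel q n) := by
  have hinv : (∏ i : Fin (n + 1), ∏ j ∈ Ioi i,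
      (1 - PowerSeries.C (var i / var j : RatFn K n) * PowerSeries.X))⁻¹ =
      ∏ i : Fin (n + 1), ∏ j ∈ Ioi i, geom (toRat K n (xp (root i j))) := by
    rw [PowerSeries.inv_eq_iff_mul_eq_one, ← prod_mul_distrib]
    · refine prod_eq_one fun i _ => ?_
      rw [← prod_mul_distrib]
      refine prod_eq_one fun j _ => ?_
      rw [var_div_var, mul_comm, geom_mul]
    · simp [map_prod]
  have hC : ∀ f : Lau K (Fin (n + 1)), (toRat K n).toRingHom f = toRat K n f := fun f => rfl
  rw [catalanSeries, hinv, catalanKernel, map_mul, map_mul, PowerSeries.map_C, mono_eq, mul_assoc]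
  simp only [map_prod, map_sub, map_one, map_mul, PowerSeries.map_C, PowerSeries.map_X, map_geom,
    hC, map_smul, var_div_var, Algebra.smul_def]
  rfl

/-- The kernel is invariant under `x_i ↦ 1 / x_{l + 1 - i}`, which permutes the `x_i / x_j` with a
given `j - i`. -/
theorem map_flip_catalanKernel (q : K) :
    PowerSeries.map (flip (K := K) (n := n)).toRingHom (catalanKernel q n) = catalanKernel q n := by
  have hflip : ∀ i j : Fin (n + 1), (flip (K := K) (n := n)).toRingHom (xp (root i j)) =
      xp (root j.rev i.rev) := fun i j =>
    (flip_xp _).trans (congrArg xp (neg_root_comp_rev i j))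
  have hflip' : ∀ i j : Fin (n + 1), (flip (K := K) (n := n)).toRingHom (q • xp (root i j)) =
      q • xp (root j.rev i.rev) := fun i j => by
    rw [← hflip]
    exact map_smul flip _ _
  have hrev : ∀ i j : Fin (n + 1), ((j.rev : Fin (n + 1)) : ℕ) + 1 < i.rev ↔ (i : ℕ) + 1 < j := by
    intro i j
    simp only [Fin.val_rev]
    omega
  rw [catalanKernel, map_mul]
  congr 1
  · simp only [map_prod, map_sub, map_one, map_mul, PowerSeries.map_C, PowerSeries.map_X, hflip']
    rw [← Equiv.prod_comp Fin.revPerm]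
    have e : ∀ i : Fin (n + 1), ∏ j ∈ univ.filter (fun j : Fin (n + 1) => (i : ℕ) + 1 < j),
        (1 - PowerSeries.C (q • xp (root j.rev i.rev) : Lau K (Fin (n + 1))) * PowerSeries.X) =
        ∏ j : Fin (n + 1), if (j.rev : ℕ) + 1 < i.rev then
          (1 - PowerSeries.C (q • xp (root j.rev i.rev)) * PowerSeries.X) else 1 := fun i => by
      rw [prod_filter]
      exact prod_congr rfl fun j _ => if_congr (hrev i j).symm rfl rfl
    simp only [e, prod_filter]
    rw [Finset.prod_comm]
    rw [← Equiv.prod_comp Fin.revPerm]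
    simp
  · simp only [map_prod, map_geom, hflip]
    rw [prod_Ioi_eq_prod_filter, prod_Ioi_eq_prod_filter]
    refine prod_nbij' (fun p => (p.2.rev, p.1.rev)) (fun p => (p.2.rev, p.1.rev)) ?_ ?_ ?_ ?_ ?_
    · rintro ⟨i, j⟩ h
      simpa using h
    · rintro ⟨i, j⟩ h
      simpa using h
    · rintro ⟨i, j⟩ _
      simp
    · rintro ⟨i, j⟩ _
      simp
    · rintro ⟨i, j⟩ _
      rfl

/-- In terms of `x_1, …, x_n` and `x_2, …, x_{n+1}` the products run over the pairs `i < j` and `i ≤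
j`, as they do in the Cauchy identity. -/
theorem catalanKernel_eq (q : K) : catalanKernel q n =
    (∏ i : Fin n, ∏ j ∈ Ioi i,
      (1 - PowerSeries.C (q • xp (root i.castSucc j.succ)) * PowerSeries.X)) *
    ∏ i : Fin n, ∏ j ∈ Ici i, geom (xp (root i.castSucc j.succ)) := by
  have h1 : univ.filter (fun j : Fin (n + 1) => ((Fin.last n : Fin (n + 1)) : ℕ) + 1 < j) = ∅ :=
    filter_eq_empty_iff.2 fun j _ => by
      rw [Fin.val_last]
      omega
  have h2 : Ioi (Fin.last n) = ∅ := by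
    ext j
    simpa using Fin.le_last j
  have h3 : ∀ i : Fin n, univ.filter (fun j : Fin (n + 1) => ((i.castSucc : Fin (n + 1)) : ℕ) + 1 < j) =
      (Ioi i).map (Fin.succEmb n) := fun i => by
    ext j
    simp only [mem_filter, mem_univ, true_and, mem_map, mem_Ioi, Fin.coe_succEmb, Fin.val_castSucc]
    constructor
    · intro h
      refine ⟨j.pred (fun e => by simp [e] at h), ?_, Fin.succ_pred _ _⟩
      rw [Fin.lt_def, Fin.val_pred]
      omega
    · rintro ⟨k, hk, rfl⟩
      rw [Fin.lt_def] at hk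
      rw [Fin.val_succ]
      omega
  have h4 : ∀ i : Fin n, Ioi i.castSucc = (Ici i).map (Fin.succEmb n) := fun i => by
    ext j
    simp only [mem_map, mem_Ioi, mem_Ici, Fin.coe_succEmb]
    constructor
    · intro h
      rw [Fin.lt_def, Fin.val_castSucc] at h
      refine ⟨j.pred (fun e => by simp [e] at h), ?_, Fin.succ_pred _ _⟩
      rw [Fin.le_def, Fin.val_pred]
      omega
    · rintro ⟨k, hk, rfl⟩
      rw [Fin.le_def] at hk
      rw [Fin.lt_def, Fin.val_succ, Fin.val_castSucc]
      omega
  rw [catalanKernel, Fin.prod_univ_castSucc, Fin.prod_univ_castSucc, h1, h2, prod_empty, prod_empty,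
    mul_one, mul_one]
  simp only [h3, h4, prod_map, Fin.coe_succEmb]

/-- The coefficients of the Catalan function, as constant terms. -/
theorem catalanH_eq (q : K) (b : Weight n) (μ : DomWeight n) (d : ℕ) :
    hallLittlewoodSym q (PowerSeries.coeff d (catalanSeries q b)) μ =
      ctDelta q (charLau K μ * (xp (-(b ∘ Fin.rev)) *
        PowerSeries.coeff d (catalanKernel q n))) := by
  have h := congrArg (PowerSeries.coeff d) (map_flip_catalanKernel (n := n) q)
  rw [PowerSeries.coeff_map] at h
  rw [catalanSeries_eq, PowerSeries.coeff_map, PowerSeries.coeff_C_mul]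
  have h1 := hallLittlewoodSym_eq q (xp b * PowerSeries.coeff d (catalanKernel q n)) μ
  refine h1.trans ?_
  have h' : flip (PowerSeries.coeff d (catalanKernel q n)) =
    PowerSeries.coeff d (catalanKernel q n) := h
  rw [map_mul flip, flip_xp, h', mul_comm (charLau K μ)]

theorem narrow_of_eq {m : ℕ} {c d : Fin m → ℝ} (h : Narrow c) (x : ℝ) (e : ∀ i, d i = c i + x) :
    Narrow d := fun i j => by
  rw [e, e, add_sub_add_right_eq_sub]
  exact h i j

theorem narrow_of_eq_neg {m : ℕ} {c d : Fin m → ℝ} (h : Narrow c) (x : ℝ)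
    (e : ∀ i, d i = -c i + x) : Narrow d := fun i j => by
  have := h j i
  rw [e, e]
  linarith

/-- In the first argument the last variable splits off. -/
theorem genHL_snoc (q : K) {c : Fin (n + 1) → ℝ} (hc : Narrow c) (u : ℕ) (a : Fin n → ℕ) :
    genHL q (Fin.snoc (fun j => (a j : ℤ)) (-(u : ℤ)) : Fin (n + 1) → ℤ)
        (fun i => ((Fin.snoc (fun j => (a j : ℤ)) (-(u : ℤ)) : Fin (n + 1) → ℤ) i : ℝ) + c i) =
      xp (-Pi.single (Fin.last n) (u : ℤ)) * mapX (extz Fin.castSucc)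
        (genHL q (fun j => (a j : ℤ)) (fun j => ((a j : ℤ) : ℝ) + c j.castSucc)) := by
  set w : Fin (n + 1) → ℤ := Fin.snoc (fun j => (a j : ℤ)) (-(u : ℤ)) with hw
  have hlast : w (Fin.last n) = -(u : ℤ) := Fin.snoc_last _ _
  have hcast : ∀ j : Fin n, w j.castSucc = a j := fun j => Fin.snoc_castSucc _ _ _
  rw [genHL_castSucc q w _ (fun i => ?_) (narrow_of_eq hc 0 fun i => by ring), hlast,
    Pi.single_neg]
  · congr 3
    · exact funext hcast
    · funext j
      simp only [Function.comp, hcast]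
  · refine Fin.lastCases le_rfl (fun j => ?_) i
    rw [hlast, hcast]
    omega

/-- In the second argument the first variable splits off, after a shift by `b` which takes the
real vector `c` to its rotation by one step. -/
theorem genHL_cons (q : K) (b : Weight n) (D : Fin (n + 2) → ℝ) (p : ℝ) (hD : Narrow D)
    (hb : ∀ i : Fin (n + 1), D i.succ + b i = D i.castSucc + p) (v : ℕ) (a : Fin n → ℕ) :
    genHL q (-(b + (Fin.cons (-(v : ℤ)) fun j => (a j : ℤ) : Fin (n + 1) → ℤ)))
        (fun i => -(((b + (Fin.cons (-(v : ℤ)) fun j => (a j : ℤ) : Fin (n + 1) → ℤ)) i : ℝ) +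
          D i.succ)) =
      xp (-b) * xp (Pi.single 0 (v : ℤ)) * mapX (extz Fin.succ)
        (genHL q (-fun j => (a j : ℤ)) (fun j => -(((a j : ℤ) : ℝ) + D j.castSucc.succ))) := by
  set w : Fin (n + 1) → ℤ := -Fin.cons (-(v : ℤ)) fun j => (a j : ℤ) with hw
  have h0 : w 0 = v := by simp [hw]
  have hs : ∀ j : Fin n, w j.succ = -(a j : ℤ) := fun j => by simp [hw]
  have e1 : -(b + (Fin.cons (-(v : ℤ)) fun j => (a j : ℤ) : Fin (n + 1) → ℤ)) = w + -b := by
    rw [hw, neg_add, add_comm]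
  have e2 : (fun i : Fin (n + 1) =>
      -(((b + (Fin.cons (-(v : ℤ)) fun j => (a j : ℤ) : Fin (n + 1) → ℤ)) i : ℝ) + D i.succ)) =
      fun i => ((w i : ℝ) - D i.castSucc) + -p := by
    funext i
    have h1 := hb i
    have h2 : ((w i : ℤ) : ℝ) =
        -((Fin.cons (-(v : ℤ)) (fun j => (a j : ℤ)) : Fin (n + 1) → ℤ) i : ℝ) := by
      rw [hw, Pi.neg_apply, Int.cast_neg]
    rw [h2, Pi.add_apply, Int.cast_add]
    linarith
  have hn1 : Narrow fun i : Fin (n + 1) => ((w i : ℝ) - D i.castSucc) - w i :=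
    narrow_of_eq_neg (c := fun i => D i.castSucc) (fun i j => hD _ _) 0 fun i => by ring
  rw [e1, e2, genHL_shift q w (-b) _ (-p) hn1
    (narrow_of_eq_neg (c := fun i => D i.succ) (fun i j => hD _ _) 0 fun i => by
      have := hb i
      push_cast [Pi.neg_apply]
      linarith), genHL_succ q w _ (fun i => ?_) hn1, h0, mul_assoc]
  · congr 4
    funext j
    simp only [Function.comp, hs, Fin.succ_castSucc]
    push_cast
    ring
  · refine Fin.cases le_rfl (fun j => ?_) i
    rw [h0, hs]
    omega

/-- The stable shuffle theorem over an arbitrary field, with summation indices in increasing order.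
The vector `D` lists, from right to left, the fractional parts of the heights at which the line
meets the vertical lines, one more than there are variables. -/
theorem catalan_eq_sum_llt {q : K} (hq : q ≠ 0) {σ : Perm (Fin (n + 1))} (b : Weight n)
    (D : Fin (n + 2) → ℝ) (p : ℝ) (hD : Narrow D)
    (hb : ∀ i : Fin (n + 1), D i.succ + b i.rev = D i.castSucc + p)
    (hσ : ∀ i j, σ i < σ j ↔ D i.succ < D j.succ) (u v d : ℕ) (μ : DomWeight n) :
    hallLittlewoodSym q (PowerSeries.coeff d (catalanSeries q
        (b + Pi.single 0 (u : ℤ) - Pi.single (Fin.last n) (v : ℤ)))) μ =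
      ∑ a ∈ piAntidiag (univ : Finset (Fin n)) d,
        lltSeries q σ
          ((fun i => b i.rev) + (Fin.cons (-(v : ℤ)) (fun j => (a j : ℤ)) : Fin (n + 1) → ℤ))
          (Fin.snoc (fun j => (a j : ℤ)) (-(u : ℤ)) : Fin (n + 1) → ℤ) μ := by
  have hc : Narrow fun i : Fin (n + 1) => D i.succ := fun i j => hD _ _
  have hinj : Function.Injective fun j : Fin n => D j.castSucc.succ := fun i j h => by
    by_contra hne
    rcases lt_or_gt_of_ne (σ.injective.ne ((Fin.castSucc_injective n).ne hne)) with h1 | h1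
    · exact absurd h ((hσ _ _).1 h1).ne
    · exact absurd h ((hσ _ _).1 h1).ne'
  -- the substitution `x_i ↦ 1 / x_{l + 1 - i}` negates and reverses the weight, so that `u` moves
  -- to the last entry and `v` to the first one
  have hweight : -((b + Pi.single 0 (u : ℤ) - Pi.single (Fin.last n) (v : ℤ)) ∘ Fin.rev) =
      -Pi.single (Fin.last n) (u : ℤ) + (-(fun i => b i.rev) + Pi.single 0 (v : ℤ)) := by
    funext i
    have h1 : (i.rev = 0) = (i = Fin.last n) := by rw [Fin.rev_eq_iff, Fin.rev_zero]
    have h2 : (i.rev = Fin.last n) = (i = 0) := by rw [Fin.rev_eq_iff, Fin.rev_last]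
    simp only [Function.comp, Pi.add_apply, Pi.sub_apply, Pi.neg_apply, Pi.single_apply, h1, h2]
    ring
  have hroot : ∀ i j : Fin n, mapX (extz Fin.castSucc) (xp (Pi.single i 1) : Lau K (Fin n)) *
      mapX (extz Fin.succ) (xp (-Pi.single j 1)) = xp (root i.castSucc j.succ) := fun i j => by
    rw [mapX_xp, mapX_xp, map_neg, extz_single _ (Fin.castSucc_injective n),
      extz_single _ (Fin.succ_injective n), ← xp_add, root, sub_eq_add_neg]
  have hcauchy := cauchy hq (c := fun j : Fin n => D j.castSucc.succ) (fun i j => hD _ _) hinj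
    (mapX (extz Fin.castSucc)) (mapX (extz Fin.succ)) d
  simp only [hroot] at hcauchy
  rw [catalanH_eq, catalanKernel_eq, ← hcauchy, hweight, xp_add, xp_add, mul_sum, mul_sum, map_sum]
  refine sum_congr rfl fun a _ => ?_
  rw [lltSeries_eq hq hc hσ _ _ μ (toRat_charLau μ), genHL_snoc q hc u a,
    genHL_cons q (fun i => b i.rev) D p hD hb v a]
  congr 1
  ring

theorem sum_piAntidiag_rev {M : Type*} [AddCommMonoid M] (d : ℕ) (F : (Fin n → ℕ) → M) :
    ∑ a ∈ piAntidiag (univ : Finset (Fin n)) d, F (fun j => a j.rev) =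
      ∑ a ∈ piAntidiag (univ : Finset (Fin n)) d, F a := by
  refine sum_nbij' (fun a j => a j.rev) (fun a j => a j.rev) ?_ ?_ ?_ ?_ ?_
  · intro a ha
    simp only [mem_piAntidiag, mem_univ, implies_true, and_true] at ha ⊢
    rw [← ha]
    exact Equiv.sum_comp Fin.revPerm a
  · intro a ha
    simp only [mem_piAntidiag, mem_univ, implies_true, and_true] at ha ⊢
    rw [← ha]
    exact Equiv.sum_comp Fin.revPerm a
  · intro a _
    simp
  · intro a _
    simp
  · intro a _
    rfl

end Shuffle

end StableShuffle

end

open StableShuffle in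
theorem mainTheorem2 (n : ℕ) (p s : ℝ) (hp : 0 < p) (hirr : Irrational p)
    (b : Fin (n + 1) → ℤ)
    (hb : ∀ i, b i = ⌊s - p * ((i : ℕ) : ℝ)⌋ - ⌊s - p * (((i : ℕ) : ℝ) + 1)⌋)
    (c : Fin (n + 1) → ℝ) (hc : ∀ i, c i = Int.fract (s - p * ((i : ℕ) : ℝ)))
    (σ : Equiv.Perm (Fin (n + 1))) (hσ : ∀ i j, σ i < σ j ↔ c i.rev < c j.rev)
    (u v : ℕ) :
    (catalanH (RatFunc.X : RatFunc ℚ) (b + Pi.single 0 (u : ℤ) - Pi.single (Fin.last n) (v : ℤ)) :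
        CharSeries n (PowerSeries (RatFunc ℚ))) =
      fun μ => PowerSeries.mk fun d =>
        ∑ a ∈ Finset.piAntidiag (Finset.univ : Finset (Fin n)) d,
          lltSeries (RatFunc.X : RatFunc ℚ) σ
            ((fun i => b i.rev) +
              (Fin.cons (-(v : ℤ)) (fun j : Fin n => (a j.rev : ℤ)) : Fin (n + 1) → ℤ))
            (Fin.snoc (fun j : Fin n => (a j.rev : ℤ)) (-(u : ℤ)) : Fin (n + 1) → ℤ) μ := by
  funext μ
  rw [catalanH]
  congr 1
  funext d
  have hrev : ∀ i : Fin (n + 1), (((i.rev : Fin (n + 1)) : ℕ) : ℝ) = n - (i : ℕ) := fun i => by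
    have h1 : ((i.rev : Fin (n + 1)) : ℕ) + i = n := by
      rw [Fin.val_rev]
      omega
    have h2 : (((i.rev : Fin (n + 1)) : ℕ) : ℝ) + (i : ℕ) = n := by exact_mod_cast h1
    linarith
  -- the fractional parts of `s - p k`, for `k` decreasing from `n + 1` to `0`
  let D : Fin (n + 2) → ℝ := fun k => Int.fract (s - p * ((n : ℝ) + 1 - (k : ℕ)))
  have hDs : ∀ i : Fin (n + 1), D i.succ = c i.rev := fun i => by
    simp only [D]
    rw [hc, hrev, Fin.val_succ]
    push_cast
    congr 3
    ring
  have key := catalan_eq_sum_llt (RatFunc.X_ne_zero (K := ℚ)) (σ := σ) b D p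
    (fun i j => by
      have h1 := Int.fract_lt_one (s - p * ((n : ℝ) + 1 - (i : ℕ)))
      have h2 := Int.fract_nonneg (s - p * ((n : ℝ) + 1 - (j : ℕ)))
      simp only [D]
      linarith)
    (fun i => by
      have h1 : D i.castSucc = Int.fract (s - p * (((i.rev : Fin (n + 1)) : ℕ) + 1)) := by
        simp only [D]
        rw [hrev, Fin.val_castSucc]
        congr 3
        ring
      rw [hDs, h1, hc, hb, Int.fract, Int.fract]
      push_cast
      ring)
    (fun i j => by rw [hDs, hDs, hσ]) u v d μ
  rw [key, ← sum_piAntidiag_rev]
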